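/- **Theorem 3.1.** Let $(M,g)$ be a smooth oriented Riemannian four-manifold whose Weyl tensor $C_{abcd}$ is anti-self-dual, $C_{abcd}=-\tfrac12\epsilon_{ab}{}^{ef}C_{cdef}$, and vanishes at no point. *Notation.* Use the (local) identification $\mathbb C\otimes TM\cong\mathbb S\otimes\mathbb S'$, $g=\epsilon\otimes\epsilon'$, under which a vector index is a pair $a=AA'$ of spinor indices; $\mathbb S,\mathbb S'$ are complex rank-two bundles with symplectic forms $\epsilon_{AB},\epsilon_{A'B'}$, and the two-forms $\phi_{AB}\epsilon_{A'B'}$ with $\phi_{AB}=\phi_{BA}$ are the anti-self-dual ones. Frames of $\mathbb S,\mathbb S'$ are normalised by $\epsilon_{01}=\epsilon_{0'1'}=1$, indices are moved by $\mu^A=\epsilon^{AB}\mu_B$, $\mu_A=\mu^B\epsilon_{BA}$ (with $\epsilon^{01}=1$), and likewise for primed indices. $\nabla$ is the connection induced on spinors by the Levi-Civita connection ($\nabla\epsilon=\nabla\epsilon'=0$). Write $C_{abcd}=\psi_{ABCD}\,\epsilon_{A'B'}\epsilon_{C'D'}$ with $\psi_{ABCD}=\psi_{(ABCD)}$, and let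 $P_{ab}=\tfrac12\left(\mathrm{Ric}_{ab}-\tfrac16 R\,g_{ab}\right)$ be the Schouten tensor ($\mathrm{Ric}$ and $R$ positive on round spheres). Put $|\psi|^2=\psi_{ABCD}\psi^{ABCD}$ (which has no zeros) and $$W_{A'ABC}=\nabla_{A'}{}^{D}\psi_{ABCD},\qquad V_{AA'}=2|\psi|^{-2}\,\psi_A{}^{BCD}W_{A'BCD},$$ $$\mathcal R=\begin{pmatrix}\psi_{0000}&\psi_{0001}&-W_{0'000}&-W_{1'000}\\ \psi_{0001}&\psi_{0011}&-W_{0'001}&-W_{1'001}\\ \psi_{0011}&\psi_{0111}&-W_{0'011}&-W_{1'011}\\ \psi_{0111}&\psi_{1111}&-W_{0'111}&-W_{1'111}\end{pmatrix},$$ $$\Xi_{E'EABCD}=\nabla_{EE'}\psi_{ABCD}-W_{E'ABC}\,\epsilon_{DE},\qquad \Theta_{ABCEE'A'}=\psi_{ABCD}\,\epsilon^{DF}P_{(FA')(EE')}+\nabla_{EE'}W_{A'ABC},$$ where $P_{(FA')(EE')}$ denotes $P_{ab}$ with $a=FA'$, $b=EE'$. *Claim.* The metric $g$ is locally conformal to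 a Ricci-flat metric, that is, every point of $M$ has an open neighbourhood $U$ and a smooth function $\Omega:U\to(0,\infty)$ such that $\Omega^2g$ is Ricci-flat on $U$, if and only if, everywhere on $M$ (and in all normalised spin frames), both $$\det\mathcal R=0\qquad\text{and}\qquad \Xi_{E'EABCD}\,V^{D}{}_{A'}-\Theta_{ABCEE'A'}=0 .$$ -/

import Mathlib

open scoped Manifold ContDiff Matrix

noncomputable section

namespace ASDGravity

/-- The model space of a four-manifold. -/
abbrev Coord : Type := EuclideanSpace ℝ (Fin 4)

/-- The coordinate vector `∂_i`. -/
def dirVec (i : Fin 4) : Coord := EuclideanSpace.single i 1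

/-- The partial derivative `∂_i f` at `x`. -/
def pd (i : Fin 4) (f : Coord → ℝ) (x : Coord) : ℝ := fderiv ℝ f x (dirVec i)

/-! ### Riemannian geometry in coordinates

A metric in coordinates is a matrix valued function `G`.  A covariant tensor field of rank `r` is
given by its components `T x I = T_{I 0 … I (r-1)}(x)`, with multi-index `I : Fin r → Fin 4`. -/

/-- Components of a metric. -/
abbrev Metric : Type := Coord → Matrix (Fin 4) (Fin 4) ℝ

/-- Components of a covariant tensor field of rank `r`. -/
abbrev Tensor (r : ℕ) : Type := Coord → (Fin r → Fin 4) → ℝ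

/-- Christoffel symbols `Γ^k_{ij}` of the Levi-Civita connection. -/
def christoffel (G : Metric) (k i j : Fin 4) (x : Coord) : ℝ :=
  (1 / 2) * ∑ l, (G x)⁻¹ k l *
    (pd i (fun y => G y j l) x + pd j (fun y => G y i l) x - pd l (fun y => G y i j) x)

/-- Riemann tensor `R^l_{kij}`, where `R(∂_i, ∂_j) ∂_k = R^l_{kij} ∂_l` and
`R(X, Y) = ∇_X ∇_Y - ∇_Y ∇_X - ∇_{[X, Y]}`. -/
def riemann (G : Metric) (l k i j : Fin 4) (x : Coord) : ℝ :=
  pd i (christoffel G l j k) x - pd j (christoffel G l i k) x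
    + ∑ m, (christoffel G l i m x * christoffel G m j k x
      - christoffel G l j m x * christoffel G m i k x)

/-- Ricci tensor `R^i_{kij}` (positive on round spheres). -/
def ricci (G : Metric) (k j : Fin 4) (x : Coord) : ℝ := ∑ i, riemann G i k i j x

/-- Scalar curvature (positive on round spheres). -/
def scalarCurv (G : Metric) (x : Coord) : ℝ := ∑ i, ∑ j, (G x)⁻¹ i j * ricci G i j x

/-- Schouten tensor `P_{ij} = (1/2) (Ric_{ij} - (1/6) R g_{ij})` in dimension four.  In the opposite
sign convention for the Ricci tensor this reads `(1/12) R g_{ij} - (1/2) R_{ij}`. -/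
def schouten (G : Metric) (x : Coord) (i j : Fin 4) : ℝ :=
  (1 / 2) * (ricci G i j x - (1 / 6) * scalarCurv G x * G x i j)

/-- Weyl tensor `C_{ijkl}`, all indices down. -/
def weyl (G : Metric) : Tensor 4 := fun x I =>
  (∑ m, G x (I 0) m * riemann G m (I 1) (I 2) (I 3) x)
    - (G x (I 0) (I 2) * schouten G x (I 1) (I 3) - G x (I 0) (I 3) * schouten G x (I 1) (I 2)
      + G x (I 1) (I 3) * schouten G x (I 0) (I 2) - G x (I 1) (I 2) * schouten G x (I 0) (I 3))

/-- Levi-Civita covariant derivative of a covariant tensor field; the index of differentiation is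
the first index of the result: `(∇T)_{m I} = ∇_m T_I`. -/
def covD (G : Metric) {r : ℕ} (T : Tensor r) : Tensor (r + 1) := fun x J =>
  pd (J 0) (fun y => T y (Fin.tail J)) x
    - ∑ s : Fin r, ∑ n, christoffel G n (J 0) (J s.succ) x
        * T x (Function.update (Fin.tail J) s n)

/-- Volume form `ε_{ijkl}` of the metric for the orientation of the coordinates; the
determinant is the totally antisymmetric symbol, with value `1` at `(0, 1, 2, 3)`. -/
def volForm (G : Metric) : Tensor 4 := fun x I =>
  Real.sqrt (G x).det * Matrix.det (Matrix.of fun a b : Fin 4 => if I a = b then (1 : ℝ) else 0)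

/-- Anti-self-duality at `x`: `C_{ijkl} = -(1/2) ε_{ij}^{mn} C_{klmn}`. -/
def WeylASDAt (G : Metric) (x : Coord) : Prop :=
  ∀ i j k l : Fin 4, weyl G x ![i, j, k, l] =
    -(1 / 2) * ∑ p, ∑ q, ∑ m, ∑ n,
      volForm G x ![i, j, p, q] * (G x)⁻¹ p m * (G x)⁻¹ q n * weyl G x ![k, l, m, n]

/-! ### Spinors -/

/-- The symplectic form on spinors in a normalised frame: `ε_{01} = 1`.  The components of
`ε_{AB}`, `ε^{AB}`, `ε_{A'B'}`, `ε^{A'B'}` all coincide.  Indices are moved by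
`μ^A = ε^{AB} μ_B` and `μ_A = μ^B ε_{BA}`. -/
def eps (A B : Fin 2) : ℂ := !![0, 1; -1, 0] A B

/-- Spinor components `T_{A₁A₁'…AᵣAᵣ'}` of a covariant tensor, with respect to vectors
`σ A A'` (components `σ A A' i`). -/
def spinComp (σ : Fin 2 → Fin 2 → Fin 4 → ℂ) {r : ℕ} (T : (Fin r → Fin 4) → ℝ)
    (A A' : Fin r → Fin 2) : ℂ :=
  ∑ I : Fin r → Fin 4, (∏ s, σ (A s) (A' s) (I s)) * (T I : ℂ)

/-- A pair of normalised frames of the spin spaces `S`, `S'` at `x`, given through the isomorphism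
`S ⊗ S' ≅ ℂ ⊗ T_x`: the complex tangent vectors `σ A A'` are the images of the products of the
frame spinors.  The first condition says `g = ε ⊗ ε'`.  The second one is the choice of
orientation, for which the two-forms `φ_{AB} ε_{A'B'}` are the anti-self-dual ones (and
`φ_{A'B'} ε_{AB}` the self-dual ones). -/
structure SpinFrame (G : Metric) (x : Coord) where
  σ : Fin 2 → Fin 2 → Fin 4 → ℂ
  metric_eq : ∀ A A' B B', ∑ i, ∑ j, (G x i j : ℂ) * σ A A' i * σ B B' j = eps A B * eps A' B'
  oriented : spinComp σ (volForm G x) ![0, 0, 1, 1] ![0, 1, 0, 1] = -1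

variable {G : Metric} {x : Coord}

/-- The spinor `ψ_{ABCD}` in `C_{abcd} = ψ_{ABCD} ε_{A'B'} ε_{C'D'}`. -/
def psi (e : SpinFrame G x) (A B C D : Fin 2) : ℂ :=
  (1 / 4) * ∑ A', ∑ B', ∑ C', ∑ D', eps A' B' * eps C' D' *
    spinComp e.σ (weyl G x) ![A, B, C, D] ![A', B', C', D']

/-- `∇_{EE'} ψ_{ABCD}`.  The connection on spinors is the one induced by the Levi-Civita connection,
with `∇ε = 0` and `∇ε' = 0`, so that `∇_e C_{abcd} = (∇_{EE'} ψ_{ABCD}) ε_{A'B'} ε_{C'D'}`. -/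
def dPsi (e : SpinFrame G x) (E E' A B C D : Fin 2) : ℂ :=
  (1 / 4) * ∑ A', ∑ B', ∑ C', ∑ D', eps A' B' * eps C' D' *
    spinComp e.σ (covD G (weyl G) x) ![E, A, B, C, D] ![E', A', B', C', D']

/-- `∇_{FF'} ∇_{EE'} ψ_{ABCD}`, from
`∇_f ∇_e C_{abcd} = (∇_{FF'} ∇_{EE'} ψ_{ABCD}) ε_{A'B'} ε_{C'D'}`. -/
def ddPsi (e : SpinFrame G x) (F F' E E' A B C D : Fin 2) : ℂ :=
  (1 / 4) * ∑ A', ∑ B', ∑ C', ∑ D', eps A' B' * eps C' D' *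
    spinComp e.σ (covD G (covD G (weyl G)) x) ![F, E, A, B, C, D] ![F', E', A', B', C', D']

/-- `W_{A'ABC} = ∇_{A'}^D ψ_{ABCD}`. -/
def W (e : SpinFrame G x) (A' A B C : Fin 2) : ℂ :=
  ∑ D, ∑ E, eps D E * dPsi e E A' A B C D

/-- `∇_{EE'} W_{A'ABC}`. -/
def dW (e : SpinFrame G x) (E E' A' A B C : Fin 2) : ℂ :=
  ∑ D, ∑ F, eps D F * ddPsi e E E' F A' A B C D

/-- `|ψ|² = ψ_{ABCD} ψ^{ABCD}`. -/
def normSqPsi (e : SpinFrame G x) : ℂ :=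
  ∑ A, ∑ B, ∑ C, ∑ D, ∑ E, ∑ F, ∑ H, ∑ K,
    eps A E * eps B F * eps C H * eps D K * psi e A B C D * psi e E F H K

/-- `V_{AA'} = 2 |ψ|⁻² ψ_A^{BCD} W_{A'BCD}`. -/
def V (e : SpinFrame G x) (A A' : Fin 2) : ℂ :=
  2 / normSqPsi e * ∑ B, ∑ C, ∑ D, ∑ F, ∑ H, ∑ K,
    eps B F * eps C H * eps D K * psi e A F H K * W e A' B C D

/-- `V^D_{A'}`. -/
def Vup (e : SpinFrame G x) (D A' : Fin 2) : ℂ := ∑ E, eps D E * V e E A'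

/-- The Schouten tensor `P_{ab}` with `a = AA'`, `b = BB'`. -/
def pSpin (e : SpinFrame G x) (A A' B B' : Fin 2) : ℂ :=
  ∑ i, ∑ j, e.σ A A' i * e.σ B B' j * (schouten G x i j : ℂ)

/-- The matrix of the linear system `ψ_{ABCD} α^D - W_{A'ABC} π^{A'} = 0` for
`(α^0, α^1, π^{0'}, π^{1'})`. -/
def curvMatrix (e : SpinFrame G x) : Matrix (Fin 4) (Fin 4) ℂ :=
  !![psi e 0 0 0 0, psi e 0 0 0 1, -W e 0 0 0 0, -W e 1 0 0 0;
     psi e 0 0 0 1, psi e 0 0 1 1, -W e 0 0 0 1, -W e 1 0 0 1;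
     psi e 0 0 1 1, psi e 0 1 1 1, -W e 0 0 1 1, -W e 1 0 1 1;
     psi e 0 1 1 1, psi e 1 1 1 1, -W e 0 1 1 1, -W e 1 1 1 1]

/-- `Ξ_{E'EABCD} = ∇_{EE'} ψ_{ABCD} - W_{E'ABC} ε_{DE}`. -/
def Xi (e : SpinFrame G x) (E' E A B C D : Fin 2) : ℂ :=
  dPsi e E E' A B C D - W e E' A B C * eps D E

/-- `Θ_{ABCEE'A'} = ψ_{ABCD} P^D_{A' EE'} + ∇_{EE'} W_{A'ABC}`; the index pairs of the tensor
`P` are `DA'` and `EE'`. -/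
def Theta (e : SpinFrame G x) (A B C E E' A' : Fin 2) : ℂ :=
  (∑ D, psi e A B C D * ∑ F, eps D F * pSpin e F A' E E') + dW e E E' A' A B C

/-! ### Manifolds -/

section Manifold

variable (M : Type*) [TopologicalSpace M] [ChartedSpace Coord M]

/-- An oriented atlas: all transition maps have positive Jacobian. -/
def IsOrientedAtlas : Prop :=
  ∀ φ ∈ atlas Coord M, ∀ φ' ∈ atlas Coord M, ∀ x ∈ (φ.symm.trans φ').source,
    0 < (fderiv ℝ (φ.symm.trans φ') x).det

/-- A field of bilinear forms on the tangent spaces. -/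
abbrev BilinField : Type _ :=
  ∀ p : M, TangentSpace (𝓡 4) p →L[ℝ] TangentSpace (𝓡 4) p →L[ℝ] ℝ

variable {M}

/-- Components `h_{ij} = h(∂_i, ∂_j)` in a chart. -/
def inChart (h : BilinField M) (φ : OpenPartialHomeomorph M Coord) : Metric := fun x =>
  Matrix.of fun i j => h (φ.symm x) (mfderiv (𝓡 4) (𝓡 4) φ.symm x (dirVec i))
    (mfderiv (𝓡 4) (𝓡 4) φ.symm x (dirVec j))

/-- The Weyl tensor is anti-self-dual, for the orientation given by the atlas. -/
def IsASD (h : BilinField M) : Prop :=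
  ∀ φ ∈ atlas Coord M, ∀ x ∈ φ.target, WeylASDAt (inChart h φ) x

/-- The Weyl tensor has no zeros. -/
def WeylNeZero (h : BilinField M) : Prop :=
  ∀ φ ∈ atlas Coord M, ∀ x ∈ φ.target, weyl (inChart h φ) x ≠ 0

/-- The Ricci tensor vanishes on `U`. -/
def RicciFlatOn (h : BilinField M) (U : Set M) : Prop :=
  ∀ φ ∈ atlas Coord M, ∀ x ∈ φ.target, φ.symm x ∈ U →
    ∀ i j, ricci (inChart h φ) i j x = 0

/-- Every point has a neighbourhood on which a conformal rescaling `Ω² h`, with `Ω` smooth and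
positive, is Ricci-flat. -/
def LocallyConformallyRicciFlat (h : BilinField M) : Prop :=
  ∀ p : M, ∃ U : Set M, IsOpen U ∧ p ∈ U ∧ ∃ Ω : M → ℝ,
    ContMDiffOn (𝓡 4) 𝓘(ℝ, ℝ) ∞ Ω U ∧ (∀ q ∈ U, 0 < Ω q) ∧
    RicciFlatOn (fun q => (Ω q) ^ 2 • h q) U

end Manifold

end ASDGravity

end

/-! A rescaled metric exp(2f)g is Ricci-flat exactly when P_ij - ∇_i∂_j f + ∂_i f ∂_j f - (1/2)|df|²
g_ij = 0 (`ricci_conf_eq_zero_iff`). With v = -df the left side is `obstr`, that is P_ij + ∇_j v_i +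
v_i v_j - (1/2)|v|² g_ij. Conversely, if `obstr` vanishes for some covector field v, its
antisymmetric part says that v is closed, so locally v = -df. Everything therefore turns on finding
v, and the point is that the Weyl tensor determines it.

If exp(2f)g is Ricci-flat, its Riemann tensor is the Weyl tensor, and the contracted Bianchi
identity, rewritten with the connection of g, becomes ∇^d C_abcd = C_abcd v^d
(`divEq_of_ricci_conf`). Since ∇ commutes with the Hodge star, C and its covariant derivatives are
all anti-self-dual of Weyl type (`IsASDType.nab`), hence given by totally symmetric spinors, and the
equation reads W_{A'ABC} = ψ_{ABCD} v^D_{A'} (`divEq_iff`). In Riemannian signature |C|² = 4|ψ|² is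
nonzero wherever C is (`normSqPsi_ne_zero`), and ψ_{ABCD} contracted with its own first three
indices is a multiple of |ψ|² ε, so ψ is injective on spinors (`psi_injective`) and v must be V
(`V_eq`).

Determinant condition. A solution v puts (v^D_{0'}, 1, 0) in the kernel of the matrix. Conversely
one kernel vector (α, π) solves the equation only in the direction π; the quaternionic conjugation
of Euclidean spinors yields a second kernel vector with independent π, and the two together give a
solution (`exists_eq_of_det_eq_zero`). It can be taken real (`exists_divEq`) and smooth
(`exists_smooth_divEq`).

Second condition. Differentiating W = ψ V and substituting gives Ξ V - Θ = -ψ · `obstr`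
(`second_condition_eq`), so by injectivity of ψ the condition is `obstr` = 0.

The equivalence is thus proved in a coordinate domain, with the Poincaré lemma on a ball supplying
f. Ricci-flatness in the remaining charts follows from the transformation law of the curvature
(`IsPullback.ricci_eq_zero`). -/

noncomputable section

namespace ASDGravity

/-! ### Partial derivatives of smooth functions -/

variable {O : Set Coord} {f h : Coord → ℝ} {x : Coord}

/-- Smoothness on a set of a function of the coordinates. -/
def Sm (O : Set Coord) (f : Coord → ℝ) : Prop := ContDiffOn ℝ ∞ f O

lemma Sm.differentiableAt (hf : Sm O f) (hO : IsOpen O) (hx : x ∈ O) : DifferentiableAt ℝ f x :=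
  ((hf.contDiffAt (hO.mem_nhds hx)).differentiableAt (by simp))

lemma Sm.const (c : ℝ) : Sm O (fun _ => c) := contDiffOn_const

lemma Sm.add (hf : Sm O f) (hh : Sm O h) : Sm O (fun y => f y + h y) := ContDiffOn.add hf hh

lemma Sm.sub (hf : Sm O f) (hh : Sm O h) : Sm O (fun y => f y - h y) := ContDiffOn.sub hf hh

lemma Sm.neg (hf : Sm O f) : Sm O (fun y => - f y) := ContDiffOn.neg hf

lemma Sm.mul (hf : Sm O f) (hh : Sm O h) : Sm O (fun y => f y * h y) := ContDiffOn.mul hf hh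

lemma Sm.sum {ι : Type*} [Fintype ι] {F : ι → Coord → ℝ} (hF : ∀ a, Sm O (F a)) :
    Sm O (fun y => ∑ a, F a y) := ContDiffOn.sum fun a _ => hF a

lemma Sm.inv (hf : Sm O f) (h0 : ∀ y ∈ O, f y ≠ 0) : Sm O (fun y => (f y)⁻¹) :=
  ContDiffOn.inv hf h0

lemma Sm.congr (hf : Sm O f) (e : ∀ y ∈ O, h y = f y) : Sm O h := ContDiffOn.congr hf e

lemma Sm.mono {O' : Set Coord} (hf : Sm O f) (e : O' ⊆ O) : Sm O' f := ContDiffOn.mono hf e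

lemma Sm.pd (hf : Sm O f) (hO : IsOpen O) (i : Fin 4) : Sm O (pd i f) := by
  have := hf.fderiv_of_isOpen (m := ∞) hO (by simp)
  exact this.clm_apply contDiffOn_const

lemma pd_congr (hO : IsOpen O) (hx : x ∈ O) (e : ∀ y ∈ O, f y = h y) (i : Fin 4) :
    pd i f x = pd i h x := by
  unfold pd
  rw [Filter.EventuallyEq.fderiv_eq]
  filter_upwards [hO.mem_nhds hx] with y hy using e y hy

lemma pd_const (c : ℝ) (i : Fin 4) : pd i (fun _ => c) x = 0 := by simp [pd]

lemma pd_eq_zero (hO : IsOpen O) (hx : x ∈ O) (e : ∀ y ∈ O, f y = 0) (i : Fin 4) :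
    pd i f x = 0 := by
  rw [pd_congr hO hx (h := fun _ => 0) e, pd_const]

lemma pd_add (hO : IsOpen O) (hx : x ∈ O) (hf : Sm O f) (hh : Sm O h) (i : Fin 4) :
    pd i (fun y => f y + h y) x = pd i f x + pd i h x := by
  unfold pd
  rw [fderiv_fun_add (hf.differentiableAt hO hx) (hh.differentiableAt hO hx)]; rfl

lemma pd_sub (hO : IsOpen O) (hx : x ∈ O) (hf : Sm O f) (hh : Sm O h) (i : Fin 4) :
    pd i (fun y => f y - h y) x = pd i f x - pd i h x := by
  unfold pd
  rw [fderiv_fun_sub (hf.differentiableAt hO hx) (hh.differentiableAt hO hx)]; rfl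

lemma pd_neg (i : Fin 4) : pd i (fun y => - f y) x = - pd i f x := by
  unfold pd
  rw [fderiv_fun_neg]; rfl

lemma pd_mul (hO : IsOpen O) (hx : x ∈ O) (hf : Sm O f) (hh : Sm O h) (i : Fin 4) :
    pd i (fun y => f y * h y) x = pd i f x * h x + f x * pd i h x := by
  unfold pd
  rw [fderiv_fun_mul (hf.differentiableAt hO hx) (hh.differentiableAt hO hx)]
  simp; ring

lemma pd_sum (hO : IsOpen O) (hx : x ∈ O) {ι : Type*} [Fintype ι] {F : ι → Coord → ℝ}
    (hF : ∀ a, Sm O (F a)) (i : Fin 4) :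
    pd i (fun y => ∑ a, F a y) x = ∑ a, pd i (F a) x := by
  unfold pd
  rw [fderiv_fun_sum fun a _ => (hF a).differentiableAt hO hx]; simp

lemma pd_comm (hO : IsOpen O) (hx : x ∈ O) (hf : Sm O f) (i j : Fin 4) :
    pd i (pd j f) x = pd j (pd i f) x := by
  have hc : ContDiffAt ℝ ∞ f x := hf.contDiffAt (hO.mem_nhds hx)
  have hd : DifferentiableAt ℝ (fderiv ℝ f) x :=
    (hc.fderiv_right (m := 1) (by norm_cast)).differentiableAt (by simp)
  have hs : IsSymmSndFDerivAt ℝ f x := by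
    apply hc.isSymmSndFDerivAt
    simp only [minSmoothness_of_isRCLikeNormedField]
    exact WithTop.coe_le_coe.2 le_top
  have key : ∀ a b : Fin 4, pd a (pd b f) x = fderiv ℝ (fderiv ℝ f) x (dirVec a) (dirVec b) := by
    intro a b
    have e : pd b f = fun y => fderiv ℝ f y (dirVec b) := rfl
    rw [e]; unfold pd
    rw [fderiv_clm_apply hd (by fun_prop)]
    simp
  rw [key, key, hs.eq]

/-! ### Matrix valued functions -/

abbrev Mat : Type := Matrix (Fin 4) (Fin 4) ℝ

/-- Entrywise smoothness on a set of a matrix valued function. -/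
def SmM (O : Set Coord) (M : Coord → Mat) : Prop := ∀ a b, Sm O (fun y => M y a b)

/-- Entrywise partial derivative of a matrix valued function. -/
def pdM (i : Fin 4) (M : Coord → Mat) (x : Coord) : Mat :=
  Matrix.of fun a b => pd i (fun y => M y a b) x

variable {M N : Coord → Mat}

lemma SmM.add (hM : SmM O M) (hN : SmM O N) : SmM O (fun y => M y + N y) :=
  fun a b => (hM a b).add (hN a b)

lemma SmM.sub (hM : SmM O M) (hN : SmM O N) : SmM O (fun y => M y - N y) :=
  fun a b => (hM a b).sub (hN a b)

lemma SmM.mul (hM : SmM O M) (hN : SmM O N) : SmM O (fun y => M y * N y) := by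
  intro a b
  simp only [Matrix.mul_apply]
  exact Sm.sum fun c => (hM a c).mul (hN c b)

lemma SmM.transpose (hM : SmM O M) : SmM O (fun y => (M y)ᵀ) := fun a b => hM b a

lemma SmM.pdM (hM : SmM O M) (hO : IsOpen O) (i : Fin 4) : SmM O (pdM i M) :=
  fun a b => (hM a b).pd hO i

lemma Sm.prod {ι : Type*} (s : Finset ι) {F : ι → Coord → ℝ} (hF : ∀ a, Sm O (F a)) :
    Sm O (fun y => ∏ a ∈ s, F a y) := contDiffOn_prod fun a _ => hF a

lemma SmM.det (hM : SmM O M) : Sm O (fun y => (M y).det) := by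
  simp only [Matrix.det_apply, Units.smul_def, zsmul_eq_mul]
  exact Sm.sum fun p => (Sm.const _).mul (Sm.prod _ fun a => hM _ _)

/-- Cramer's rule: the inverse is the adjugate over the determinant, and the entries of the adjugate
are determinants of matrices with smooth entries. -/
lemma SmM.inv (hM : SmM O M) (h0 : ∀ y ∈ O, (M y).det ≠ 0) : SmM O (fun y => (M y)⁻¹) := by
  intro a b
  have e : (fun y => (M y)⁻¹ a b) = fun y => ((M y).det)⁻¹ * (M y).adjugate a b := by
    funext y
    rw [Matrix.inv_def]; simp
  rw [e]
  refine (hM.det.inv h0).mul ?_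
  simp only [Matrix.adjugate_apply]
  apply SmM.det
  intro c d
  by_cases hc : c = b
  · subst hc; simp [Sm.const]
  · simpa [Matrix.updateRow_apply, hc] using hM c d

lemma pdM_congr (hO : IsOpen O) (hx : x ∈ O) (e : ∀ y ∈ O, M y = N y) (i : Fin 4) :
    pdM i M x = pdM i N x := by
  ext a b
  exact pd_congr hO hx (fun y hy => by rw [e y hy]) i

lemma pdM_add (hO : IsOpen O) (hx : x ∈ O) (hM : SmM O M) (hN : SmM O N) (i : Fin 4) :
    pdM i (fun y => M y + N y) x = pdM i M x + pdM i N x := by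
  ext a b
  exact pd_add hO hx (hM a b) (hN a b) i

lemma pdM_sub (hO : IsOpen O) (hx : x ∈ O) (hM : SmM O M) (hN : SmM O N) (i : Fin 4) :
    pdM i (fun y => M y - N y) x = pdM i M x - pdM i N x := by
  ext a b
  exact pd_sub hO hx (hM a b) (hN a b) i

lemma pdM_const (c : Mat) (i : Fin 4) : pdM i (fun _ => c) x = 0 := by
  ext a b
  exact pd_const _ i

lemma pdM_mul (hO : IsOpen O) (hx : x ∈ O) (hM : SmM O M) (hN : SmM O N) (i : Fin 4) :
    pdM i (fun y => M y * N y) x = pdM i M x * N x + M x * pdM i N x := by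
  ext a b
  simp only [pdM, Matrix.mul_apply, Matrix.of_apply, Matrix.add_apply]
  rw [pd_sum hO hx fun c => (hM a c).mul (hN c b), ← Finset.sum_add_distrib]
  exact Finset.sum_congr rfl fun c _ => pd_mul hO hx (hM a c) (hN c b) i

lemma pdM_transpose (i : Fin 4) : pdM i (fun y => (M y)ᵀ) x = (pdM i M x)ᵀ := rfl

lemma pdM_comm (hO : IsOpen O) (hx : x ∈ O) (hM : SmM O M) (i j : Fin 4) :
    pdM i (pdM j M) x = pdM j (pdM i M) x := by
  ext a b
  exact pd_comm hO hx (hM a b) i j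

lemma pdM_inv (hO : IsOpen O) (hx : x ∈ O) (hM : SmM O M) (h0 : ∀ y ∈ O, (M y).det ≠ 0)
    (i : Fin 4) : pdM i (fun y => (M y)⁻¹) x = - ((M x)⁻¹ * pdM i M x * (M x)⁻¹) := by
  have h1 := pdM_mul hO hx hM (hM.inv h0) i
  have h2 : pdM i (fun y => M y * (M y)⁻¹) x = 0 := by
    rw [pdM_congr hO hx (N := fun _ => 1), pdM_const]
    exact fun y hy => Matrix.mul_nonsing_inv _ (IsUnit.mk0 _ (h0 y hy))
  have hi : (M x)⁻¹ * M x = 1 := Matrix.nonsing_inv_mul _ (IsUnit.mk0 _ (h0 x hx))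
  rw [h2] at h1
  have h3 := congrArg (fun Z => (M x)⁻¹ * Z) h1
  simp only [mul_zero, mul_add, ← mul_assoc, hi, one_mul] at h3
  rw [eq_neg_iff_add_eq_zero, add_comm, ← h3]

end ASDGravity

end

/-! ### Levi-Civita connection and curvature identities, in matrix form -/

noncomputable section

namespace ASDGravity

variable {O : Set Coord} {x : Coord}

/-! ### Connections in matrix form -/

/-- Curvature of a connection with matrices `(A i)^l_k = Γ^l_{ik}`. -/
def curv (A : Fin 4 → Coord → Mat) (i j : Fin 4) (x : Coord) : Mat :=
  pdM i (A j) x - pdM j (A i) x + (A i x * A j x - A j x * A i x)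

/-- The Christoffel symbols as connection matrices. -/
def Gam (G : Metric) (i : Fin 4) (x : Coord) : Mat := Matrix.of fun l k => christoffel G l i k x

lemma riemann_eq (G : Metric) (l k i j : Fin 4) (x : Coord) :
    riemann G l k i j x = curv (Gam G) i j x l k := by
  simp [riemann, curv, Gam, pdM, Matrix.mul_apply, Finset.sum_sub_distrib]

lemma curv_swap (A : Fin 4 → Coord → Mat) (i j : Fin 4) (x : Coord) :
    curv A j i x = - curv A i j x := by
  unfold curv; abel

lemma SmM.curv {A : Fin 4 → Coord → Mat} (hO : IsOpen O) (hA : ∀ i, SmM O (A i)) (i j : Fin 4) :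
    SmM O (curv A i j) :=
  (((hA j).pdM hO i).sub ((hA i).pdM hO j)).add (((hA i).mul (hA j)).sub ((hA j).mul (hA i)))

/-- Holds for an arbitrary connection, with no assumption on torsion: second partial derivatives
commute, the first-order terms cancel against the commutators, and the cubic terms cancel by the
Jacobi identity. -/
lemma second_bianchi {A : Fin 4 → Coord → Mat} (hO : IsOpen O) (hx : x ∈ O)
    (hA : ∀ i, SmM O (A i)) (i j k : Fin 4) :
    (pdM i (curv A j k) x + (A i x * curv A j k x - curv A j k x * A i x))
      + (pdM j (curv A k i) x + (A j x * curv A k i x - curv A k i x * A j x))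
      + (pdM k (curv A i j) x + (A k x * curv A i j x - curv A i j x * A k x)) = 0 := by
  have key : ∀ a b c : Fin 4, pdM a (curv A b c) x =
      pdM a (pdM b (A c)) x - pdM a (pdM c (A b)) x
        + ((pdM a (A b) x * A c x + A b x * pdM a (A c) x)
          - (pdM a (A c) x * A b x + A c x * pdM a (A b) x)) := by
    intro a b c
    unfold curv
    rw [pdM_add hO hx (((hA c).pdM hO b).sub ((hA b).pdM hO c))
        (((hA b).mul (hA c)).sub ((hA c).mul (hA b))),
      pdM_sub hO hx ((hA c).pdM hO b) ((hA b).pdM hO c),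
      pdM_sub hO hx ((hA b).mul (hA c)) ((hA c).mul (hA b)),
      pdM_mul hO hx (hA b) (hA c), pdM_mul hO hx (hA c) (hA b)]
  rw [key, key, key, pdM_comm hO hx (hA k) i j, pdM_comm hO hx (hA j) i k,
    pdM_comm hO hx (hA i) j k]
  unfold curv
  noncomm_ring

/-- Integrability condition of the compatibility equation: differentiating it again and using ∂_i∂_j
G = ∂_j∂_i G leaves exactly the curvature terms. -/
lemma curv_metric {A : Fin 4 → Coord → Mat} {G : Metric} (hO : IsOpen O) (hx : x ∈ O)
    (hA : ∀ i, SmM O (A i)) (hG : SmM O G)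
    (hc : ∀ y ∈ O, ∀ i, pdM i G y = (A i y)ᵀ * G y + G y * A i y) (i j : Fin 4) :
    (curv A i j x)ᵀ * G x + G x * curv A i j x = 0 := by
  have key : ∀ a b : Fin 4, pdM a (pdM b G) x =
      ((pdM a (A b) x)ᵀ * G x + (A b x)ᵀ * ((A a x)ᵀ * G x + G x * A a x))
      + (((A a x)ᵀ * G x + G x * A a x) * A b x + G x * pdM a (A b) x) := by
    intro a b
    rw [pdM_congr hO hx (fun y hy => hc y hy b),
      pdM_add hO hx ((hA b).transpose.mul hG) (hG.mul (hA b)),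
      pdM_mul hO hx (hA b).transpose hG, pdM_mul hO hx hG (hA b), hc x hx, pdM_transpose]
  have h := pdM_comm hO hx hG i j
  rw [key, key, ← sub_eq_zero] at h
  rw [← h]
  simp only [curv, Matrix.transpose_add, Matrix.transpose_sub, Matrix.transpose_mul]
  noncomm_ring

/-- Symmetric in the lower indices. -/
def TorsionFree (A : Fin 4 → Coord → Mat) (x : Coord) : Prop :=
  ∀ i k l, A i x l k = A k x l i

lemma first_bianchi {A : Fin 4 → Coord → Mat} (hO : IsOpen O) (hx : x ∈ O)
    (ht : ∀ y ∈ O, TorsionFree A y) (l i j k : Fin 4) :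
    curv A i j x l k + curv A j k x l i + curv A k i x l j = 0 := by
  have hp : ∀ a b c : Fin 4, pd a (fun y => A b y l c) x = pd a (fun y => A c y l b) x :=
    fun a b c => pd_congr hO hx (fun y hy => ht y hy b c l) a
  have hm : ∀ a b c : Fin 4, (A a x * A b x) l c = (A a x * A c x) l b := by
    intro a b c
    simp only [Matrix.mul_apply]
    exact Finset.sum_congr rfl fun m _ => by rw [ht x hx b c m]
  simp only [curv, Matrix.add_apply, Matrix.sub_apply, pdM, Matrix.of_apply]
  rw [hp i j k, hp j i k, hp k i j, hm i j k, hm j i k, hm k i j]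
  ring

/-! ### The Levi-Civita connection -/

/-- Smooth Riemannian metrics on an open set. -/
structure IsMetricOn (G : Metric) (O : Set Coord) : Prop where
  isOpen : IsOpen O
  smooth : SmM O G
  posDef : ∀ y ∈ O, (G y).PosDef

variable {G : Metric}

lemma IsMetricOn.mono {O' : Set Coord} (hG : IsMetricOn G O) (hO' : IsOpen O') (h : O' ⊆ O) :
    IsMetricOn G O' :=
  ⟨hO', fun a b => (hG.smooth a b).mono h, fun y hy => hG.posDef y (h hy)⟩

/-- The curvature with all indices down, `R_{lkij}`. -/
def riem (G : Metric) (x : Coord) (l k i j : Fin 4) : ℝ :=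
  ∑ m, G x l m * riemann G m k i j x

namespace IsMetricOn

lemma symm (hG : IsMetricOn G O) (hx : x ∈ O) (i j : Fin 4) : G x i j = G x j i := by
  have := (hG.posDef x hx).isHermitian.apply i j
  simpa using this.symm

lemma transpose (hG : IsMetricOn G O) (hx : x ∈ O) : (G x)ᵀ = G x := by
  ext i j; exact hG.symm hx j i

lemma det_pos (hG : IsMetricOn G O) (hx : x ∈ O) : 0 < (G x).det := (hG.posDef x hx).det_pos

lemma det_ne (hG : IsMetricOn G O) : ∀ y ∈ O, (G y).det ≠ 0 := fun _ hy => (hG.det_pos hy).ne'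

lemma inv_mul (hG : IsMetricOn G O) (hx : x ∈ O) : (G x)⁻¹ * G x = 1 :=
  Matrix.nonsing_inv_mul _ (IsUnit.mk0 _ (hG.det_ne x hx))

lemma mul_inv (hG : IsMetricOn G O) (hx : x ∈ O) : G x * (G x)⁻¹ = 1 :=
  Matrix.mul_nonsing_inv _ (IsUnit.mk0 _ (hG.det_ne x hx))

lemma inv_transpose (hG : IsMetricOn G O) (hx : x ∈ O) : ((G x)⁻¹)ᵀ = (G x)⁻¹ := by
  rw [Matrix.transpose_nonsing_inv, hG.transpose hx]

lemma inv_symm (hG : IsMetricOn G O) (hx : x ∈ O) (i j : Fin 4) : (G x)⁻¹ i j = (G x)⁻¹ j i := by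
  conv_lhs => rw [← hG.inv_transpose hx]
  rfl

lemma smooth_inv (hG : IsMetricOn G O) : SmM O (fun y => (G y)⁻¹) := hG.smooth.inv hG.det_ne

lemma sum_inv_mul (hG : IsMetricOn G O) (hx : x ∈ O) (i j : Fin 4) :
    ∑ m, (G x)⁻¹ i m * G x m j = if i = j then 1 else 0 := by
  have := congrFun (congrFun (hG.inv_mul hx) i) j
  rwa [Matrix.mul_apply, Matrix.one_apply] at this

lemma sum_mul_inv (hG : IsMetricOn G O) (hx : x ∈ O) (i j : Fin 4) :
    ∑ m, G x i m * (G x)⁻¹ m j = if i = j then 1 else 0 := by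
  have := congrFun (congrFun (hG.mul_inv hx) i) j
  rwa [Matrix.mul_apply, Matrix.one_apply] at this

lemma smooth_christoffel (hG : IsMetricOn G O) (k i j : Fin 4) : Sm O (christoffel G k i j) := by
  unfold christoffel
  refine (Sm.const _).mul (Sm.sum fun l => (hG.smooth_inv k l).mul ?_)
  exact (((hG.smooth j l).pd hG.isOpen i).add ((hG.smooth i l).pd hG.isOpen j)).sub
    ((hG.smooth i j).pd hG.isOpen l)

lemma smooth_Gam (hG : IsMetricOn G O) (i : Fin 4) : SmM O (Gam G i) :=
  fun l k => hG.smooth_christoffel l i k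

lemma lower_christoffel (hG : IsMetricOn G O) (hx : x ∈ O) (m i j : Fin 4) :
    ∑ k, G x m k * christoffel G k i j x = (1 / 2) *
      (pd i (fun y => G y j m) x + pd j (fun y => G y i m) x - pd m (fun y => G y i j) x) := by
  unfold christoffel
  simp only [Finset.mul_sum]
  rw [Finset.sum_comm]
  have : ∀ l, ∑ k, G x m k * (1 / 2 * ((G x)⁻¹ k l * (pd i (fun y => G y j l) x
      + pd j (fun y => G y i l) x - pd l (fun y => G y i j) x))) =
      (if m = l then 1 else 0) * (1 / 2 * (pd i (fun y => G y j l) x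
      + pd j (fun y => G y i l) x - pd l (fun y => G y i j) x)) := by
    intro l
    rw [← hG.sum_mul_inv hx, Finset.sum_mul]
    exact Finset.sum_congr rfl fun k _ => by ring
  simp only [this]
  simp

lemma torsionFree (hG : IsMetricOn G O) (hx : x ∈ O) : TorsionFree (Gam G) x := by
  intro i k l
  simp only [Gam, Matrix.of_apply, christoffel]
  congr 1
  refine Finset.sum_congr rfl fun m _ => ?_
  rw [pd_congr hG.isOpen hx (fun y hy => hG.symm hy i k) m]
  ring

lemma pd_symm (hG : IsMetricOn G O) (hx : x ∈ O) (m i j : Fin 4) :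
    pd m (fun y => G y i j) x = pd m (fun y => G y j i) x :=
  pd_congr hG.isOpen hx (fun _ hy => hG.symm hy i j) m

lemma compat (hG : IsMetricOn G O) (hx : x ∈ O) (i : Fin 4) :
    pdM i G x = (Gam G i x)ᵀ * G x + G x * Gam G i x := by
  ext a b
  simp only [pdM, Matrix.of_apply, Matrix.add_apply, Matrix.mul_apply, Matrix.transpose_apply, Gam]
  have h1 := hG.lower_christoffel hx a i b
  have h2 := hG.lower_christoffel hx b i a
  have e : ∑ c, christoffel G c i a x * G x c b = ∑ k, G x b k * christoffel G k i a x :=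
    Finset.sum_congr rfl fun c _ => by rw [hG.symm hx c b, mul_comm]
  rw [e, h1, h2, hG.pd_symm hx i b a, hG.pd_symm hx b i a, hG.pd_symm hx a i b,
    hG.pd_symm hx b a i]
  ring

lemma compat_inv (hG : IsMetricOn G O) (hx : x ∈ O) (i : Fin 4) :
    pdM i (fun y => (G y)⁻¹) x = - (Gam G i x * (G x)⁻¹ + (G x)⁻¹ * (Gam G i x)ᵀ) := by
  rw [pdM_inv hG.isOpen hx hG.smooth hG.det_ne, hG.compat hx]
  simp only [mul_add, add_mul]
  congr 1
  rw [← mul_assoc _ (Gam G i x)ᵀ, mul_assoc _ (G x), hG.mul_inv hx, mul_one,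
    ← mul_assoc _ (G x), hG.inv_mul hx, one_mul, add_comm]

/-- Uniqueness of the Levi-Civita connection. -/
lemma christoffel_unique (hG : IsMetricOn G O) (hx : x ∈ O) {A : Fin 4 → Coord → Mat}
    (ht : TorsionFree A x) (hc : ∀ i, pdM i G x = (A i x)ᵀ * G x + G x * A i x) (i : Fin 4) :
    Gam G i x = A i x := by
  have hpd : ∀ i a b, pd i (fun y => G y a b) x =
      ∑ c, G x b c * A i x c a + ∑ c, G x a c * A i x c b := by
    intro i a b
    have := congrFun (congrFun (hc i) a) b
    simp only [pdM, Matrix.of_apply, Matrix.add_apply, Matrix.mul_apply,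
      Matrix.transpose_apply] at this
    rw [this]
    congr 1
    exact Finset.sum_congr rfl fun c _ => by rw [hG.symm hx c b, mul_comm]
  -- Koszul's argument: in the Christoffel combination of metric derivatives, each expanded by
  -- compatibility, the symmetry of `A` in its lower indices makes all but two equal terms cancel.
  have key : G x * Gam G i x = G x * A i x := by
    ext m j
    simp only [Matrix.mul_apply, Gam, Matrix.of_apply]
    rw [hG.lower_christoffel hx, hpd, hpd, hpd]
    have s : ∀ a b c : Fin 4, ∑ d, G x c d * A a x d b = ∑ d, G x c d * A b x d a :=
      fun a b c => Finset.sum_congr rfl fun d _ => by rw [ht a b d]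
    rw [s i m j, s m j i, s j i m]
    ring
  have := congrArg (fun Z => (G x)⁻¹ * Z) key
  simpa only [← mul_assoc, hG.inv_mul hx, one_mul] using this

/-! ### Symmetries of the curvature -/

lemma riem_eq (G : Metric) (x : Coord) (l k i j : Fin 4) :
    riem G x l k i j = (G x * curv (Gam G) i j x) l k := by
  simp only [riem, riemann_eq, Matrix.mul_apply]

lemma riem_antisymm_right (G : Metric) (x : Coord) (l k i j : Fin 4) :
    riem G x l k i j = - riem G x l k j i := by
  rw [riem_eq, riem_eq, curv_swap _ j i]; simp

lemma riem_antisymm_left (hG : IsMetricOn G O) (hx : x ∈ O) (l k i j : Fin 4) :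
    riem G x l k i j = - riem G x k l i j := by
  have h := curv_metric hG.isOpen hx hG.smooth_Gam hG.smooth (fun y hy i => hG.compat hy i) i j
  have h2 := congrFun (congrFun h k) l
  rw [riem_eq, riem_eq]
  rw [← hG.transpose hx, ← Matrix.transpose_mul, hG.transpose hx, Matrix.add_apply,
    Matrix.transpose_apply] at h2
  simp only [Matrix.zero_apply] at h2
  linarith

lemma riem_cyclic (hG : IsMetricOn G O) (hx : x ∈ O) (l k i j : Fin 4) :
    riem G x l k i j + riem G x l i j k + riem G x l j k i = 0 := by
  simp only [riem_eq, Matrix.mul_apply, ← Finset.sum_add_distrib, ← mul_add]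
  refine Finset.sum_eq_zero fun m _ => ?_
  rw [first_bianchi hG.isOpen hx (fun y hy => hG.torsionFree hy) m i j k, mul_zero]

/-- A linear consequence of the cyclic identity for the four choices of first index and of the two
antisymmetries. -/
lemma riem_pair_symm (hG : IsMetricOn G O) (hx : x ∈ O) (l k i j : Fin 4) :
    riem G x l k i j = riem G x i j l k := by
  have c := fun l k i j => hG.riem_cyclic hx l k i j
  have a := fun l k i j => hG.riem_antisymm_left hx l k i j
  have b := fun l k i j => riem_antisymm_right G x l k i j
  linarith [c l k i j, c k i j l, c i j l k, c j l k i, a l k i j, b l k i j, a l i j k, b l i j k,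
    a l j k i, b l j k i, a k i j l, b k i j l, a k j l i, b k j l i, a k l i j, b k l i j,
    a i j l k, b i j l k, a i l k j, b i l k j, a i k j l, b i k j l, a j l k i, b j l k i,
    a j k i l, b j k i l, a j i l k, b j i l k, a l i k j, a l j i k, a k i l j, a k j i l]

lemma ricci_eq (hG : IsMetricOn G O) (hx : x ∈ O) (k j : Fin 4) :
    ricci G k j x = ∑ i, ∑ l, (G x)⁻¹ i l * riem G x l k i j := by
  unfold ricci riem
  refine Finset.sum_congr rfl fun i _ => ?_
  simp only [Finset.mul_sum]
  rw [Finset.sum_comm]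
  simp only [← mul_assoc, ← Finset.sum_mul, hG.sum_inv_mul hx]
  simp

lemma ricci_symm (hG : IsMetricOn G O) (hx : x ∈ O) (k j : Fin 4) :
    ricci G k j x = ricci G j k x := by
  rw [hG.ricci_eq hx, hG.ricci_eq hx, Finset.sum_comm]
  refine Finset.sum_congr rfl fun i _ => Finset.sum_congr rfl fun l _ => ?_
  rw [hG.inv_symm hx l i, hG.riem_pair_symm hx i k l j]

lemma schouten_symm (hG : IsMetricOn G O) (hx : x ∈ O) (k j : Fin 4) :
    schouten G x k j = schouten G x j k := by
  unfold schouten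
  rw [hG.ricci_symm hx k j, hG.symm hx k j]

/-! ### Smoothness of the curvature -/

lemma smooth_riemann (hG : IsMetricOn G O) (l k i j : Fin 4) : Sm O (riemann G l k i j) :=
  (SmM.curv hG.isOpen hG.smooth_Gam i j l k).congr fun y _ => riemann_eq G l k i j y

lemma smooth_ricci (hG : IsMetricOn G O) (k j : Fin 4) : Sm O (ricci G k j) :=
  Sm.sum fun i => hG.smooth_riemann i k i j

lemma smooth_scalarCurv (hG : IsMetricOn G O) : Sm O (scalarCurv G) :=
  Sm.sum fun i => Sm.sum fun j => (hG.smooth_inv i j).mul (hG.smooth_ricci i j)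

lemma smooth_schouten (hG : IsMetricOn G O) (i j : Fin 4) : Sm O (fun y => schouten G y i j) :=
  (Sm.const _).mul ((hG.smooth_ricci i j).sub
    (((Sm.const _).mul hG.smooth_scalarCurv).mul (hG.smooth i j)))

end IsMetricOn

end ASDGravity

end

/-! ### The Hodge star on two-forms is parallel -/

noncomputable section

namespace ASDGravity

variable {O : Set Coord} {x : Coord} {G : Metric}

/-! ### The alternating symbol -/

/-- The totally antisymmetric symbol. -/
def eps4 (i j p q : Fin 4) : ℝ :=
  Matrix.det (Matrix.of fun a b : Fin 4 => if (![i, j, p, q] : Fin 4 → Fin 4) a = b then (1 : ℝ) else 0)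

/-- Selecting rows of the Vandermonde matrix with nodes 0, 1, 2, 3 gives the Vandermonde matrix with
nodes i, j, p, q; the determinant of the former is 12. The closed form lets single values be
computed by arithmetic. -/
lemma eps4_eq (i j p q : Fin 4) : eps4 i j p q =
    ((j : ℕ) - (i : ℕ) : ℝ) * ((p : ℕ) - (i : ℕ)) * ((q : ℕ) - (i : ℕ)) * ((p : ℕ) - (j : ℕ))
      * ((q : ℕ) - (j : ℕ)) * ((q : ℕ) - (p : ℕ)) / 12 := by
  have h : (Matrix.of fun a b : Fin 4 =>
      if (![i, j, p, q] : Fin 4 → Fin 4) a = b then (1 : ℝ) else 0)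
        * Matrix.vandermonde (fun a : Fin 4 => ((a : ℕ) : ℝ)) =
      Matrix.vandermonde (fun a : Fin 4 => (((![i, j, p, q] : Fin 4 → Fin 4) a : ℕ) : ℝ)) := by
    ext a b
    simp [Matrix.mul_apply, Matrix.vandermonde_apply]
  have h2 := congrArg Matrix.det h
  have h3 : Matrix.det (Matrix.vandermonde (fun a : Fin 4 => ((a : ℕ) : ℝ))) = 12 := by
    simp [Matrix.det_vandermonde, Fin.prod_univ_succ,
      Fin.prod_Ioi_succ]
    norm_num
  rw [Matrix.det_mul, h3, Matrix.det_vandermonde] at h2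
  rw [eq_div_iff (by norm_num)]
  refine h2.trans ?_
  simp [Fin.prod_univ_succ, Fin.prod_Ioi_succ]
  ring

/-- Contraction of the alternating symbol with a matrix in the last two indices. -/
def epsContr (H : Mat) : Mat := Matrix.of fun i j => ∑ p, ∑ q, eps4 i j p q * H p q

lemma epsContr_eq (H : Mat) : epsContr H =
    !![0, H 2 3 - H 3 2, H 3 1 - H 1 3, H 1 2 - H 2 1;
       H 3 2 - H 2 3, 0, H 0 3 - H 3 0, H 2 0 - H 0 2;
       H 1 3 - H 3 1, H 3 0 - H 0 3, 0, H 0 1 - H 1 0;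
       H 2 1 - H 1 2, H 0 2 - H 2 0, H 1 0 - H 0 1, 0] := by
  ext i j
  simp only [epsContr, eps4_eq, Matrix.of_apply, Fin.sum_univ_four]
  fin_cases i <;> fin_cases j <;> norm_num <;> ring

/-- Infinitesimal form of the fact that the alternating symbol is multiplied by the determinant
under a linear change of basis. -/
lemma epsContr_derivation (A H : Mat) :
    A.trace • epsContr H - epsContr (A * H + H * Aᵀ) = Aᵀ * epsContr H + epsContr H * A := by
  simp only [epsContr_eq]
  ext i j
  fin_cases i <;> fin_cases j <;>
    simp [Matrix.trace, Matrix.mul_apply, Fin.sum_univ_four, Matrix.vecMul, dotProduct] <;> ring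

lemma epsContr_add (H K : Mat) : epsContr (H + K) = epsContr H + epsContr K := by
  ext i j
  simp [epsContr, mul_add, Finset.sum_add_distrib]

lemma epsContr_smul (c : ℝ) (H : Mat) : epsContr (c • H) = c • epsContr H := by
  ext i j
  simp [epsContr, Finset.mul_sum, mul_left_comm]

lemma pdM_epsContr (hO : IsOpen O) (hx : x ∈ O) {H : Coord → Mat} (hH : SmM O H) (m : Fin 4) :
    pdM m (fun y => epsContr (H y)) x = epsContr (pdM m H x) := by
  ext i j
  simp only [pdM, epsContr, Matrix.of_apply]
  rw [pd_sum hO hx fun p => Sm.sum fun q => (Sm.const _).mul (hH p q)]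
  refine Finset.sum_congr rfl fun p _ => ?_
  rw [pd_sum hO hx fun q => (Sm.const _).mul (hH p q)]
  refine Finset.sum_congr rfl fun q _ => ?_
  rw [pd_mul hO hx (Sm.const _) (hH p q), pd_const]
  ring

lemma SmM.epsContr {H : Coord → Mat} (hH : SmM O H) : SmM O (fun y => epsContr (H y)) := by
  intro i j
  simp only [ASDGravity.epsContr, Matrix.of_apply]
  exact Sm.sum fun p => Sm.sum fun q => (Sm.const _).mul (hH p q)

/-! ### Derivative of the volume density -/

lemma pd_prod (hO : IsOpen O) (hx : x ∈ O) {F : Fin 4 → Coord → ℝ} (hF : ∀ a, Sm O (F a))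
    (i : Fin 4) :
    pd i (fun y => ∏ a, F a y) x = ∑ a, (∏ b ∈ Finset.univ.erase a, F b x) * pd i (F a) x := by
  unfold pd
  rw [fderiv_finsetProd fun a _ => (hF a).differentiableAt hO hx]
  simp

/-- Jacobi's formula. Both sides are the sum over columns of the determinant with that column
differentiated; on the right this is Cramer's rule, on the left the Leibniz rule in the permutation
expansion. -/
lemma pd_det (hO : IsOpen O) (hx : x ∈ O) {M : Coord → Mat} (hM : SmM O M) (i : Fin 4) :
    pd i (fun y => (M y).det) x = ((M x).adjugate * pdM i M x).trace := by
  have h1 : ∀ k, ((M x).adjugate * pdM i M x) k k =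
      ((M x).updateCol k (fun a => pdM i M x a k)).det := by
    intro k
    rw [← Matrix.cramer_apply, Matrix.cramer_eq_adjugate_mulVec]
    rfl
  simp only [Matrix.trace, Matrix.diag, h1]
  simp only [Matrix.det_apply, Units.smul_def, zsmul_eq_mul]
  rw [pd_sum hO hx fun p => (Sm.const _).mul (Sm.prod _ fun a => hM _ _), Finset.sum_comm]
  refine Finset.sum_congr rfl fun p _ => ?_
  rw [pd_mul hO hx (Sm.const _) (Sm.prod _ fun a => hM _ _), pd_const, zero_mul, zero_add,
    pd_prod hO hx fun a => hM _ _, Finset.mul_sum]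
  refine Finset.sum_congr rfl fun k _ => ?_
  rw [← Finset.mul_prod_erase Finset.univ _ (Finset.mem_univ k)]
  simp only [Matrix.updateCol_self, pdM, Matrix.of_apply]
  rw [mul_comm (∏ _ ∈ _, _)]
  congr 2
  refine Finset.prod_congr rfl fun b hb => ?_
  rw [Matrix.updateCol_ne (Finset.ne_of_mem_erase hb)]

namespace IsMetricOn

lemma smooth_sqrt_det (hG : IsMetricOn G O) : Sm O (fun y => Real.sqrt (G y).det) :=
  ContDiffOn.sqrt hG.smooth.det hG.det_ne

/-- Differentiating the square of the density brings in Jacobi's formula for det G; metric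
compatibility turns its trace into 2 det G times the trace of the connection matrix. -/
lemma pd_sqrt_det (hG : IsMetricOn G O) (hx : x ∈ O) (i : Fin 4) :
    pd i (fun y => Real.sqrt (G y).det) x = Real.sqrt (G x).det * (Gam G i x).trace := by
  have h0 : Real.sqrt (G x).det ≠ 0 := (Real.sqrt_pos.2 (hG.det_pos hx)).ne'
  have h1 : pd i (fun y => Real.sqrt (G y).det * Real.sqrt (G y).det) x
      = pd i (fun y => (G y).det) x :=
    pd_congr hG.isOpen hx (fun y hy => Real.mul_self_sqrt (hG.det_pos hy).le) i
  rw [pd_mul hG.isOpen hx hG.smooth_sqrt_det hG.smooth_sqrt_det, pd_det hG.isOpen hx hG.smooth,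
    hG.compat hx, mul_add, Matrix.trace_add, Matrix.trace_mul_comm, ← mul_assoc,
    Matrix.adjugate_mul, mul_assoc, Matrix.mul_adjugate] at h1
  simp only [Matrix.mul_smul, mul_one, Matrix.smul_mul, one_mul, Matrix.trace_smul,
    Matrix.trace_transpose, smul_eq_mul] at h1
  have h2 := Real.mul_self_sqrt (hG.det_pos hx).le
  apply mul_left_cancel₀ h0
  rw [← mul_assoc, h2]
  linarith

end IsMetricOn

/-! ### The Hodge star on two-forms -/

/-- The Hodge star `(1/2) ε_{ij}^{mn} F_{mn}` of a metric `g`. -/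
def hodge (g F : Mat) : Mat := (Real.sqrt g.det / 2) • epsContr (g⁻¹ * F * g⁻¹)

lemma hodge_add (g F K : Mat) : hodge g (F + K) = hodge g F + hodge g K := by
  simp [hodge, mul_add, add_mul, epsContr_add]

lemma hodge_smul (g : Mat) (c : ℝ) (F : Mat) : hodge g (c • F) = c • hodge g F := by
  simp [hodge, epsContr_smul, smul_comm c]

/-- The Levi-Civita derivative of a two-form. -/
def nab2 (G : Metric) (m : Fin 4) (F : Coord → Mat) (x : Coord) : Mat :=
  pdM m F x - (Gam G m x)ᵀ * F x - F x * Gam G m x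

/-- The derivative of the density produces a trace of the connection matrix, and those of the two
inverse metrics produce its action on the raised two-form. By `epsContr_derivation` these terms
amount to its action on the dual form, which is what the covariant derivative subtracts. -/
lemma nab2_hodge (hG : IsMetricOn G O) (hx : x ∈ O) {F : Coord → Mat} (hF : SmM O F) (m : Fin 4) :
    nab2 G m (fun y => hodge (G y) (F y)) x = hodge (G x) (nab2 G m F x) := by
  have hO := hG.isOpen
  have hH : SmM O (fun y => (G y)⁻¹ * F y * (G y)⁻¹) :=
    (hG.smooth_inv.mul hF).mul hG.smooth_inv
  have h1 : pdM m (fun y => hodge (G y) (F y)) x =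
      (Real.sqrt (G x).det * (Gam G m x).trace / 2) • epsContr ((G x)⁻¹ * F x * (G x)⁻¹)
      + (Real.sqrt (G x).det / 2) • epsContr (pdM m (fun y => (G y)⁻¹ * F y * (G y)⁻¹) x) := by
    rw [← pdM_epsContr hO hx hH]
    ext i j
    simp only [pdM, hodge, Matrix.smul_apply, Matrix.of_apply, smul_eq_mul, Matrix.add_apply,
      div_eq_mul_inv]
    rw [pd_mul hO hx (hG.smooth_sqrt_det.mul (Sm.const _)) (hH.epsContr i j),
      pd_mul hO hx hG.smooth_sqrt_det (Sm.const _), hG.pd_sqrt_det hx, pd_const]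
    ring
  have h2 : pdM m (fun y => (G y)⁻¹ * F y * (G y)⁻¹) x =
      (G x)⁻¹ * nab2 G m F x * (G x)⁻¹
        + (-1 : ℝ) • (Gam G m x * ((G x)⁻¹ * F x * (G x)⁻¹)
          + ((G x)⁻¹ * F x * (G x)⁻¹) * (Gam G m x)ᵀ) := by
    rw [pdM_mul hO hx (hG.smooth_inv.mul hF) hG.smooth_inv, pdM_mul hO hx hG.smooth_inv hF,
      hG.compat_inv hx, nab2, neg_one_smul]
    noncomm_ring
  have h3 := epsContr_derivation (Gam G m x) ((G x)⁻¹ * F x * (G x)⁻¹)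
  unfold nab2
  rw [h1, h2, epsContr_add, epsContr_smul]
  set E := epsContr ((G x)⁻¹ * F x * (G x)⁻¹) with hE
  set E' := epsContr (Gam G m x * ((G x)⁻¹ * F x * (G x)⁻¹)
          + ((G x)⁻¹ * F x * (G x)⁻¹) * (Gam G m x)ᵀ) with hE'
  have h4 : (Gam G m x)ᵀ * hodge (G x) (F x) + hodge (G x) (F x) * Gam G m x
      = (Real.sqrt (G x).det / 2) • ((Gam G m x).trace • E - E') := by
    rw [h3, hodge, ← hE, Matrix.mul_smul, Matrix.smul_mul, smul_add]
  rw [sub_sub, h4]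
  unfold hodge
  rw [nab2]
  module

end ASDGravity

end

/-! ### Anti-self-dual tensors of Weyl type and their covariant derivatives -/

noncomputable section

namespace ASDGravity

variable {O : Set Coord} {x : Coord} {G : Metric}

/-! ### Tensors of Weyl type -/

/-- Components of a covariant tensor of rank four at a point. -/
abbrev T4 : Type := Fin 4 → Fin 4 → Fin 4 → Fin 4 → ℝ

/-- The matrix of the first two indices. -/
def slice (t : T4) (k l : Fin 4) : Mat := Matrix.of fun i j => t i j k l

/-- The tensors with the algebraic symmetries of an anti-self-dual Weyl tensor. -/
structure IsASDType (g : Mat) (t : T4) : Prop where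
  anti : ∀ i j k l, t i j k l = - t j i k l
  pair : ∀ i j k l, t i j k l = t k l i j
  cyc : ∀ i j k l, t i j k l + t i k l j + t i l j k = 0
  asd : ∀ k l, slice t k l = - hodge g (slice t k l)

lemma hodge_zero (g : Mat) : hodge g 0 = 0 := by
  have := hodge_smul g 0 0
  simpa using this

lemma hodge_neg (g F : Mat) : hodge g (-F) = - hodge g F := by
  have := hodge_smul g (-1) F
  simpa using this

/-- The space of tensors of anti-self-dual Weyl type. -/
def asdSubmodule (g : Mat) : Submodule ℝ T4 where
  carrier := {t | IsASDType g t}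
  zero_mem' := by
    refine ⟨by simp, by simp, by simp, fun k l => ?_⟩
    have : slice (0 : T4) k l = 0 := rfl
    rw [this, hodge_zero, neg_zero]
  add_mem' := by
    intro s t hs ht
    refine ⟨fun i j k l => ?_, fun i j k l => ?_, fun i j k l => ?_, fun k l => ?_⟩
    · simp only [Pi.add_apply]; linarith [hs.anti i j k l, ht.anti i j k l]
    · simp only [Pi.add_apply]; linarith [hs.pair i j k l, ht.pair i j k l]
    · simp only [Pi.add_apply]; linarith [hs.cyc i j k l, ht.cyc i j k l]
    · have : slice (s + t) k l = slice s k l + slice t k l := rfl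
      rw [this, hodge_add, neg_add, ← hs.asd, ← ht.asd]
  smul_mem' := by
    intro c t ht
    refine ⟨fun i j k l => ?_, fun i j k l => ?_, fun i j k l => ?_, fun k l => ?_⟩
    · simp only [Pi.smul_apply, smul_eq_mul]; rw [ht.anti]; ring
    · simp only [Pi.smul_apply, smul_eq_mul]; rw [ht.pair]
    · simp only [Pi.smul_apply, smul_eq_mul]; rw [← mul_add, ← mul_add, ht.cyc, mul_zero]
    · have : slice (c • t) k l = c • slice t k l := rfl
      rw [this, hodge_smul, ← smul_neg, ← ht.asd]

lemma mem_asdSubmodule {g : Mat} {t : T4} : t ∈ asdSubmodule g ↔ IsASDType g t := Iff.rfl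

/-- Smoothness of a field of tensors of rank four. -/
def SmT (O : Set Coord) (t : Coord → T4) : Prop := ∀ i j k l, Sm O (fun y => t y i j k l)

/-- Levi-Civita derivative of a tensor of rank four in the direction `∂_m`. -/
def nab (G : Metric) (m : Fin 4) (t : Coord → T4) (x : Coord) : T4 := fun i j k l =>
  pd m (fun y => t y i j k l) x
    - ∑ n, christoffel G n m i x * t x n j k l - ∑ n, christoffel G n m j x * t x i n k l
    - ∑ n, christoffel G n m k x * t x i j n l - ∑ n, christoffel G n m l x * t x i j k n

lemma SmT.nab {t : Coord → T4} (hG : IsMetricOn G O) (ht : SmT O t) (m : Fin 4) :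
    SmT O (nab G m t) := by
  intro i j k l
  have hs := fun n a b => hG.smooth_christoffel n a b
  exact (((((ht i j k l).pd hG.isOpen m).sub (Sm.sum fun n => (hs n m i).mul (ht n j k l))).sub
    (Sm.sum fun n => (hs n m j).mul (ht i n k l))).sub
    (Sm.sum fun n => (hs n m k).mul (ht i j n l))).sub
    (Sm.sum fun n => (hs n m l).mul (ht i j k n))

lemma slice_nab (t : Coord → T4) (m k l : Fin 4) (x : Coord) :
    slice (nab G m t x) k l = nab2 G m (fun y => slice (t y) k l) x
      - (∑ n, christoffel G n m k x • slice (t x) n l)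
      - ∑ n, christoffel G n m l x • slice (t x) k n := by
  ext i j
  simp only [slice, nab, nab2, pdM, Gam, Matrix.of_apply, Matrix.sub_apply, Matrix.mul_apply,
    Matrix.transpose_apply, Matrix.sum_apply, Matrix.smul_apply, smul_eq_mul]
  congr 3
  exact Finset.sum_congr rfl fun n _ => mul_comm _ _

/-- The index symmetries are linear with constant coefficients, so they pass to partial derivatives
and to each Christoffel term. Duality refers to the varying metric and needs `nab2_hodge` for the
first index pair; the corrections in the second pair are combinations of anti-self-dual slices. -/
lemma IsASDType.nab {t : Coord → T4} (hG : IsMetricOn G O) (ht : SmT O t)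
    (h : ∀ y ∈ O, IsASDType (G y) (t y)) (hx : x ∈ O) (m : Fin 4) :
    IsASDType (G x) (nab G m t x) := by
  have hO := hG.isOpen
  refine ⟨fun i j k l => ?_, fun i j k l => ?_, fun i j k l => ?_, fun k l => ?_⟩
  · have h1 : pd m (fun y => t y i j k l) x = - pd m (fun y => t y j i k l) x := by
      rw [← pd_neg]; exact pd_congr hO hx (fun y hy => (h y hy).anti i j k l) m
    simp only [ASDGravity.nab, h1]
    have a : ∀ i j k l, t x i j k l = - t x j i k l := (h x hx).anti
    simp only [fun n => a n j k l, fun n => a i n k l, fun n => a i j n l, fun n => a i j k n,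
      mul_neg, Finset.sum_neg_distrib]
    ring
  · have h1 : pd m (fun y => t y i j k l) x = pd m (fun y => t y k l i j) x :=
      pd_congr hO hx (fun y hy => (h y hy).pair i j k l) m
    simp only [ASDGravity.nab, h1]
    have a : ∀ i j k l, t x i j k l = t x k l i j := (h x hx).pair
    simp only [fun n => a n j k l, fun n => a i n k l, fun n => a i j n l, fun n => a i j k n]
    ring
  · have h1 : pd m (fun y => t y i j k l) x + pd m (fun y => t y i k l j) x
        + pd m (fun y => t y i l j k) x = 0 := by
      rw [← pd_add hO hx (ht i j k l) (ht i k l j),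
        ← pd_add hO hx ((ht i j k l).add (ht i k l j)) (ht i l j k)]
      exact pd_eq_zero hO hx (fun y hy => (h y hy).cyc i j k l) m
    have hs : ∀ (c : Fin 4 → ℝ) (u v w : Fin 4 → ℝ), (∀ n, u n + v n + w n = 0) →
        ∑ n, c n * u n + ∑ n, c n * v n + ∑ n, c n * w n = 0 := by
      intro c u v w huvw
      rw [← Finset.sum_add_distrib, ← Finset.sum_add_distrib]
      refine Finset.sum_eq_zero fun n _ => ?_
      rw [← mul_add, ← mul_add, huvw, mul_zero]
    have c := (h x hx).cyc
    have e1 := hs (fun n => christoffel G n m i x) _ _ _ (fun n => c n j k l)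
    have e2 := hs (fun n => christoffel G n m j x) _ _ _ (fun n => c i n k l)
    have e3 := hs (fun n => christoffel G n m k x) _ _ _ (fun n => c i j n l)
    have e4 := hs (fun n => christoffel G n m l x) _ _ _ (fun n => c i j k n)
    simp only [ASDGravity.nab]
    linarith
  · have hs : SmM O (fun y => slice (t y) k l) := fun i j => ht i j k l
    have h1 : nab2 G m (fun y => slice (t y) k l) x
        = - hodge (G x) (nab2 G m (fun y => slice (t y) k l) x) := by
      rw [← nab2_hodge hG hx hs]
      have e : pdM m (fun y => slice (t y) k l) x
          = - pdM m (fun y => hodge (G y) (slice (t y) k l)) x := by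
        ext i j
        simp only [pdM, Matrix.of_apply, Matrix.neg_apply]
        rw [← pd_neg]
        exact pd_congr hO hx (fun y hy => congrFun (congrFun ((h y hy).asd k l) i) j) m
      have e2 := (h x hx).asd k l
      have e3 : hodge (G x) (slice (t x) k l) = - slice (t x) k l := by
        rw [eq_neg_iff_add_eq_zero, add_comm, ← eq_neg_iff_add_eq_zero]
        exact e2
      simp only [nab2, e, e3]
      noncomm_ring
    rw [slice_nab]
    have hsum : ∀ (c : Fin 4 → ℝ) (F : Fin 4 → Mat), (∀ n, F n = - hodge (G x) (F n)) →
        ∑ n, c n • F n = - hodge (G x) (∑ n, c n • F n) := by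
      intro c F hF
      simp only [Fin.sum_univ_four, hodge_add, hodge_smul]
      nth_rewrite 1 [hF 0, hF 1, hF 2, hF 3]
      module
    have h2 := hsum (fun n => christoffel G n m k x) _ (fun n => (h x hx).asd n l)
    have h3 := hsum (fun n => christoffel G n m l x) _ (fun n => (h x hx).asd k n)
    rw [sub_eq_add_neg, sub_eq_add_neg, hodge_add, hodge_add, hodge_neg, hodge_neg]
    nth_rewrite 1 [h1, h2, h3]
    abel

/-! ### The Weyl tensor -/

/-- Components of the Weyl tensor. -/
def wey (G : Metric) (x : Coord) : T4 := fun i j k l => weyl G x ![i, j, k, l]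

lemma wey_eq (G : Metric) (x : Coord) (i j k l : Fin 4) : wey G x i j k l = riem G x i j k l
    - (G x i k * schouten G x j l - G x i l * schouten G x j k
      + G x j l * schouten G x i k - G x j k * schouten G x i l) := rfl

lemma smooth_wey (hG : IsMetricOn G O) : SmT O (wey G) := by
  intro i j k l
  have hP := hG.smooth_schouten
  have hg := hG.smooth
  exact (Sm.sum fun m => (hg i m).mul (hG.smooth_riemann m j k l)).sub
    (((((hg i k).mul (hP j l)).sub ((hg i l).mul (hP j k))).add ((hg j l).mul (hP i k))).sub
      ((hg j k).mul (hP i l)))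

/-- The hypothesis dualises one pair and contracts against the other position of C, so pair symmetry
is needed to read it as a condition on each slice in the first two indices. -/
lemma wey_isASDType (hG : IsMetricOn G O) (hx : x ∈ O) (h : WeylASDAt G x) :
    IsASDType (G x) (wey G x) := by
  have hs := hG.symm hx
  have hP := hG.schouten_symm hx
  have hpair : ∀ i j k l, wey G x i j k l = wey G x k l i j := by
    intro i j k l
    rw [wey_eq, wey_eq, hG.riem_pair_symm hx, hs k i, hs l j, hs k j, hs l i, hP l j, hP k i,
      hP l i, hP k j]
    ring
  refine ⟨fun i j k l => ?_, hpair, fun i j k l => ?_, fun k l => ?_⟩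
  · rw [wey_eq, wey_eq, hG.riem_antisymm_left hx]; ring
  · have c := hG.riem_cyclic hx i j k l
    rw [wey_eq, wey_eq, wey_eq, hs l k, hs l j, hs k j, hP l k, hP l j, hP k j]
    linarith
  · ext i j
    have h1 := h i j k l
    have h2 : ∀ p q, ((G x)⁻¹ * slice (wey G x) k l * (G x)⁻¹) p q =
        ∑ m, ∑ n, (G x)⁻¹ p m * (G x)⁻¹ q n * weyl G x ![k, l, m, n] := by
      intro p q
      simp only [Matrix.mul_apply, Finset.sum_mul]
      rw [Finset.sum_comm]
      refine Finset.sum_congr rfl fun m _ => Finset.sum_congr rfl fun n _ => ?_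
      rw [hG.inv_symm hx q n]
      simp only [slice, Matrix.of_apply, hpair m n k l]
      simp only [wey]; ring
    have hL : slice (wey G x) k l i j = weyl G x ![i, j, k, l] := rfl
    rw [hL, h1, Matrix.neg_apply, hodge, Matrix.smul_apply]
    simp only [epsContr, Matrix.of_apply, smul_eq_mul, h2, Finset.mul_sum]
    rw [← Finset.sum_neg_distrib]
    refine Finset.sum_congr rfl fun p _ => ?_
    rw [← Finset.sum_neg_distrib]
    refine Finset.sum_congr rfl fun q _ => ?_
    rw [← Finset.sum_neg_distrib]
    refine Finset.sum_congr rfl fun m _ => ?_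
    rw [← Finset.sum_neg_distrib]
    refine Finset.sum_congr rfl fun n _ => ?_
    simp only [volForm, eps4]
    ring

/-! ### Covariant derivatives of the Weyl tensor -/

lemma covD_weyl (m i j k l : Fin 4) :
    covD G (weyl G) x ![m, i, j, k, l] = nab G m (wey G) x i j k l := by
  have e0 : ∀ n, Function.update ![i, j, k, l] 0 n = ![n, j, k, l] := by
    intro n; ext a; fin_cases a <;> rfl
  have e1 : ∀ n, Function.update ![i, j, k, l] 1 n = ![i, n, k, l] := by
    intro n; ext a; fin_cases a <;> rfl
  have e2 : ∀ n, Function.update ![i, j, k, l] 2 n = ![i, j, n, l] := by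
    intro n; ext a; fin_cases a <;> rfl
  have e3 : ∀ n, Function.update ![i, j, k, l] 3 n = ![i, j, k, n] := by
    intro n; ext a; fin_cases a <;> rfl
  have et : (Fin.tail ![m, i, j, k, l] : Fin 4 → Fin 4) = ![i, j, k, l] := rfl
  rw [covD, et, Fin.sum_univ_four]
  simp only [e0, e1, e2, e3, nab, wey]
  simp only [← sub_sub]
  rfl

/-- `∇_n ∇_m C_{ijkl}`. -/
def nabnab (G : Metric) (n m : Fin 4) (t : Coord → T4) (x : Coord) : T4 := fun i j k l =>
  nab G n (nab G m t) x i j k l - ∑ p, christoffel G p n m x * nab G p t x i j k l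

lemma covD_covD_weyl (n m i j k l : Fin 4) :
    covD G (covD G (weyl G)) x ![n, m, i, j, k, l] = nabnab G n m (wey G) x i j k l := by
  have e0 : ∀ n, Function.update ![m, i, j, k, l] 0 n = ![n, i, j, k, l] := by
    intro n; ext a; fin_cases a <;> rfl
  have e1 : ∀ n, Function.update ![m, i, j, k, l] 1 n = ![m, n, j, k, l] := by
    intro n; ext a; fin_cases a <;> rfl
  have e2 : ∀ n, Function.update ![m, i, j, k, l] 2 n = ![m, i, n, k, l] := by
    intro n; ext a; fin_cases a <;> rfl
  have e3 : ∀ n, Function.update ![m, i, j, k, l] 3 n = ![m, i, j, n, l] := by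
    intro n; ext a; fin_cases a <;> rfl
  have e4 : ∀ n, Function.update ![m, i, j, k, l] 4 n = ![m, i, j, k, n] := by
    intro n; ext a; fin_cases a <;> rfl
  have et : (Fin.tail ![n, m, i, j, k, l] : Fin 5 → Fin 4) = ![m, i, j, k, l] := rfl
  rw [covD, et, Fin.sum_univ_five]
  simp only [e0, e1, e2, e3, e4, covD_weyl]
  simp only [nabnab]
  conv_rhs => rw [nab]
  have hd : pd (![n, m, i, j, k, l] 0) (fun y => nab G m (wey G) y i j k l) x
    = pd n (fun y => nab G m (wey G) y i j k l) x := rfl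
  rw [hd]
  have c : ∀ a : Fin 5, ∀ b : Fin 4, christoffel G b (![n, m, i, j, k, l] 0)
    (![n, m, i, j, k, l] a.succ) x = christoffel G b n (![m, i, j, k, l] a) x := fun _ _ => rfl
  simp only [c]
  have d0 : (![m, i, j, k, l] : Fin 5 → Fin 4) 0 = m := rfl
  have d1 : (![m, i, j, k, l] : Fin 5 → Fin 4) 1 = i := rfl
  have d2 : (![m, i, j, k, l] : Fin 5 → Fin 4) 2 = j := rfl
  have d3 : (![m, i, j, k, l] : Fin 5 → Fin 4) 3 = k := rfl
  have d4 : (![m, i, j, k, l] : Fin 5 → Fin 4) 4 = l := rfl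
  simp only [d0, d1, d2, d3, d4]
  ring

lemma nab_isASDType (hG : IsMetricOn G O) (h : ∀ y ∈ O, WeylASDAt G y) (hx : x ∈ O)
    (m : Fin 4) : IsASDType (G x) (nab G m (wey G) x) :=
  IsASDType.nab hG (smooth_wey hG) (fun _ hy => wey_isASDType hG hy (h _ hy)) hx m

/-- The Christoffel term for the index of the first derivative is a linear combination of tensors of
the same type, so closure under linear combinations suffices. -/
lemma nabnab_isASDType (hG : IsMetricOn G O) (h : ∀ y ∈ O, WeylASDAt G y) (hx : x ∈ O)
    (n m : Fin 4) : IsASDType (G x) (nabnab G n m (wey G) x) := by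
  have h1 : IsASDType (G x) (nab G n (nab G m (wey G)) x) :=
    IsASDType.nab hG ((smooth_wey hG).nab hG m) (fun _ hy => nab_isASDType hG h hy m) hx n
  have e : nabnab G n m (wey G) x = nab G n (nab G m (wey G)) x
      - ∑ p, christoffel G p n m x • nab G p (wey G) x := by
    funext i j k l
    simp [nabnab, Finset.sum_apply]
  rw [← mem_asdSubmodule, e]
  exact Submodule.sub_mem _ h1 (Submodule.sum_mem _ fun p _ =>
    Submodule.smul_mem _ _ (nab_isASDType hG h hx p))

end ASDGravity

end

/-! ### From tensors to spinors: the factorisation t_{abcd} = Ψ_{ABCD} ε_{A'B'} ε_{C'D'} -/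

noncomputable section

namespace ASDGravity

variable {O : Set Coord} {x : Coord} {G : Metric}

/-! ### Spinor components as iterated sums -/

lemma sum_cons {r : ℕ} (f : (Fin (r + 1) → Fin 4) → ℂ) :
    ∑ I, f I = ∑ i, ∑ I : Fin r → Fin 4, f (Matrix.vecCons i I) := by
  rw [← (Fin.consEquiv (fun _ : Fin (r + 1) => Fin 4)).sum_comp, Fintype.sum_prod_type]
  rfl

lemma spinComp_cons (σ : Fin 2 → Fin 2 → Fin 4 → ℂ) {r : ℕ} (T : (Fin (r + 1) → Fin 4) → ℝ)
    (A A' : Fin 2) (B B' : Fin r → Fin 2) :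
    spinComp σ T (Matrix.vecCons A B) (Matrix.vecCons A' B') =
      ∑ i, σ A A' i * spinComp σ (fun I => T (Matrix.vecCons i I)) B B' := by
  unfold spinComp
  rw [sum_cons]
  refine Finset.sum_congr rfl fun i _ => ?_
  rw [Finset.mul_sum]
  refine Finset.sum_congr rfl fun I _ => ?_
  rw [Fin.prod_univ_succ]
  simp only [Matrix.cons_val_zero, Matrix.cons_val_succ]
  ring

lemma spinComp_nil (σ : Fin 2 → Fin 2 → Fin 4 → ℂ) (T : (Fin 0 → Fin 4) → ℝ)
    (A A' : Fin 0 → Fin 2) : spinComp σ T A A' = T ![] := by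
  unfold spinComp
  rw [Fintype.sum_unique]
  simp
  congr

/-- Components of a tensor of rank four with respect to a family of complex vectors. -/
def spin4 (σ : Fin 2 → Fin 2 → Fin 4 → ℂ) (t : T4) (A A' B B' C C' D D' : Fin 2) : ℂ :=
  ∑ i, σ A A' i * ∑ j, σ B B' j * ∑ k, σ C C' k * ∑ l, σ D D' l * (t i j k l : ℂ)

lemma spinComp_four (σ : Fin 2 → Fin 2 → Fin 4 → ℂ) (T : (Fin 4 → Fin 4) → ℝ)
    (A A' B B' C C' D D' : Fin 2) :
    spinComp σ T ![A, B, C, D] ![A', B', C', D'] =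
      spin4 σ (fun i j k l => T ![i, j, k, l]) A A' B B' C C' D D' := by
  simp only [spinComp_cons, spinComp_nil, spin4]

/-- The spinor `Ψ_{ABCD} = (1/4) t_{abcd} ε^{A'B'} ε^{C'D'}`. -/
def spinor (σ : Fin 2 → Fin 2 → Fin 4 → ℂ) (t : T4) (A B C D : Fin 2) : ℂ :=
  (1 / 4) * ∑ A', ∑ B', ∑ C', ∑ D', eps A' B' * eps C' D' * spin4 σ t A A' B B' C C' D D'

lemma psi_eq (e : SpinFrame G x) (A B C D : Fin 2) :
    psi e A B C D = spinor e.σ (wey G x) A B C D := by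
  simp only [psi, spinComp_four]; rfl

lemma spin4_sum {ι : Type*} [Fintype ι] (σ : Fin 2 → Fin 2 → Fin 4 → ℂ) (c : ι → ℂ)
    (t : ι → T4) (A B C D : Fin 2) :
    (1 / 4) * ∑ A', ∑ B', ∑ C', ∑ D', eps A' B' * eps C' D' *
        ∑ m, c m * spin4 σ (t m) A A' B B' C C' D D' =
      ∑ m, c m * spinor σ (t m) A B C D := by
  simp only [spinor, Fin.sum_univ_two, Finset.mul_sum, ← Finset.sum_add_distrib]
  refine Finset.sum_congr rfl fun m _ => ?_
  ring

lemma dPsi_eq (e : SpinFrame G x) (E E' A B C D : Fin 2) :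
    dPsi e E E' A B C D = ∑ m, e.σ E E' m * spinor e.σ (nab G m (wey G) x) A B C D := by
  rw [← spin4_sum, dPsi]
  simp only [spinComp_cons _ _ E E', spinComp_four, covD_weyl]

lemma ddPsi_eq (e : SpinFrame G x) (F F' E E' A B C D : Fin 2) :
    ddPsi e F F' E E' A B C D = ∑ n, e.σ F F' n * ∑ m, e.σ E E' m *
      spinor e.σ (nabnab G n m (wey G) x) A B C D := by
  have h : ∀ n, ∑ m, e.σ E E' m * spinor e.σ (nabnab G n m (wey G) x) A B C D =
      (1 / 4) * ∑ A', ∑ B', ∑ C', ∑ D', eps A' B' * eps C' D' *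
        ∑ m, e.σ E E' m * spin4 e.σ (nabnab G n m (wey G) x) A A' B B' C C' D D' :=
    fun n => (spin4_sum _ _ _ _ _ _ _).symm
  simp only [h]
  rw [ddPsi]
  simp only [spinComp_cons _ _ F F', spinComp_cons _ _ E E', spinComp_four, covD_covD_weyl]
  simp only [Fin.sum_univ_two, Finset.mul_sum, ← Finset.sum_add_distrib]
  refine Finset.sum_congr rfl fun n _ => Finset.sum_congr rfl fun m _ => ?_
  ring

/-! ### Spin frames as matrices -/

abbrev CMat : Type := Matrix (Fin 4) (Fin 4) ℂ

/-- Complexification of a real matrix. -/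
def toC : Mat →+* CMat := Complex.ofRealHom.mapMatrix

@[simp] lemma toC_apply (M : Mat) (i j : Fin 4) : toC M i j = (M i j : ℂ) := rfl

/-- The matrix with rows `σ 0 0`, `σ 0 1`, `σ 1 0`, `σ 1 1`. -/
def frameMat (σ : Fin 2 → Fin 2 → Fin 4 → ℂ) : CMat :=
  Matrix.of ![σ 0 0, σ 0 1, σ 1 0, σ 1 1]

/-- The metric in a spin frame. -/
def etaMat : CMat := !![0, 0, 0, 1; 0, 0, -1, 0; 0, -1, 0, 0; 1, 0, 0, 0]

lemma etaMat_sq : etaMat * etaMat = 1 := by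
  ext i j
  fin_cases i <;> fin_cases j <;> simp [etaMat, Matrix.mul_apply, Fin.sum_univ_four]

lemma frameMat_metric (e : SpinFrame G x) :
    frameMat e.σ * toC (G x) * (frameMat e.σ)ᵀ = etaMat := by
  have h : ∀ a b, (frameMat e.σ * toC (G x) * (frameMat e.σ)ᵀ) a b =
      ∑ i, ∑ j, (G x i j : ℂ) * frameMat e.σ a i * frameMat e.σ b j := by
    intro a b
    simp only [Matrix.mul_apply, Matrix.transpose_apply, toC_apply, Finset.sum_mul]
    rw [Finset.sum_comm]
    exact Finset.sum_congr rfl fun i _ => Finset.sum_congr rfl fun j _ => by ring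
  ext a b
  rw [h]
  fin_cases a <;> fin_cases b <;>
    refine (e.metric_eq _ _ _ _).trans ?_ <;> simp [eps, etaMat]

lemma frameMat_mul (e : SpinFrame G x) :
    (frameMat e.σ) * (toC (G x) * (frameMat e.σ)ᵀ * etaMat) = 1 := by
  rw [← mul_assoc, ← mul_assoc, frameMat_metric, etaMat_sq]

lemma frameMat_inv_mul (e : SpinFrame G x) :
    (toC (G x) * (frameMat e.σ)ᵀ * etaMat) * (frameMat e.σ) = 1 :=
  mul_eq_one_comm.1 (frameMat_mul e)

/-- `G⁻¹ = σᵀ η σ`. -/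
lemma toC_inv (hG : IsMetricOn G O) (hx : x ∈ O) (e : SpinFrame G x) :
    toC (G x)⁻¹ = (frameMat e.σ)ᵀ * etaMat * frameMat e.σ := by
  have h := frameMat_inv_mul e
  have h2 : toC (G x)⁻¹ * toC (G x) = 1 := by rw [← map_mul, hG.inv_mul hx, map_one]
  have h3 := congrArg (fun Z => toC (G x)⁻¹ * Z) h
  simp only [← mul_assoc, h2, one_mul, mul_one] at h3
  exact h3.symm

lemma inv_eq_sum (hG : IsMetricOn G O) (hx : x ∈ O) (e : SpinFrame G x) (i j : Fin 4) :
    (((G x)⁻¹ i j : ℝ) : ℂ) =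
      ∑ A, ∑ B, ∑ A', ∑ B', eps A B * eps A' B' * e.σ A A' i * e.σ B B' j := by
  rw [← toC_apply, toC_inv hG hx e]
  simp [Matrix.mul_apply, Fin.sum_univ_four, frameMat, etaMat, eps]
  ring

/-! ### The volume form in a spin frame -/

/-- Multilinear expansion of the determinant with every row written in the standard basis. -/
lemma sum_prod_det (M : CMat) :
    ∑ I : Fin 4 → Fin 4, (∏ s, M s (I s)) *
      Matrix.det (Matrix.of fun a b : Fin 4 => if I a = b then (1 : ℂ) else 0) = M.det := by
  have h : M = fun s => ∑ i, M s i • (fun b : Fin 4 => if i = b then (1 : ℂ) else 0) := by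
    ext s b; simp [Finset.sum_apply]
  conv_rhs => rw [h]
  change _ = (Matrix.detRowAlternating (n := Fin 4) (R := ℂ)).toMultilinearMap _
  rw [MultilinearMap.map_sum]
  refine Finset.sum_congr rfl fun I _ => ?_
  rw [MultilinearMap.map_smul_univ]
  rfl

lemma det_cast (I : Fin 4 → Fin 4) :
    ((Matrix.det (Matrix.of fun a b : Fin 4 => if I a = b then (1 : ℝ) else 0) : ℝ) : ℂ) =
      Matrix.det (Matrix.of fun a b : Fin 4 => if I a = b then (1 : ℂ) else 0) := by
  refine (Complex.ofRealHom.map_det _).trans ?_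
  congr 1
  ext a b
  simp only [RingHom.mapMatrix_apply, Matrix.map_apply, Matrix.of_apply]
  split_ifs <;> simp

lemma frameMat_det (e : SpinFrame G x) :
    (Real.sqrt (G x).det : ℂ) * (frameMat e.σ).det = -1 := by
  rw [← e.oriented, ← sum_prod_det, Finset.mul_sum, spinComp]
  refine Finset.sum_congr rfl fun I _ => ?_
  simp only [volForm, Complex.ofReal_mul, det_cast]
  rw [mul_left_comm]
  congr 1

lemma sum_eps4 (S : CMat) (a b c d : Fin 4) :
    ∑ i, ∑ j, ∑ p, ∑ q, S a i * S b j * S c p * S d q * (eps4 i j p q : ℂ) =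
      (eps4 a b c d : ℂ) * S.det := by
  have h := sum_prod_det (Matrix.of ![S a, S b, S c, S d])
  have h2 : (Matrix.of ![S a, S b, S c, S d] : CMat) =
      (Matrix.of fun s t : Fin 4 => if (![a, b, c, d] : Fin 4 → Fin 4) s = t then (1 : ℂ) else 0)
        * S := by
    ext s t
    simp only [Matrix.mul_apply, Matrix.of_apply, ite_mul, one_mul, zero_mul, Finset.sum_ite_eq,
      Finset.mem_univ, if_true]
    fin_cases s <;> rfl
  conv_rhs at h => rw [h2, Matrix.det_mul, ← det_cast]
  rw [eps4, ← h]
  simp only [sum_cons, Fintype.sum_unique]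
  refine Finset.sum_congr rfl fun i _ => Finset.sum_congr rfl fun j _ =>
    Finset.sum_congr rfl fun p _ => Finset.sum_congr rfl fun q _ => ?_
  rw [eps4, det_cast, Fin.prod_univ_four]
  rfl

/-! ### Anti-self-dual two-forms -/

/-- Spin components of a bilinear form. -/
def spin2 (σ : Fin 2 → Fin 2 → Fin 4 → ℂ) (F : Mat) (A A' B B' : Fin 2) : ℂ :=
  ∑ i, ∑ j, σ A A' i * σ B B' j * (F i j : ℂ)

/-- Anti-self-duality read in the null frame, where indices are raised with the constant matrix
`etaMat`. The orientation of the frame makes the density times det σ equal to -1, which absorbs the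
minus sign of anti-self-duality. -/
lemma frameMat_asd (hG : IsMetricOn G O) (hx : x ∈ O) (e : SpinFrame G x) {F : Mat}
    (h : F = - hodge (G x) F) (a b : Fin 4) :
    (frameMat e.σ * toC F * (frameMat e.σ)ᵀ) a b = (1 / 2) * ∑ c, ∑ d, (eps4 a b c d : ℂ) *
      (etaMat * (frameMat e.σ * toC F * (frameMat e.σ)ᵀ) * etaMat) c d := by
  set S := frameMat e.σ with hS
  set K := etaMat * (S * toC F * Sᵀ) * etaMat with hK
  have h1 : toC ((G x)⁻¹ * F * (G x)⁻¹) = Sᵀ * K * S := by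
    rw [map_mul, map_mul, toC_inv hG hx e, ← hS, hK]
    simp only [mul_assoc]
  have h2 : ∀ p q, ((((G x)⁻¹ * F * (G x)⁻¹) p q : ℝ) : ℂ) = ∑ c, ∑ d, S c p * S d q * K c d := by
    intro p q
    rw [← toC_apply, h1]
    simp only [Matrix.mul_apply, Matrix.transpose_apply, Finset.sum_mul]
    rw [Finset.sum_comm]
    exact Finset.sum_congr rfl fun c _ => Finset.sum_congr rfl fun d _ => by ring
  have h3 : ∀ i j, (F i j : ℂ) = - ((Real.sqrt (G x).det : ℂ) / 2) *
      ∑ c, ∑ d, K c d * ∑ p, ∑ q, S c p * S d q * (eps4 i j p q : ℂ) := by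
    intro i j
    have : ∀ c d, K c d * ∑ p, ∑ q, S c p * S d q * (eps4 i j p q : ℂ) =
        ∑ p, ∑ q, (eps4 i j p q : ℂ) * (S c p * S d q * K c d) := by
      intro c d
      simp only [Finset.mul_sum]
      exact Finset.sum_congr rfl fun p _ => Finset.sum_congr rfl fun q _ => by ring
    simp only [this]
    have h4 : ∑ c, ∑ d, ∑ p, ∑ q, (eps4 i j p q : ℂ) * (S c p * S d q * K c d) =
        ∑ p, ∑ q, (eps4 i j p q : ℂ) * ∑ c, ∑ d, S c p * S d q * K c d := by
      have h5 : ∀ c, ∑ d, ∑ p, ∑ q, (eps4 i j p q : ℂ) * (S c p * S d q * K c d) =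
          ∑ p, ∑ q, (eps4 i j p q : ℂ) * ∑ d, S c p * S d q * K c d := by
        intro c
        rw [Finset.sum_comm]
        refine Finset.sum_congr rfl fun p _ => ?_
        rw [Finset.sum_comm]
        exact Finset.sum_congr rfl fun q _ => by rw [Finset.mul_sum]
      simp only [h5]
      rw [Finset.sum_comm]
      refine Finset.sum_congr rfl fun p _ => ?_
      rw [Finset.sum_comm]
      exact Finset.sum_congr rfl fun q _ => by rw [Finset.mul_sum]
    rw [h4]
    simp only [← h2]
    conv_lhs => rw [h]
    simp [hodge, epsContr]
  have h6 : (S * toC F * Sᵀ) a b = ∑ i, ∑ j, S a i * S b j * (F i j : ℂ) := by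
    simp only [Matrix.mul_apply, Matrix.transpose_apply, toC_apply, Finset.sum_mul]
    rw [Finset.sum_comm]
    exact Finset.sum_congr rfl fun i _ => Finset.sum_congr rfl fun j _ => by ring
  have h7 : ∑ i, ∑ j, S a i * S b j * (F i j : ℂ) = - ((Real.sqrt (G x).det : ℂ) / 2) *
      ∑ c, ∑ d, K c d * ∑ i, ∑ j, ∑ p, ∑ q, S a i * S b j * S c p * S d q * (eps4 i j p q : ℂ) := by
    simp only [h3]
    have h8 : ∀ c d, K c d * ∑ i, ∑ j, ∑ p, ∑ q,
        S a i * S b j * S c p * S d q * (eps4 i j p q : ℂ) =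
        ∑ i, ∑ j, S a i * S b j * (K c d * ∑ p, ∑ q, S c p * S d q * (eps4 i j p q : ℂ)) := by
      intro c d
      simp only [Finset.mul_sum]
      exact Finset.sum_congr rfl fun i _ => Finset.sum_congr rfl fun j _ =>
        Finset.sum_congr rfl fun p _ => Finset.sum_congr rfl fun q _ => by ring
    simp only [h8]
    have h9 : ∀ f : Fin 4 → Fin 4 → Fin 4 → Fin 4 → ℂ,
        ∑ c, ∑ d, ∑ i, ∑ j, f i j c d = ∑ i, ∑ j, ∑ c, ∑ d, f i j c d := by
      intro f
      have : ∀ c, ∑ d, ∑ i, ∑ j, f i j c d = ∑ i, ∑ j, ∑ d, f i j c d := by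
        intro c
        rw [Finset.sum_comm]
        exact Finset.sum_congr rfl fun i _ => Finset.sum_comm
      simp only [this]
      rw [Finset.sum_comm]
      exact Finset.sum_congr rfl fun i _ => Finset.sum_comm
    rw [h9, Finset.mul_sum]
    refine Finset.sum_congr rfl fun i _ => ?_
    rw [Finset.mul_sum]
    refine Finset.sum_congr rfl fun j _ => ?_
    simp only [← Finset.mul_sum]
    ring
  rw [h6, h7]
  simp only [sum_eps4]
  have h10 := frameMat_det e
  rw [← hS] at h10
  simp only [Finset.mul_sum]
  refine Finset.sum_congr rfl fun c _ => Finset.sum_congr rfl fun d _ => ?_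
  linear_combination (-(1 / 2 : ℂ) * K c d * (eps4 a b c d : ℂ)) * h10

/-- In the basis 00', 01', 10', 11', an anti-self-dual form has vanishing entries 02 and 13 and
opposite entries 03 and 12. Together with antisymmetry this is proportionality to ε_{A'B'}; the
factor is recovered by tracing, since ε_{A'B'} ε^{A'B'} = 2. -/
lemma spin2_eq (hG : IsMetricOn G O) (hx : x ∈ O) (e : SpinFrame G x) {F : Mat}
    (ha : ∀ i j, F i j = - F j i) (h : F = - hodge (G x) F) (A A' B B' : Fin 2) :
    spin2 e.σ F A A' B B' =
      eps A' B' * ((1 / 2) * ∑ P', ∑ Q', eps P' Q' * spin2 e.σ F A P' B Q') := by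
  set X := frameMat e.σ * toC F * (frameMat e.σ)ᵀ with hX
  have h6 : ∀ a b, X a b = ∑ i, ∑ j, frameMat e.σ a i * frameMat e.σ b j * (F i j : ℂ) := by
    intro a b
    simp only [hX, Matrix.mul_apply, Matrix.transpose_apply, toC_apply, Finset.sum_mul]
    rw [Finset.sum_comm]
    exact Finset.sum_congr rfl fun i _ => Finset.sum_congr rfl fun j _ => by ring
  have hanti : ∀ a b, X a b = - X b a := by
    intro a b
    rw [h6, h6, Finset.sum_comm, ← Finset.sum_neg_distrib]
    refine Finset.sum_congr rfl fun i _ => ?_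
    rw [← Finset.sum_neg_distrib]
    refine Finset.sum_congr rfl fun j _ => ?_
    rw [ha j i]; push_cast; ring
  have key := frameMat_asd hG hx e h
  rw [← hX] at key
  have k02 := key 0 2
  have k13 := key 1 3
  have k03 := key 0 3
  simp [Fin.sum_univ_four, eps4_eq, etaMat, Matrix.mul_apply, Matrix.vecMul, dotProduct]
    at k02 k13 k03
  norm_num at k02 k13 k03
  have d : ∀ a, X a a = 0 := fun a => self_eq_neg.1 (hanti a a)
  have e02 : X 0 2 = 0 := by linear_combination (1 / 2) * k02 + (1 / 4) * hanti 2 0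
  have e13 : X 1 3 = 0 := by linear_combination (1 / 2) * k13 + (1 / 4) * hanti 3 1
  have e12 : X 1 2 = - X 0 3 := by linear_combination k03 + (1 / 2) * hanti 2 1
  have hs : ∀ A A' B B', spin2 e.σ F A A' B B' =
      X ((![![0, 1], ![2, 3]] : Fin 2 → Fin 2 → Fin 4) A A')
        ((![![0, 1], ![2, 3]] : Fin 2 → Fin 2 → Fin 4) B B') := by
    intro A A' B B'
    rw [h6]
    fin_cases A <;> fin_cases A' <;> fin_cases B <;> fin_cases B' <;> rfl
  simp only [hs, Fin.sum_univ_two]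
  fin_cases A <;> fin_cases A' <;> fin_cases B <;> fin_cases B' <;>
    simp [eps, d, e02, e13, e12, hanti 1 0, hanti 2 0, hanti 3 0, hanti 2 1, hanti 3 1,
      hanti 3 2] <;> ring

/-! ### Tensors of anti-self-dual Weyl type -/

lemma spin4_eq_spin2 (σ : Fin 2 → Fin 2 → Fin 4 → ℂ) (t : T4) (A A' B B' C C' D D' : Fin 2) :
    spin4 σ t A A' B B' C C' D D' =
      ∑ k, ∑ l, σ C C' k * σ D D' l * spin2 σ (slice t k l) A A' B B' := by
  simp only [spin4, spin2, slice, Matrix.of_apply, Finset.mul_sum]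
  have h9 : ∀ f : Fin 4 → Fin 4 → Fin 4 → Fin 4 → ℂ,
      ∑ c, ∑ d, ∑ i, ∑ j, f i j c d = ∑ i, ∑ j, ∑ c, ∑ d, f i j c d := by
    intro f
    have : ∀ c, ∑ d, ∑ i, ∑ j, f i j c d = ∑ i, ∑ j, ∑ d, f i j c d := by
      intro c
      rw [Finset.sum_comm]
      exact Finset.sum_congr rfl fun i _ => Finset.sum_comm
    simp only [this]
    rw [Finset.sum_comm]
    exact Finset.sum_congr rfl fun i _ => Finset.sum_comm
  rw [h9]
  exact Finset.sum_congr rfl fun i _ => Finset.sum_congr rfl fun j _ =>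
    Finset.sum_congr rfl fun p _ => Finset.sum_congr rfl fun q _ => by ring

lemma spin4_pair {t : T4} (h : ∀ i j k l, t i j k l = t k l i j)
    (σ : Fin 2 → Fin 2 → Fin 4 → ℂ) (A A' B B' C C' D D' : Fin 2) :
    spin4 σ t A A' B B' C C' D D' = spin4 σ t C C' D D' A A' B B' := by
  rw [spin4_eq_spin2]
  simp only [spin4, spin2, slice, Matrix.of_apply, Finset.mul_sum]
  exact Finset.sum_congr rfl fun i _ => Finset.sum_congr rfl fun j _ =>
    Finset.sum_congr rfl fun p _ => Finset.sum_congr rfl fun q _ => by rw [h]; ring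

lemma spin4_cyc {t : T4} (h : ∀ i j k l, t i j k l + t i k l j + t i l j k = 0)
    (σ : Fin 2 → Fin 2 → Fin 4 → ℂ) (A A' B B' C C' D D' : Fin 2) :
    spin4 σ t A A' B B' C C' D D' + spin4 σ t A A' C C' D D' B B'
      + spin4 σ t A A' D D' B B' C C' = 0 := by
  simp only [spin4, Finset.mul_sum, ← Finset.sum_add_distrib]
  refine Finset.sum_eq_zero fun i _ => ?_
  have h1 : ∑ k, ∑ l, ∑ j, σ A A' i * (σ C C' k * (σ D D' l * (σ B B' j * (t i k l j : ℂ)))) =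
      ∑ j, ∑ k, ∑ l, σ A A' i * (σ C C' k * (σ D D' l * (σ B B' j * (t i k l j : ℂ)))) := by
    rw [Finset.sum_comm]
    conv_rhs => rw [Finset.sum_comm]
    rw [Finset.sum_comm]
    exact Finset.sum_congr rfl fun k _ => Finset.sum_comm
  have h2 : ∑ l, ∑ j, ∑ k, σ A A' i * (σ D D' l * (σ B B' j * (σ C C' k * (t i l j k : ℂ)))) =
      ∑ j, ∑ k, ∑ l, σ A A' i * (σ D D' l * (σ B B' j * (σ C C' k * (t i l j k : ℂ)))) := by
    rw [Finset.sum_comm]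
    exact Finset.sum_congr rfl fun k _ => Finset.sum_comm
  simp only [Finset.sum_add_distrib]
  rw [h1, h2]
  simp only [← Finset.sum_add_distrib]
  refine Finset.sum_eq_zero fun j _ => Finset.sum_eq_zero fun k _ => Finset.sum_eq_zero fun l _ => ?_
  have := h i j k l
  have h3 : (t i j k l : ℂ) + t i k l j + t i l j k = 0 := by exact_mod_cast this
  linear_combination (σ A A' i * σ B B' j * σ C C' k * σ D D' l) * h3

lemma spin4_left (hG : IsMetricOn G O) (hx : x ∈ O) (e : SpinFrame G x) {t : T4}
    (ht : IsASDType (G x) t) (A A' B B' C C' D D' : Fin 2) :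
    spin4 e.σ t A A' B B' C C' D D' =
      eps A' B' * ((1 / 2) * ∑ P', ∑ Q', eps P' Q' * spin4 e.σ t A P' B Q' C C' D D') := by
  simp only [spin4_eq_spin2]
  have h : ∀ k l, spin2 e.σ (slice t k l) A A' B B' = eps A' B' * ((1 / 2) * ∑ P', ∑ Q',
      eps P' Q' * spin2 e.σ (slice t k l) A P' B Q') := fun k l =>
    spin2_eq hG hx e (fun i j => ht.anti i j k l) (ht.asd k l) A A' B B'
  simp only [h]
  simp only [Fin.sum_univ_two, Finset.mul_sum, ← Finset.sum_add_distrib]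
  exact Finset.sum_congr rfl fun p _ => Finset.sum_congr rfl fun q _ => by ring

/-- The factorisation of two-forms applied to both index pairs, the second one through pair
symmetry. The two factors 1/2 make up the 1/4 in `spinor`. -/
lemma spin4_eq (hG : IsMetricOn G O) (hx : x ∈ O) (e : SpinFrame G x) {t : T4}
    (ht : IsASDType (G x) t) (A A' B B' C C' D D' : Fin 2) :
    spin4 e.σ t A A' B B' C C' D D' = eps A' B' * eps C' D' * spinor e.σ t A B C D := by
  have hr : ∀ A A' B B', spin4 e.σ t A A' B B' C C' D D' =
      eps C' D' * ((1 / 2) * ∑ P', ∑ Q', eps P' Q' * spin4 e.σ t A A' B B' C P' D Q') := by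
    intro A A' B B'
    rw [spin4_pair ht.pair, spin4_left hG hx e ht]
    simp only [spin4_pair ht.pair e.σ C _ D _ A A' B B']
  rw [spin4_left hG hx e ht]
  simp only [hr, spinor, Fin.sum_univ_two]
  ring

lemma spinor_swap_left (hG : IsMetricOn G O) (hx : x ∈ O) (e : SpinFrame G x) {t : T4}
    (ht : IsASDType (G x) t) (A B C D : Fin 2) :
    spinor e.σ t A B C D = spinor e.σ t B A C D := by
  have h : ∀ A A' B B' C C' D D', spin4 e.σ t A A' B B' C C' D D' =
      - spin4 e.σ t B B' A A' C C' D D' := by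
    intro A A' B B' C C' D D'
    simp only [spin4_eq_spin2, ← Finset.sum_neg_distrib, spin2, Finset.mul_sum]
    refine Finset.sum_congr rfl fun k _ => Finset.sum_congr rfl fun l _ => ?_
    rw [Finset.sum_comm]
    refine Finset.sum_congr rfl fun j _ => Finset.sum_congr rfl fun i _ => ?_
    simp only [slice, Matrix.of_apply]
    rw [ht.anti i j]; push_cast; ring
  -- Primed values for which both ε factors are nonzero: the antisymmetry of t in its first pair is
  -- carried by ε_{A'B'}, so the unprimed part is symmetric.
  have h1 := h A 0 B 1 C 0 D 1
  rw [spin4_eq hG hx e ht, spin4_eq hG hx e ht] at h1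
  simpa [eps] using h1

lemma spinor_pair {t : T4} {g : Mat} (ht : IsASDType g t) (σ : Fin 2 → Fin 2 → Fin 4 → ℂ)
    (A B C D : Fin 2) : spinor σ t A B C D = spinor σ t C D A B := by
  simp only [spinor, Fin.sum_univ_two]
  simp only [spin4_pair ht.pair σ A _ B _ C _ D _]
  ring

lemma spinor_cyc (hG : IsMetricOn G O) (hx : x ∈ O) (e : SpinFrame G x) {t : T4}
    (ht : IsASDType (G x) t) (A B C D : Fin 2) :
    spinor e.σ t A B C D = spinor e.σ t A D B C := by
  -- With primed values 0, 1, 0, 1 the middle term of the cyclic sum contains ε_{0'0'} = 0, and the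
  -- remaining two terms have opposite signs.
  have h := spin4_cyc ht.cyc e.σ A 0 B 1 C 0 D 1
  simp only [spin4_eq hG hx e ht] at h
  simp [eps] at h
  linear_combination h

/-- The three symmetries generate all permutations of the indices, so a component depends only on
how many of its indices are 1, which is A + B + C + D. This reduces later spinor identities to
polynomial identities in five numbers. -/
lemma totally_symm {ψ : Fin 2 → Fin 2 → Fin 2 → Fin 2 → ℂ}
    (s : ∀ A B C D, ψ A B C D = ψ B A C D) (p : ∀ A B C D, ψ A B C D = ψ C D A B)
    (c : ∀ A B C D, ψ A B C D = ψ A D B C) :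
    ∃ q : ℕ → ℂ, ∀ A B C D : Fin 2, ψ A B C D = q ((A : ℕ) + B + C + D) := by
  have s34 : ∀ A B C D, ψ A B C D = ψ A B D C := fun A B C D => by rw [p, s, p]
  have s23 : ∀ A B C D, ψ A B C D = ψ A C B D := fun A B C D => by rw [c A C B D, s34, ← c]
  have h2 := s34 0 0 1 0
  have h4 := (s23 0 1 0 0).trans h2
  have h8 := (s 1 0 0 0).trans h4
  have h5 := s23 0 1 0 1
  have h6 := (s34 0 1 1 0).trans h5
  have h9 := (s 1 0 0 1).trans h5
  have h10 := (s 1 0 1 0).trans h6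
  have h12 := (s23 1 1 0 0).trans h10
  have h11 := s 1 0 1 1
  have h13 := (s23 1 1 0 1).trans h11
  have h14 := (s34 1 1 1 0).trans h13
  refine ⟨fun n => if n = 0 then ψ 0 0 0 0 else if n = 1 then ψ 0 0 0 1 else
    if n = 2 then ψ 0 0 1 1 else if n = 3 then ψ 0 1 1 1 else ψ 1 1 1 1, fun A B C D => ?_⟩
  fin_cases A <;> fin_cases B <;> fin_cases C <;> fin_cases D <;> simp <;> assumption

/-- The spinor of a tensor of anti-self-dual Weyl type is totally symmetric. -/
lemma spinor_totally_symm (hG : IsMetricOn G O) (hx : x ∈ O) (e : SpinFrame G x) {t : T4}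
    (ht : IsASDType (G x) t) : ∃ q : ℕ → ℂ, ∀ A B C D : Fin 2,
      spinor e.σ t A B C D = q ((A : ℕ) + B + C + D) :=
  totally_symm (spinor_swap_left hG hx e ht) (spinor_pair ht e.σ) (spinor_cyc hG hx e ht)

end ASDGravity

end

/-! ### Contractions in a spin frame and positivity of the norm -/

noncomputable section

namespace ASDGravity

variable {O : Set Coord} {x : Coord} {G : Metric}

/-! ### Contractions in a spin frame -/

lemma sum_inv_contr (hG : IsMetricOn G O) (hx : x ∈ O) (e : SpinFrame G x) (u v : Fin 4 → ℂ) :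
    ∑ i, ∑ j, (((G x)⁻¹ i j : ℝ) : ℂ) * (u i * v j) =
      (∑ i, e.σ 0 0 i * u i) * (∑ i, e.σ 1 1 i * v i)
      - (∑ i, e.σ 0 1 i * u i) * (∑ i, e.σ 1 0 i * v i)
      - (∑ i, e.σ 1 0 i * u i) * (∑ i, e.σ 0 1 i * v i)
      + (∑ i, e.σ 1 1 i * u i) * (∑ i, e.σ 0 0 i * v i) := by
  simp only [inv_eq_sum hG hx e, Finset.sum_mul_sum, ← Finset.sum_add_distrib,
    ← Finset.sum_sub_distrib]
  refine Finset.sum_congr rfl fun i _ => Finset.sum_congr rfl fun j _ => ?_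
  simp [Fin.sum_univ_two, eps]
  ring

/-- A spin frame spans. -/
lemma frame_injective (e : SpinFrame G x) {u : Fin 4 → ℂ}
    (h : ∀ A A', ∑ i, e.σ A A' i * u i = 0) : ∀ i, u i = 0 := by
  have h1 : (frameMat e.σ) *ᵥ u = 0 := by
    ext a
    fin_cases a
    · exact h 0 0
    · exact h 0 1
    · exact h 1 0
    · exact h 1 1
  have h2 := congrArg (fun z => (toC (G x) * (frameMat e.σ)ᵀ * etaMat) *ᵥ z) h1
  simp only [Matrix.mulVec_mulVec, frameMat_inv_mul, Matrix.one_mulVec, Matrix.mulVec_zero] at h2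
  exact fun i => congrFun h2 i

/-- The contraction `T_{ijk} = g^{lm} T_{m ijkl}` in a spin frame. -/
lemma contr_spin (hG : IsMetricOn G O) (hx : x ∈ O) (e : SpinFrame G x) {T : Fin 4 → T4}
    (hT : ∀ m, IsASDType (G x) (T m)) (A A' B B' C C' : Fin 2) :
    ∑ i, e.σ A A' i * ∑ j, e.σ B B' j * ∑ k, e.σ C C' k *
        ((∑ l, ∑ m, (G x)⁻¹ l m * T m i j k l : ℝ) : ℂ) =
      - eps A' B' * ∑ D, ∑ E, eps D E * ∑ m, e.σ E C' m * spinor e.σ (T m) A B C D := by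
  have h1 : ∀ i j k, ((∑ l, ∑ m, (G x)⁻¹ l m * T m i j k l : ℝ) : ℂ) =
      ∑ D, ∑ E, ∑ D', ∑ E', eps D E * eps D' E' * ∑ m, e.σ E E' m *
        ∑ l, e.σ D D' l * (T m i j k l : ℂ) := by
    intro i j k
    push_cast
    simp only [inv_eq_sum hG hx e, Fin.sum_univ_two, Finset.mul_sum, ← Finset.sum_add_distrib]
    rw [Finset.sum_comm]
    refine Finset.sum_congr rfl fun m _ => Finset.sum_congr rfl fun l _ => ?_
    ring
  have h2 : ∀ m D D', ∑ i, e.σ A A' i * ∑ j, e.σ B B' j * ∑ k, e.σ C C' k *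
      ∑ l, e.σ D D' l * (T m i j k l : ℂ) = eps A' B' * eps C' D' * spinor e.σ (T m) A B C D :=
    fun m D D' => spin4_eq hG hx e (hT m) A A' B B' C C' D D'
  have h3 : ∑ i, e.σ A A' i * ∑ j, e.σ B B' j * ∑ k, e.σ C C' k *
        ((∑ l, ∑ m, (G x)⁻¹ l m * T m i j k l : ℝ) : ℂ) =
      ∑ D, ∑ E, ∑ D', ∑ E', eps D E * eps D' E' * ∑ m, e.σ E E' m *
        (eps A' B' * eps C' D' * spinor e.σ (T m) A B C D) := by
    simp only [h1, ← h2]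
    simp only [Fin.sum_univ_two, Finset.mul_sum, ← Finset.sum_add_distrib]
    conv_rhs => rw [Finset.sum_comm]
    refine Finset.sum_congr rfl fun i _ => ?_
    conv_rhs => rw [Finset.sum_comm]
    refine Finset.sum_congr rfl fun j _ => ?_
    conv_rhs => rw [Finset.sum_comm]
    refine Finset.sum_congr rfl fun k _ => ?_
    refine Finset.sum_congr rfl fun m _ => Finset.sum_congr rfl fun l _ => ?_
    ring
  rw [h3]
  -- The primed contraction is trivial: the matrix ε squares to -1, so ε_{C'D'} ε^{D'E'} replaces E'
  -- by C' with a sign.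
  have h4 : ∀ D E, ∑ D', ∑ E', eps D E * eps D' E' * ∑ m, e.σ E E' m *
        (eps A' B' * eps C' D' * spinor e.σ (T m) A B C D) =
      - eps A' B' * (eps D E * ∑ m, e.σ E C' m * spinor e.σ (T m) A B C D) := by
    intro D E
    simp only [Finset.mul_sum, Fin.sum_univ_two, ← Finset.sum_add_distrib]
    refine Finset.sum_congr rfl fun m _ => ?_
    fin_cases C' <;> simp [eps] <;> ring
  simp only [h4, ← Finset.mul_sum]

/-- By `contr_spin` the two sides differ by the factor ε_{A'B'}. It equals 1 for the primed pair 0,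
1, which gives one direction; the other uses that the frame spans, one index at a time. -/
lemma contr_eq_zero_iff (hG : IsMetricOn G O) (hx : x ∈ O) (e : SpinFrame G x) {T : Fin 4 → T4}
    (hT : ∀ m, IsASDType (G x) (T m)) :
    (∀ i j k, ∑ l, ∑ m, (G x)⁻¹ l m * T m i j k l = 0) ↔
      ∀ A B C C', ∑ D, ∑ E, eps D E * ∑ m, e.σ E C' m * spinor e.σ (T m) A B C D = 0 := by
  constructor
  · intro h A B C C'
    have h1 := contr_spin hG hx e hT A 0 B 1 C C'
    simp only [h] at h1
    simp only [Complex.ofReal_zero, mul_zero, Finset.sum_const_zero] at h1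
    have h2 : eps 0 1 = 1 := by simp [eps]
    rw [h2] at h1
    linear_combination h1
  · intro h
    have h1 := contr_spin hG hx e hT
    simp only [h, mul_zero] at h1
    intro i j k
    have h2 : ∀ i, ∀ B B' C C', ∑ j, e.σ B B' j * ∑ k, e.σ C C' k *
        ((∑ l, ∑ m, (G x)⁻¹ l m * T m i j k l : ℝ) : ℂ) = 0 := fun i B B' C C' =>
      frame_injective e (fun A A' => h1 A A' B B' C C') i
    have h3 : ∀ i j, ∀ C C', ∑ k, e.σ C C' k *
        ((∑ l, ∑ m, (G x)⁻¹ l m * T m i j k l : ℝ) : ℂ) = 0 := fun i j C C' =>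
      frame_injective e (fun A A' => h2 i A A' C C') j
    have h4 := frame_injective e (fun A A' => h3 i j A A') k
    exact_mod_cast h4

/-! ### The norm of the Weyl spinor -/

/-- Serves to contract one index after another: ι collects the indices already expressed through the
square root R, and the result has the form needed for the next index. -/
lemma quad_contr (M R : Mat) (hM : M = Rᵀ * R) {ι : Type*} [Fintype ι] (u v : ι → Fin 4 → ℝ) :
    ∑ i, ∑ j, M i j * ∑ p, u p i * v p j =
      ∑ q : ι × Fin 4, (∑ i, R q.2 i * u q.1 i) * (∑ i, R q.2 i * v q.1 i) := by
  rw [Fintype.sum_prod_type]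
  conv_lhs => simp only [Finset.mul_sum]
  have h : ∀ i, ∑ j, ∑ p, M i j * (u p i * v p j) = ∑ p, ∑ j, M i j * (u p i * v p j) :=
    fun i => Finset.sum_comm
  simp only [h]
  rw [Finset.sum_comm]
  refine Finset.sum_congr rfl fun p _ => ?_
  simp only [Finset.sum_mul_sum]
  simp only [hM, Matrix.mul_apply, Matrix.transpose_apply, Finset.sum_mul]
  have h2 : ∀ i, ∑ j, ∑ a, R a i * R a j * (u p i * v p j)
      = ∑ a, ∑ j, R a i * R a j * (u p i * v p j) := fun i => Finset.sum_comm
  simp only [h2]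
  rw [Finset.sum_comm]
  exact Finset.sum_congr rfl fun a _ => Finset.sum_congr rfl fun i _ =>
    Finset.sum_congr rfl fun j _ => by ring

/-- The complete contraction of a tensor of rank four with itself. -/
def normSq4 (M : Mat) (t : T4) : ℝ :=
  ∑ i, ∑ i', M i i' * ∑ j, ∑ j', M j j' * ∑ k, ∑ k', M k k' * ∑ l, ∑ l', M l l' *
    (t i j k l * t i' j' k' l')

open scoped MatrixOrder Matrix.Norms.L2Operator in
lemma exists_eq_transpose_mul_self {M : Mat} (hM : M.PosDef) : ∃ R : Mat, M = Rᵀ * R := by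
  obtain ⟨R, hR⟩ := CStarAlgebra.nonneg_iff_eq_star_mul_self.mp hM.posSemidef.nonneg
  exact ⟨R, by rw [hR, Matrix.star_eq_conjTranspose, Matrix.conjTranspose_eq_transpose_of_trivial]⟩

set_option maxRecDepth 4000 in
-- With M = RᵀR the contraction is the sum of the squares of the components of t transformed by R in
-- every index. If it vanishes they all do, and R is injective.
lemma normSq4_ne_zero {M : Mat} (hM : M.PosDef) {t : T4} (ht : t ≠ 0) : normSq4 M t ≠ 0 := by
  obtain ⟨R, hR⟩ := exists_eq_transpose_mul_self hM
  have hinj : ∀ u : Fin 4 → ℝ, (∀ a, ∑ i, R a i * u i = 0) → ∀ i, u i = 0 := by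
    intro u hu
    have h1 : R *ᵥ u = 0 := funext hu
    have h2 : M *ᵥ u = 0 := by rw [hR, ← Matrix.mulVec_mulVec, h1, Matrix.mulVec_zero]
    have h3 := congrArg (fun z => M⁻¹ *ᵥ z) h2
    simp only [Matrix.mulVec_mulVec, Matrix.mulVec_zero,
      Matrix.nonsing_inv_mul _ (IsUnit.mk0 _ hM.det_pos.ne'), Matrix.one_mulVec] at h3
    exact fun i => congrFun h3 i
  intro h0
  have h1 : ∀ i j k i' j' k', ∑ l, ∑ l', M l l' * (t i j k l * t i' j' k' l') =
      ∑ q : Unit × Fin 4, (∑ l, R q.2 l * t i j k l) * (∑ l, R q.2 l * t i' j' k' l) := by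
    intro i j k i' j' k'
    rw [← quad_contr M R hR (fun (_ : Unit) => t i j k) (fun _ => t i' j' k')]
    simp
  unfold normSq4 at h0
  simp only [h1] at h0
  simp only [fun i j i' j' => quad_contr M R hR
    (fun (q : Unit × Fin 4) k => ∑ l, R q.2 l * t i j k l) (fun q k => ∑ l, R q.2 l * t i' j' k l)]
    at h0
  simp only [fun i i' => quad_contr M R hR
    (fun (q : (Unit × Fin 4) × Fin 4) j => ∑ k, R q.2 k * ∑ l, R q.1.2 l * t i j k l)
    (fun q j => ∑ k, R q.2 k * ∑ l, R q.1.2 l * t i' j k l)] at h0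
  rw [quad_contr M R hR (fun (q : ((Unit × Fin 4) × Fin 4) × Fin 4) i =>
      ∑ j, R q.2 j * ∑ k, R q.1.2 k * ∑ l, R q.1.1.2 l * t i j k l)
    (fun q i => ∑ j, R q.2 j * ∑ k, R q.1.2 k * ∑ l, R q.1.1.2 l * t i j k l)] at h0
  rw [Finset.sum_eq_zero_iff_of_nonneg fun q _ => mul_self_nonneg _] at h0
  replace h0 := fun q => h0 q (Finset.mem_univ q)
  apply ht
  funext i j k l
  refine hinj (t i j k) (fun a => ?_) l
  refine hinj (fun k => ∑ l, R a l * t i j k l) (fun b => ?_) k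
  refine hinj (fun j => ∑ k, R b k * ∑ l, R a l * t i j k l) (fun c => ?_) j
  refine hinj (fun i => ∑ j, R c j * ∑ k, R b k * ∑ l, R a l * t i j k l) (fun d => ?_) i
  exact mul_self_eq_zero.1 (h0 (((((), a), b), c), d))

end ASDGravity

end

/-! ### The Weyl spinor, its divergence equation and the second condition -/

noncomputable section

namespace ASDGravity

variable {O : Set Coord} {x : Coord} {G : Metric}

/-- The factor 2 is ε_{A'B'} ε^{A'B'}; what remains is φ_{AB} χ^{AB} written out for symmetric
spinors. -/
lemma sum_inv_contr_two (hG : IsMetricOn G O) (hx : x ∈ O) (e : SpinFrame G x)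
    {f h : Fin 4 → Fin 4 → ℂ} {φ χ : Fin 2 → Fin 2 → ℂ}
    (hf : ∀ A A' B B', ∑ i, e.σ A A' i * ∑ j, e.σ B B' j * f i j = eps A' B' * φ A B)
    (hh : ∀ A A' B B', ∑ i, e.σ A A' i * ∑ j, e.σ B B' j * h i j = eps A' B' * χ A B)
    (hφ : φ 1 0 = φ 0 1) (hχ : χ 1 0 = χ 0 1) :
    ∑ i, ∑ i', (((G x)⁻¹ i i' : ℝ) : ℂ) * ∑ j, ∑ j', (((G x)⁻¹ j j' : ℝ) : ℂ) *
      (f i j * h i' j') = 2 * (φ 0 0 * χ 1 1 - 2 * (φ 0 1 * χ 0 1) + φ 1 1 * χ 0 0) := by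
  simp only [fun i i' => sum_inv_contr hG hx e (f i) (h i'), mul_add, mul_sub,
    Finset.sum_add_distrib, Finset.sum_sub_distrib]
  rw [sum_inv_contr hG hx e (fun i => ∑ j, e.σ 0 0 j * f i j) (fun i => ∑ j, e.σ 1 1 j * h i j),
    sum_inv_contr hG hx e (fun i => ∑ j, e.σ 0 1 j * f i j) (fun i => ∑ j, e.σ 1 0 j * h i j),
    sum_inv_contr hG hx e (fun i => ∑ j, e.σ 1 0 j * f i j) (fun i => ∑ j, e.σ 0 1 j * h i j),
    sum_inv_contr hG hx e (fun i => ∑ j, e.σ 1 1 j * f i j) (fun i => ∑ j, e.σ 0 0 j * h i j)]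
  simp only [hf, hh]
  simp [eps, hφ, hχ]
  ring

lemma spin2_antisymm (σ : Fin 2 → Fin 2 → Fin 4 → ℂ) {F : Mat} (ha : ∀ i j, F i j = - F j i)
    (A A' B B' : Fin 2) : spin2 σ F A A' B B' = - spin2 σ F B B' A A' := by
  simp only [spin2]
  rw [Finset.sum_comm, ← Finset.sum_neg_distrib]
  refine Finset.sum_congr rfl fun i _ => ?_
  rw [← Finset.sum_neg_distrib]
  refine Finset.sum_congr rfl fun j _ => ?_
  rw [ha j i]; push_cast; ring

lemma spin2_eq' (σ : Fin 2 → Fin 2 → Fin 4 → ℂ) (F : Mat) (A A' B B' : Fin 2) :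
    spin2 σ F A A' B B' = ∑ i, σ A A' i * ∑ j, σ B B' j * (F i j : ℂ) := by
  simp only [spin2, Finset.mul_sum, mul_assoc]

/-- Each of the two index pairs contributes ε_{A'B'} ε^{A'B'} = 2, whence |t|² = 4 Ψ_{ABCD}
Ψ^{ABCD}; the coefficients 2, -8, 6 are binomial, by total symmetry. -/
lemma normSq4_eq_spinor (hG : IsMetricOn G O) (hx : x ∈ O) (e : SpinFrame G x) {t : T4}
    (ht : IsASDType (G x) t) {q : ℕ → ℂ}
    (hq : ∀ A B C D : Fin 2, spinor e.σ t A B C D = q ((A : ℕ) + B + C + D)) :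
    (normSq4 (G x)⁻¹ t : ℂ) = 4 * (2 * (q 0 * q 4) - 8 * (q 1 * q 3) + 6 * (q 2 * q 2)) := by
  set χ : Fin 4 → Fin 4 → Fin 2 → Fin 2 → ℂ := fun i j C D =>
    (1 / 2) * ∑ P', ∑ Q', eps P' Q' * spin2 e.σ (slice t i j) C P' D Q' with hχ
  have h1 : ∀ i j C C' D D', ∑ k, e.σ C C' k * ∑ l, e.σ D D' l * (t i j k l : ℂ) =
      eps C' D' * χ i j C D := by
    intro i j C C' D D'
    refine Eq.trans ?_ (spin2_eq hG hx e (F := slice t i j) (fun k l => ht.anti k l i j)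
      (ht.asd i j) C C' D D')
    rw [spin2_eq']
    simp only [slice, Matrix.of_apply, ht.pair i j]
  have hs : ∀ i j, χ i j 1 0 = χ i j 0 1 := by
    intro i j
    have ha := spin2_antisymm e.σ (F := slice t i j) (fun k l => ht.anti k l i j)
    simp only [hχ, Fin.sum_univ_two, ha 1 _ 0 _]
    simp [eps]; ring
  have h2 : ∀ C D A A' B B', ∑ i, e.σ A A' i * ∑ j, e.σ B B' j * χ i j C D =
      eps A' B' * spinor e.σ t A B C D := by
    intro C D A A' B B'
    have h3 : ∀ C' D', ∑ i, e.σ A A' i * ∑ j, e.σ B B' j * (eps C' D' * χ i j C D) =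
        eps A' B' * eps C' D' * spinor e.σ t A B C D := by
      intro C' D'
      simp only [← h1, ← spin4_eq hG hx e ht]
      rfl
    have h4 := h3 0 1
    simpa [eps] using h4
  have h5 : ∀ i j i' j', ∑ k, ∑ k', (((G x)⁻¹ k k' : ℝ) : ℂ) * ∑ l, ∑ l',
      (((G x)⁻¹ l l' : ℝ) : ℂ) * ((t i j k l : ℂ) * (t i' j' k' l' : ℂ)) =
      2 * (χ i j 0 0 * χ i' j' 1 1) - 4 * (χ i j 0 1 * χ i' j' 0 1)
        + 2 * (χ i j 1 1 * χ i' j' 0 0) := by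
    intro i j i' j'
    rw [sum_inv_contr_two hG hx e (h1 i j) (h1 i' j') (hs i j) (hs i' j')]
    ring
  have hsym : ∀ C D, spinor e.σ t 1 0 C D = spinor e.σ t 0 1 C D := fun C D => by
    rw [hq, hq]; rfl
  have h6 : ∀ C D C' D' : Fin 2, ∀ c : ℂ, ∑ i, ∑ i', (((G x)⁻¹ i i' : ℝ) : ℂ) * ∑ j, ∑ j',
      (((G x)⁻¹ j j' : ℝ) : ℂ) * (c * (χ i j C D * χ i' j' C' D')) = c *
      (2 * (spinor e.σ t 0 0 C D * spinor e.σ t 1 1 C' D'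
        - 2 * (spinor e.σ t 0 1 C D * spinor e.σ t 0 1 C' D')
        + spinor e.σ t 1 1 C D * spinor e.σ t 0 0 C' D')) := by
    intro C D C' D' c
    rw [← sum_inv_contr_two hG hx e (h2 C D) (h2 C' D') (hsym C D) (hsym C' D')]
    simp only [Finset.mul_sum]
    exact Finset.sum_congr rfl fun _ _ => Finset.sum_congr rfl fun _ _ =>
      Finset.sum_congr rfl fun _ _ => Finset.sum_congr rfl fun _ _ => by ring
  unfold normSq4
  push_cast
  simp only [h5, mul_add, mul_sub, Finset.sum_add_distrib, Finset.sum_sub_distrib, h6, hq]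
  simp
  ring

lemma normSqPsi_eq (e : SpinFrame G x) {q : ℕ → ℂ}
    (hq : ∀ A B C D : Fin 2, psi e A B C D = q ((A : ℕ) + B + C + D)) :
    normSqPsi e = 2 * (q 0 * q 4) - 8 * (q 1 * q 3) + 6 * (q 2 * q 2) := by
  simp [normSqPsi, hq, Fin.sum_univ_two, eps]
  ring

lemma psi_totally_symm (hG : IsMetricOn G O) (hx : x ∈ O) (h : WeylASDAt G x)
    (e : SpinFrame G x) :
    ∃ q : ℕ → ℂ, ∀ A B C D : Fin 2, psi e A B C D = q ((A : ℕ) + B + C + D) := by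
  simp only [psi_eq]
  exact spinor_totally_symm hG hx e (wey_isASDType hG hx h)

lemma wey_ne_zero (h : weyl G x ≠ 0) : wey G x ≠ 0 := by
  intro h0
  apply h
  funext I
  have e : I = ![I 0, I 1, I 2, I 3] := by ext a; fin_cases a <;> rfl
  rw [e]
  exact congrFun (congrFun (congrFun (congrFun h0 _) _) _) _

/-- This is where definiteness of the metric enters: 4|ψ|² is the Riemannian norm of the Weyl
tensor. A complex quartic spinor may be null without being zero. -/
lemma normSqPsi_ne_zero (hG : IsMetricOn G O) (hx : x ∈ O) (h : WeylASDAt G x)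
    (hne : weyl G x ≠ 0) (e : SpinFrame G x) : normSqPsi e ≠ 0 := by
  obtain ⟨q, hq⟩ := psi_totally_symm hG hx h e
  have h1 := normSq4_eq_spinor hG hx e (wey_isASDType hG hx h) (q := q)
    (by simpa only [psi_eq] using hq)
  rw [← normSqPsi_eq e hq] at h1
  have h2 := normSq4_ne_zero (hG.posDef x hx).inv (wey_ne_zero hne)
  intro h0
  rw [h0, mul_zero] at h1
  exact h2 (by exact_mod_cast h1)

/-- The Weyl spinor has no kernel. -/
lemma psi_injective (hG : IsMetricOn G O) (hx : x ∈ O) (h : WeylASDAt G x)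
    (hne : weyl G x ≠ 0) (e : SpinFrame G x) {u : Fin 2 → ℂ}
    (hu : ∀ A B C, ∑ D, psi e A B C D * u D = 0) : ∀ D, u D = 0 := by
  obtain ⟨q, hq⟩ := psi_totally_symm hG hx h e
  have h0 := normSqPsi_ne_zero hG hx h hne e
  rw [normSqPsi_eq e hq] at h0
  simp only [hq, Fin.sum_univ_two] at hu
  have e0 := hu 0 0 0
  have e1 := hu 0 0 1
  have e2 := hu 0 1 1
  have e3 := hu 1 1 1
  simp at e0 e1 e2 e3
  -- Contraction with ψ in the indices A, B, C. The product ψ^{ABC}_E ψ_{ABCD} is antisymmetric in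
  -- D, E, hence a multiple of |ψ|² ε_{ED}; the coefficients 1, 3, 3, 1 count index orderings.
  have k0 : (2 * (q 0 * q 4) - 8 * (q 1 * q 3) + 6 * (q 2 * q 2)) * u 0 = 0 := by
    linear_combination 2 * (q 4 * e0 - 3 * q 3 * e1 + 3 * q 2 * e2 - q 1 * e3)
  have k1 : (2 * (q 0 * q 4) - 8 * (q 1 * q 3) + 6 * (q 2 * q 2)) * u 1 = 0 := by
    linear_combination 2 * (q 0 * e3 - 3 * q 1 * e2 + 3 * q 2 * e1 - q 3 * e0)
  intro D
  fin_cases D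
  · exact (mul_eq_zero.1 k0).resolve_left h0
  · exact (mul_eq_zero.1 k1).resolve_left h0

/-! ### The equation `∇^d C_{abcd} = C_{abcd} V^d` -/

/-- Spin components of a covector. -/
def spin1 (e : SpinFrame G x) (v : Fin 4 → ℝ) (A A' : Fin 2) : ℂ := ∑ i, e.σ A A' i * (v i : ℂ)

lemma spinor_sub (σ : Fin 2 → Fin 2 → Fin 4 → ℂ) (s t : T4) (A B C D : Fin 2) :
    spinor σ (s - t) A B C D = spinor σ s A B C D - spinor σ t A B C D := by
  have h : ∀ A A' B B' C C' D D', spin4 σ (s - t) A A' B B' C C' D D' =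
      spin4 σ s A A' B B' C C' D D' - spin4 σ t A A' B B' C C' D D' := by
    intro A A' B B' C C' D D'
    simp [spin4, mul_sub, Finset.sum_sub_distrib]
  simp only [spinor, h, mul_sub, Finset.sum_sub_distrib]

lemma spinor_smul (σ : Fin 2 → Fin 2 → Fin 4 → ℂ) (c : ℝ) (t : T4) (A B C D : Fin 2) :
    spinor σ (c • t) A B C D = c * spinor σ t A B C D := by
  have h : ∀ A A' B B' C C' D D', spin4 σ (c • t) A A' B B' C C' D D' =
      c * spin4 σ t A A' B B' C C' D D' := by
    intro A A' B B' C C' D D'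
    simp [spin4, Finset.mul_sum, mul_left_comm]
  simp only [spinor, h, Fin.sum_univ_two]
  ring

/-- The divergence of the Weyl tensor is its contraction with the covector `v` at `x`. -/
def DivEq (G : Metric) (v : Fin 4 → ℝ) (x : Coord) : Prop :=
  ∀ i j k, ∑ l, ∑ m, (G x)⁻¹ l m * (nab G m (wey G) x i j k l - v m * wey G x i j k l) = 0

/-- For each m the tensor ∇_m C - v_m C is of anti-self-dual Weyl type, so its contraction vanishes
exactly when the contraction of the corresponding spinor does. -/
lemma divEq_iff (hG : IsMetricOn G O) (hx : x ∈ O) (h : ∀ y ∈ O, WeylASDAt G y)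
    (e : SpinFrame G x) (v : Fin 4 → ℝ) :
    DivEq G v x ↔ ∀ A' A B C,
      W e A' A B C = ∑ D, psi e A B C D * ∑ E, eps D E * spin1 e v E A' := by
  have hT : ∀ m, IsASDType (G x) (nab G m (wey G) x - v m • wey G x) := fun m =>
    (asdSubmodule (G x)).sub_mem (nab_isASDType hG h hx m)
      ((asdSubmodule (G x)).smul_mem _ (wey_isASDType hG hx (h x hx)))
  have h1 := contr_eq_zero_iff hG hx e hT
  have h2 : ∀ A B C C', ∑ D, ∑ E, eps D E * ∑ m, e.σ E C' m *
      spinor e.σ (nab G m (wey G) x - v m • wey G x) A B C D =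
      W e C' A B C - ∑ D, psi e A B C D * ∑ E, eps D E * spin1 e v E C' := by
    intro A B C C'
    simp only [spinor_sub, spinor_smul, mul_sub, Finset.sum_sub_distrib, W, dPsi_eq, psi_eq, spin1,
      Finset.mul_sum]
    congr 1
    refine Finset.sum_congr rfl fun D _ => Finset.sum_congr rfl fun E _ =>
      Finset.sum_congr rfl fun m _ => by ring
  simp only [h2] at h1
  simp only [sub_eq_zero] at h1
  refine Iff.trans (Iff.of_eq rfl) (h1.trans ?_)
  exact ⟨fun H A' A B C => H A B C A', fun H A B C A' => H A' A B C⟩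

/-- If the divergence of the Weyl tensor is `C_{abcd} v^d`, then `V` is `v`. -/
lemma V_eq (hG : IsMetricOn G O) (hx : x ∈ O) (h : WeylASDAt G x)
    (hne : weyl G x ≠ 0) (e : SpinFrame G x) {u : Fin 2 → Fin 2 → ℂ}
    (hW : ∀ A' A B C, W e A' A B C = ∑ D, psi e A B C D * ∑ E, eps D E * u E A')
    (A A' : Fin 2) : V e A A' = u A A' := by
  obtain ⟨q, hq⟩ := psi_totally_symm hG hx h e
  have h0 := normSqPsi_ne_zero hG hx h hne e
  have h1 := normSqPsi_eq e hq
  -- The contraction of ψ with itself over three indices is half of |ψ|² times ε; the factor 2 in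
  -- the definition of V compensates the half.
  have h2 : normSqPsi e * V e A A' = normSqPsi e * u A A' := by
    rw [V, ← mul_assoc, mul_div_cancel₀ _ h0, h1]
    simp only [hW, hq]
    fin_cases A <;> simp [Fin.sum_univ_two, eps] <;> ring
  exact mul_left_cancel₀ h0 h2

/-! ### The second condition -/

/-- The derivative of `DivEq`; `dv n m` stands for `∇_n v_m`. -/
def DerivDivEq (G : Metric) (v : Fin 4 → ℝ) (dv : Mat) (x : Coord) : Prop :=
  ∀ n i j k, ∑ l, ∑ m, (G x)⁻¹ l m * (nabnab G n m (wey G) x i j k l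
    - dv n m * wey G x i j k l - v m * nab G n (wey G) x i j k l) = 0

/-- The Leibniz rule for W = ψ v, obtained by passing to spinors in the differentiated tensor
equation; no derivative of a spin frame is taken. -/
lemma dW_eq (hG : IsMetricOn G O) (hx : x ∈ O) (h : ∀ y ∈ O, WeylASDAt G y)
    (e : SpinFrame G x) {v : Fin 4 → ℝ} {dv : Mat} (hd : DerivDivEq G v dv x)
    (E E' A' A B C : Fin 2) :
    dW e E E' A' A B C = (∑ D, psi e A B C D * ∑ F, eps D F * spin2 e.σ dv E E' F A')
      + ∑ D, dPsi e E E' A B C D * ∑ F, eps D F * spin1 e v F A' := by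
  have hT : ∀ n m, IsASDType (G x)
      (nabnab G n m (wey G) x - dv n m • wey G x - v m • nab G n (wey G) x) := fun n m =>
    (asdSubmodule (G x)).sub_mem ((asdSubmodule (G x)).sub_mem (nabnab_isASDType hG h hx n m)
      ((asdSubmodule (G x)).smul_mem _ (wey_isASDType hG hx (h x hx))))
      ((asdSubmodule (G x)).smul_mem _ (nab_isASDType hG h hx n))
  have h1 := fun n => (contr_eq_zero_iff hG hx e (hT n)).1 (hd n) A B C A'
  simp only [spinor_sub, spinor_smul] at h1
  have h2 : ∑ n, e.σ E E' n * ∑ D, ∑ F, eps D F * ∑ m, e.σ F A' m *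
      (spinor e.σ (nabnab G n m (wey G) x) A B C D - dv n m * spinor e.σ (wey G x) A B C D
        - v m * spinor e.σ (nab G n (wey G) x) A B C D) = 0 :=
    Finset.sum_eq_zero fun n _ => by rw [h1, mul_zero]
  rw [← sub_eq_zero, ← h2]
  have h3 : ∀ D F, dPsi e E E' A B C D * (eps D F * spin1 e v F A') =
      ∑ n, ∑ m, eps D F * ((e.σ E E' n * spinor e.σ (nab G n (wey G) x) A B C D)
        * (e.σ F A' m * v m)) := by
    intro D F
    rw [dPsi_eq, spin1, mul_left_comm, Finset.sum_mul_sum]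
    simp only [Finset.mul_sum]
  have h4 : ∑ D, dPsi e E E' A B C D * ∑ F, eps D F * spin1 e v F A' =
      ∑ D, ∑ F, dPsi e E E' A B C D * (eps D F * spin1 e v F A') := by
    simp only [Finset.mul_sum]
  rw [h4]
  simp only [h3]
  simp only [dW, ddPsi_eq, psi_eq, spin2, Fin.sum_univ_two, Finset.mul_sum,
    ← Finset.sum_add_distrib, ← Finset.sum_sub_distrib]
  refine Finset.sum_congr rfl fun n _ => Finset.sum_congr rfl fun m _ => ?_
  ring

/-- `P_{ij} + ∇_j v_i + v_i v_j - (1/2) |v|² g_{ij}`, with `dv j i = ∇_j v_i`. -/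
def obstr (G : Metric) (v : Fin 4 → ℝ) (dv : Mat) (x : Coord) : Mat := Matrix.of fun i j =>
  schouten G x i j + dv j i + v i * v j - (1 / 2) * (∑ k, ∑ l, (G x)⁻¹ k l * (v k * v l)) * G x i j

/-- The trace term is absorbed by the spinor identity v_{FA'} v_{EE'} - (1/2)|v|² ε_{FE} ε_{A'E'} =
v_{FE'} v_{EA'}, which rests on |v|² = 2(v_{00'} v_{11'} - v_{01'} v_{10'}). -/
lemma spin2_obstr (hG : IsMetricOn G O) (hx : x ∈ O) (e : SpinFrame G x) (v : Fin 4 → ℝ)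
    (dv : Mat) (F A' E E' : Fin 2) :
    spin2 e.σ (obstr G v dv x) F A' E E' = pSpin e F A' E E' + spin2 e.σ dv E E' F A'
      + spin1 e v F E' * spin1 e v E A' := by
  have h1 : spin2 e.σ (obstr G v dv x) F A' E E' = pSpin e F A' E E' + spin2 e.σ dv E E' F A'
      + spin1 e v F A' * spin1 e v E E'
      - (1 / 2) * ((∑ k, ∑ l, (G x)⁻¹ k l * (v k * v l) : ℝ) : ℂ) * (eps F E * eps A' E') := by
    have hs : spin2 e.σ dv E E' F A' = ∑ i, ∑ j, e.σ E E' j * e.σ F A' i * (dv j i : ℂ) :=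
      Finset.sum_comm
    rw [← e.metric_eq, hs, spin1, spin1, Finset.sum_mul_sum, pSpin, spin2]
    simp only [Finset.mul_sum, ← Finset.sum_add_distrib, ← Finset.sum_sub_distrib]
    refine Finset.sum_congr rfl fun i _ => Finset.sum_congr rfl fun j _ => ?_
    simp only [obstr, Matrix.of_apply]
    push_cast
    simp only [Finset.mul_sum]
    ring
  have h2 : ((∑ k, ∑ l, (G x)⁻¹ k l * (v k * v l) : ℝ) : ℂ) =
      2 * (spin1 e v 0 0 * spin1 e v 1 1 - spin1 e v 0 1 * spin1 e v 1 0) := by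
    push_cast
    rw [sum_inv_contr hG hx e (fun i => (v i : ℂ)) (fun i => (v i : ℂ))]
    simp only [spin1]
    ring
  rw [h1, h2]
  fin_cases F <;> fin_cases A' <;> fin_cases E <;> fin_cases E' <;> simp [eps] <;> ring

/-- The term ∇ψ · V of Ξ V cancels against the one in ∇W. The correction -W_{E'ABC} ε_{DE} in Ξ
contributes -ψ_{ABCD} V^D_{E'} V_{EA'}, which is the quadratic term of `obstr` in spinor form; P and
∇v supply the rest. -/
lemma second_condition_eq (hG : IsMetricOn G O) (hx : x ∈ O) (h : ∀ y ∈ O, WeylASDAt G y)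
    (hne : weyl G x ≠ 0) (e : SpinFrame G x) {v : Fin 4 → ℝ} {dv : Mat} (hv : DivEq G v x)
    (hd : DerivDivEq G v dv x) (E' E A B C A' : Fin 2) :
    (∑ D, Xi e E' E A B C D * Vup e D A') - Theta e A B C E E' A' =
      - ∑ D, psi e A B C D * ∑ F, eps D F * spin2 e.σ (obstr G v dv x) F A' E E' := by
  have hW := (divEq_iff hG hx h e v).1 hv
  have hV := V_eq hG hx (h x hx) hne e hW
  simp only [Vup, hV, Xi, Theta, dW_eq hG hx h e hd, hW, spin2_obstr hG hx e, Fin.sum_univ_two]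
  fin_cases E <;> simp [eps] <;> ring

/-- Injectivity of ψ removes ψ, invertibility of ε lowers the index, and the frame spans. -/
lemma obstr_eq_zero_iff (hG : IsMetricOn G O) (hx : x ∈ O) (h : ∀ y ∈ O, WeylASDAt G y)
    (hne : weyl G x ≠ 0) (e : SpinFrame G x) {v : Fin 4 → ℝ} {dv : Mat} (hv : DivEq G v x)
    (hd : DerivDivEq G v dv x) :
    obstr G v dv x = 0 ↔
      ∀ E' E A B C A' : Fin 2,
        (∑ D, Xi e E' E A B C D * Vup e D A') - Theta e A B C E E' A' = 0 := by
  simp only [second_condition_eq hG hx h hne e hv hd]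
  constructor
  · intro h0
    simp [h0, spin2]
  · intro h0
    have h1 : ∀ A' E E' D, ∑ F, eps D F * spin2 e.σ (obstr G v dv x) F A' E E' = 0 := by
      intro A' E E'
      exact psi_injective hG hx (h x hx) hne e fun A B C => neg_eq_zero.1 (h0 E' E A B C A')
    have h2 : ∀ F A' E E', spin2 e.σ (obstr G v dv x) F A' E E' = 0 := by
      intro F A' E E'
      have a0 := h1 A' E E' 0
      have a1 := h1 A' E E' 1
      simp [eps] at a0 a1
      fin_cases F
      · exact a1
      · exact a0
    simp only [spin2_eq'] at h2
    ext i j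
    have h3 := frame_injective e (fun A A' => frame_injective e
      (u := fun i => ∑ j, e.σ A A' j * (obstr G v dv x i j : ℂ)) (fun F F' => h2 F F' A A') i) j
    exact_mod_cast h3

end ASDGravity

end

/-! ### The differentiated divergence equation and the determinant condition -/

noncomputable section

namespace ASDGravity

variable {O : Set Coord} {x : Coord} {G : Metric}

/-! ### Differentiating `DivEq` -/

/-- Levi-Civita derivative of a covector field: `(∇_n v)_m`. -/
def covD1 (G : Metric) (v : Fin 4 → Coord → ℝ) (x : Coord) : Mat := Matrix.of fun n m =>
  pd n (v m) x - ∑ p, christoffel G p n m x * v p x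

lemma pd_inv_metric (hG : IsMetricOn G O) (hx : x ∈ O) (n l m : Fin 4) :
    pd n (fun y => (G y)⁻¹ l m) x = - ((∑ p, christoffel G l n p x * (G x)⁻¹ p m)
      + ∑ p, (G x)⁻¹ l p * christoffel G m n p x) := by
  have h := congrFun (congrFun (hG.compat_inv hx n) l) m
  simpa [pdM, Matrix.mul_apply, Gam] using h

/-- The covariant derivative of a vanishing tensor vanishes. Christoffel terms on the free indices
are contractions that vanish already; those on the contracted indices cancel the derivative of the
inverse metric. -/
lemma derivDivEq (hG : IsMetricOn G O) {v : Fin 4 → Coord → ℝ} (hv : ∀ m, Sm O (v m))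
    (h : ∀ y ∈ O, DivEq G (fun m => v m y) y) (hx : x ∈ O) :
    DerivDivEq G (fun m => v m x) (covD1 G v x) x := by
  have hO := hG.isOpen
  have hw := smooth_wey hG
  have hN := fun m => hw.nab hG m
  set Z : Fin 4 → Coord → T4 := fun m y i j k l =>
    nab G m (wey G) y i j k l - v m y * wey G y i j k l with hZ
  have hZs : ∀ m i j k l, Sm O (fun y => Z m y i j k l) := fun m i j k l =>
    (hN m i j k l).sub ((hv m).mul (hw i j k l))
  have hS : ∀ y ∈ O, ∀ i j k, ∑ l, ∑ m, (G y)⁻¹ l m * Z m y i j k l = 0 := h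
  intro n i j k
  have hpd : ∑ l, ∑ m, (pd n (fun y => (G y)⁻¹ l m) x * Z m x i j k l
      + (G x)⁻¹ l m * pd n (fun y => Z m y i j k l) x) = 0 := by
    have h1 := pd_eq_zero hO hx (fun y hy => hS y hy i j k) n
    rw [pd_sum hO hx fun l => Sm.sum fun m => (hG.smooth_inv l m).mul (hZs m i j k l)] at h1
    rw [← h1]
    refine Finset.sum_congr rfl fun l _ => ?_
    rw [pd_sum hO hx fun m => (hG.smooth_inv l m).mul (hZs m i j k l)]
    exact Finset.sum_congr rfl fun m _ => (pd_mul hO hx (hG.smooth_inv l m) (hZs m i j k l) n).symm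
  have hpdZ : ∀ m l, pd n (fun y => Z m y i j k l) x =
      pd n (fun y => nab G m (wey G) y i j k l) x
        - (pd n (v m) x * wey G x i j k l + v m x * pd n (fun y => wey G y i j k l) x) := by
    intro m l
    rw [pd_sub hO hx (hN m i j k l) ((hv m).mul (hw i j k l)), pd_mul hO hx (hv m) (hw i j k l)]
  have hT : ∀ m l, nabnab G n m (wey G) x i j k l - covD1 G v x n m * wey G x i j k l
      - v m x * nab G n (wey G) x i j k l = pd n (fun y => Z m y i j k l) x
        - (∑ p, christoffel G p n m x * Z p x i j k l)
        - (∑ p, christoffel G p n i x * Z m x p j k l)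
        - (∑ p, christoffel G p n j x * Z m x i p k l)
        - (∑ p, christoffel G p n k x * Z m x i j p l)
        - (∑ p, christoffel G p n l x * Z m x i j k p) := by
    intro m l
    rw [hpdZ, nabnab, covD1]
    conv_lhs => rw [nab, nab]
    simp only [hZ, Matrix.of_apply, mul_sub, Finset.sum_sub_distrib, sub_mul, Finset.sum_mul,
      Finset.mul_sum]
    simp only [mul_left_comm (v m x), mul_assoc]
    ring
  simp only [hT]
  have c1 : ∀ (a : Fin 4) (Y : Fin 4 → Fin 4 → Fin 4 → ℝ),
      (∀ p, ∑ l, ∑ m, (G x)⁻¹ l m * Y p m l = 0) →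
      ∑ l, ∑ m, (G x)⁻¹ l m * ∑ p, christoffel G p n a x * Y p m l = 0 := by
    intro a Y hY
    have : ∀ l m, (G x)⁻¹ l m * ∑ p, christoffel G p n a x * Y p m l =
        ∑ p, christoffel G p n a x * ((G x)⁻¹ l m * Y p m l) := by
      intro l m
      rw [Finset.mul_sum]
      exact Finset.sum_congr rfl fun p _ => by ring
    simp only [this]
    have h2 : ∀ l, ∑ m, ∑ p, christoffel G p n a x * ((G x)⁻¹ l m * Y p m l) =
        ∑ p, ∑ m, christoffel G p n a x * ((G x)⁻¹ l m * Y p m l) := fun l => Finset.sum_comm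
    simp only [h2]
    rw [Finset.sum_comm]
    refine Finset.sum_eq_zero fun p _ => ?_
    simp only [← Finset.mul_sum, hY, mul_zero]
  have d1 := c1 i (fun p m l => Z m x p j k l) (fun p => hS x hx p j k)
  have d2 := c1 j (fun p m l => Z m x i p k l) (fun p => hS x hx i p k)
  have d3 := c1 k (fun p m l => Z m x i j p l) (fun p => hS x hx i j p)
  have d4 : ∑ l, ∑ m, (G x)⁻¹ l m * ∑ p, christoffel G p n m x * Z p x i j k l =
      ∑ l, ∑ m, (∑ p, (G x)⁻¹ l p * christoffel G m n p x) * Z m x i j k l := by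
    refine Finset.sum_congr rfl fun l _ => ?_
    simp only [Finset.mul_sum, Finset.sum_mul]
    rw [Finset.sum_comm]
    exact Finset.sum_congr rfl fun m _ => Finset.sum_congr rfl fun p _ => by ring
  have d5 : ∑ l, ∑ m, (G x)⁻¹ l m * ∑ p, christoffel G p n l x * Z m x i j k p =
      ∑ l, ∑ m, (∑ p, christoffel G l n p x * (G x)⁻¹ p m) * Z m x i j k l := by
    rw [Finset.sum_comm]
    conv_rhs => rw [Finset.sum_comm]
    refine Finset.sum_congr rfl fun m _ => ?_
    simp only [Finset.mul_sum, Finset.sum_mul]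
    rw [Finset.sum_comm]
    exact Finset.sum_congr rfl fun l _ => Finset.sum_congr rfl fun p _ => by ring
  simp only [pd_inv_metric hG hx] at hpd
  simp only [neg_mul, add_mul, Finset.sum_add_distrib, Finset.sum_neg_distrib, neg_add] at hpd
  simp only [mul_sub, Finset.sum_sub_distrib]
  rw [d1, d2, d3, d4, d5]
  linarith

/-! ### The determinant condition -/

lemma det_eq_zero_of_eq (hG : IsMetricOn G O) (hx : x ∈ O) (h : WeylASDAt G x)
    (e : SpinFrame G x) {u : Fin 2 → Fin 2 → ℂ}
    (hW : ∀ A' A B C, W e A' A B C = ∑ D, psi e A B C D * u D A') :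
    (curvMatrix e).det = 0 := by
  obtain ⟨q, hq⟩ := psi_totally_symm hG hx h e
  rw [← Matrix.exists_mulVec_eq_zero_iff]
  -- The kernel vector (α, π) with π = (1, 0), for which the system asks α^D to solve the equation
  -- with A' = 0.
  refine ⟨![u 0 0, u 1 0, 1, 0], ?_, ?_⟩
  · intro h0
    have := congrFun h0 2
    simp at this
  · ext a
    fin_cases a <;>
      simp [curvMatrix, Matrix.mulVec, dotProduct, Fin.sum_univ_four, hW, Fin.sum_univ_two, hq]

/-- Spin frames adapted to an orthonormal frame. -/
def SpinFrame.IsReal (e : SpinFrame G x) : Prop := ∀ A A' i,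
  (starRingEnd ℂ) (e.σ A A' i) = (-1) ^ ((A : ℕ) + A') * e.σ (1 - A) (1 - A') i

lemma spin4_conj (e : SpinFrame G x) (he : e.IsReal) (t : T4) (A A' B B' C C' D D' : Fin 2) :
    (starRingEnd ℂ) (spin4 e.σ t A A' B B' C C' D D') =
      (-1) ^ ((A : ℕ) + A' + B + B' + C + C' + D + D') *
      spin4 e.σ t (1 - A) (1 - A') (1 - B) (1 - B') (1 - C) (1 - C') (1 - D) (1 - D') := by
  simp only [spin4, map_sum, map_mul, he _ _ _, Complex.conj_ofReal, Finset.mul_sum]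
  refine Finset.sum_congr rfl fun _ _ => Finset.sum_congr rfl fun _ _ =>
    Finset.sum_congr rfl fun _ _ => Finset.sum_congr rfl fun _ _ => ?_
  ring

lemma eps_conj (A B : Fin 2) : (starRingEnd ℂ) (eps A B) = eps A B := by
  fin_cases A <;> fin_cases B <;> simp [eps]

lemma spinor_conj (e : SpinFrame G x) (he : e.IsReal) (t : T4) (A B C D : Fin 2) :
    (starRingEnd ℂ) (spinor e.σ t A B C D) =
      (-1) ^ ((A : ℕ) + B + C + D) * spinor e.σ t (1 - A) (1 - B) (1 - C) (1 - D) := by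
  have h4 : (starRingEnd ℂ) (1 / 4) = 1 / 4 := by rw [map_div₀, map_one, map_ofNat]
  simp only [spinor, Fin.sum_univ_two, map_mul, map_add, eps_conj, spin4_conj e he, h4]
  simp [eps]
  ring

lemma W_conj (e : SpinFrame G x) (he : e.IsReal) (A' A B C : Fin 2) :
    (starRingEnd ℂ) (W e A' A B C) =
      (-1) ^ ((A' : ℕ) + A + B + C) * W e (1 - A') (1 - A) (1 - B) (1 - C) := by
  have h : ∀ E E' D, (starRingEnd ℂ) (dPsi e E E' A B C D) = (-1) ^ ((E : ℕ) + E' + A + B + C + D) *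
      dPsi e (1 - E) (1 - E') (1 - A) (1 - B) (1 - C) (1 - D) := by
    intro E E' D
    simp only [dPsi_eq, map_sum, map_mul, he _ _ _, spinor_conj e he, Finset.mul_sum]
    exact Finset.sum_congr rfl fun m _ => by ring
  simp only [W, Fin.sum_univ_two, map_mul, map_add, eps_conj, h]
  simp [eps]
  ring

/-- One kernel vector gives W only along its π. In a real spin frame the system is invariant under
quaternionic conjugation, which supplies a second kernel vector whose π is independent of the first.
-/
lemma exists_eq_of_det_eq_zero (hG : IsMetricOn G O) (hx : x ∈ O) (hA : ∀ y ∈ O, WeylASDAt G y)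
    (hne : weyl G x ≠ 0) (e : SpinFrame G x) (he : e.IsReal) (hdet : (curvMatrix e).det = 0) :
    ∃ u : Fin 2 → Fin 2 → ℂ, ∀ A' A B C, W e A' A B C = ∑ D, psi e A B C D * u D A' := by
  have h := hA x hx
  obtain ⟨q, hq⟩ := psi_totally_symm hG hx h e
  have hWs : ∃ w : Fin 2 → ℕ → ℂ, ∀ A' A B C : Fin 2, W e A' A B C = w A' ((A : ℕ) + B + C) := by
    choose r hr using fun m => spinor_totally_symm hG hx e (nab_isASDType hG hA hx m)
    refine ⟨fun A' n => ∑ D : Fin 2, ∑ E, eps D E * ∑ m, e.σ E A' m * r m (n + D),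
      fun A' A B C => ?_⟩
    simp only [W, dPsi_eq, hr]
  obtain ⟨w, hw⟩ := hWs
  have hqc : ∀ A B C D : Fin 2, (starRingEnd ℂ) (psi e A B C D) =
      (-1) ^ ((A : ℕ) + B + C + D) * psi e (1 - A) (1 - B) (1 - C) (1 - D) := by
    intro A B C D
    simp only [psi_eq, spinor_conj e he]
  have hwc := W_conj e he
  obtain ⟨z, hz0, hz⟩ := Matrix.exists_mulVec_eq_zero_iff.2 hdet
  have key : ∀ A B C, psi e A B C 0 * z 0 + psi e A B C 1 * z 1 =
      W e 0 A B C * z 2 + W e 1 A B C * z 3 := by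
    have k0 := congrFun hz 0
    have k1 := congrFun hz 1
    have k2 := congrFun hz 2
    have k3 := congrFun hz 3
    simp [curvMatrix, Matrix.mulVec, dotProduct, Fin.sum_univ_four, hq, hw] at k0 k1 k2 k3
    intro A B C
    fin_cases A <;> fin_cases B <;> fin_cases C <;> simp [hq, hw]
    · linear_combination k0
    · linear_combination k1
    · linear_combination k1
    · linear_combination k2
    · linear_combination k1
    · linear_combination k2
    · linear_combination k2
    · linear_combination k3
  -- The conjugate equation: conjugation exchanges the index values 0 and 1 up to sign and sends a
  -- pair (a, b) to (-b̄, ā).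
  have key' : ∀ A B C, psi e A B C 0 * (- (starRingEnd ℂ) (z 1)) + psi e A B C 1 * (starRingEnd ℂ) (z 0) =
      W e 0 A B C * (- (starRingEnd ℂ) (z 3)) + W e 1 A B C * (starRingEnd ℂ) (z 2) := by
    intro A B C
    have k := congrArg (starRingEnd ℂ) (key (1 - A) (1 - B) (1 - C))
    simp only [map_add, map_mul, hqc, hwc] at k
    fin_cases A <;> fin_cases B <;> fin_cases C <;> simp at k ⊢ <;>
      first | linear_combination k | linear_combination -k
  -- N is the determinant of the two-by-two matrix formed by π and its conjugate. If it vanished, π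
  -- would vanish, and then ψ α = 0 would force α = 0 as well.
  have hN : z 2 * (starRingEnd ℂ) (z 2) + z 3 * (starRingEnd ℂ) (z 3) ≠ 0 := by
    intro h0
    rw [Complex.mul_conj, Complex.mul_conj] at h0
    have h1 : Complex.normSq (z 2) + Complex.normSq (z 3) = 0 := by exact_mod_cast h0
    have h2 := Complex.normSq_nonneg (z 2)
    have h3 := Complex.normSq_nonneg (z 3)
    have h4 : z 2 = 0 := Complex.normSq_eq_zero.1 (by linarith)
    have h5 : z 3 = 0 := Complex.normSq_eq_zero.1 (by linarith)
    have h6 := psi_injective hG hx h hne e (u := ![z 0, z 1]) (fun A B C => by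
      have := key A B C
      rw [h4, h5] at this
      simpa [Fin.sum_univ_two] using this)
    apply hz0
    ext a
    fin_cases a
    · exact h6 0
    · exact h6 1
    · exact h4
    · exact h5
  set N := z 2 * (starRingEnd ℂ) (z 2) + z 3 * (starRingEnd ℂ) (z 3) with hNdef
  -- Cramer's rule for W_{0'} and W_{1'} in the two equations `key` and `key'`.
  refine ⟨fun D A' => (![![(starRingEnd ℂ) (z 2) * z 0 + z 3 * (starRingEnd ℂ) (z 1),
      (starRingEnd ℂ) (z 3) * z 0 - z 2 * (starRingEnd ℂ) (z 1)],
    ![(starRingEnd ℂ) (z 2) * z 1 - z 3 * (starRingEnd ℂ) (z 0),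
      (starRingEnd ℂ) (z 3) * z 1 + z 2 * (starRingEnd ℂ) (z 0)]] : Fin 2 → Fin 2 → ℂ) D A' / N,
    fun A' A B C => ?_⟩
  apply mul_left_cancel₀ hN
  have k1 := key A B C
  have k2 := key' A B C
  have hf : ∀ a b c d : ℂ, N * (a * (b / N) + c * (d / N)) = a * b + c * d := by
    intro a b c d
    field_simp
  rw [Fin.sum_univ_two, hf]
  fin_cases A'
  · change N * W e 0 A B C = psi e A B C 0 * ((starRingEnd ℂ) (z 2) * z 0
      + z 3 * (starRingEnd ℂ) (z 1)) + psi e A B C 1 * ((starRingEnd ℂ) (z 2) * z 1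
      - z 3 * (starRingEnd ℂ) (z 0))
    rw [hNdef]
    linear_combination -(starRingEnd ℂ) (z 2) * k1 + z 3 * k2
  · change N * W e 1 A B C = psi e A B C 0 * ((starRingEnd ℂ) (z 3) * z 0
      - z 2 * (starRingEnd ℂ) (z 1)) + psi e A B C 1 * ((starRingEnd ℂ) (z 3) * z 1
      + z 2 * (starRingEnd ℂ) (z 0))
    rw [hNdef]
    linear_combination -(starRingEnd ℂ) (z 3) * k1 - z 2 * k2

end ASDGravity

end

/-! ### Real spin frames, and reality and smoothness of the covector -/

noncomputable section

namespace ASDGravity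

variable {O : Set Coord} {x : Coord} {G : Metric}

/-! ### Existence of adapted spin frames -/

/-- An orthonormal frame with reversed orientation. -/
lemma exists_orthonormal (hG : IsMetricOn G O) (hx : x ∈ O) :
    ∃ E : Mat, Eᵀ * G x * E = 1 ∧ Real.sqrt (G x).det * E.det = -1 := by
  obtain ⟨R, hR⟩ := exists_eq_transpose_mul_self (hG.posDef x hx)
  have hdet : (G x).det = R.det * R.det := by rw [hR, Matrix.det_mul, Matrix.det_transpose]
  have hpos := hG.det_pos hx
  have hR0 : R.det ≠ 0 := by
    intro h0
    rw [hdet, h0, mul_zero] at hpos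
    exact lt_irrefl _ hpos
  have hu : IsUnit R.det := IsUnit.mk0 _ hR0
  have h1 : (R⁻¹)ᵀ * G x * R⁻¹ = 1 := by
    rw [hR, ← mul_assoc, ← Matrix.transpose_mul, Matrix.mul_nonsing_inv _ hu,
      Matrix.transpose_one, one_mul, Matrix.mul_nonsing_inv _ hu]
  have hi : R⁻¹.det = R.det⁻¹ := by rw [Matrix.det_nonsing_inv, Ring.inverse_eq_inv']
  rcases lt_or_gt_of_ne hR0 with hneg | hpos'
  · refine ⟨R⁻¹, h1, ?_⟩
    rw [hi, hdet, Real.sqrt_mul_self_eq_abs, abs_of_neg hneg]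
    field_simp
  -- A reflection reverses the orientation when the square root R has positive determinant.
  · set T : Mat := Matrix.diagonal ![-1, 1, 1, 1] with hT
    have hTT : Tᵀ * T = 1 := by
      rw [hT, Matrix.diagonal_transpose, Matrix.diagonal_mul_diagonal, ← Matrix.diagonal_one]
      congr 1
      ext a
      fin_cases a <;> simp
    refine ⟨R⁻¹ * T, ?_, ?_⟩
    · rw [Matrix.transpose_mul]
      calc Tᵀ * (R⁻¹)ᵀ * G x * (R⁻¹ * T) = Tᵀ * ((R⁻¹)ᵀ * G x * R⁻¹) * T := by noncomm_ring
        _ = 1 := by rw [h1, mul_one, hTT]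
    · rw [Matrix.det_mul, hi, hdet, Real.sqrt_mul_self_eq_abs, abs_of_pos hpos', hT,
        Matrix.det_diagonal]
      simp [Fin.prod_univ_four]
      field_simp

/-- Coefficients of the null vectors of a spin frame in an orthonormal frame. -/
def nullCoeff : Fin 2 → Fin 2 → Fin 4 → ℂ :=
  ![![![1, Complex.I, 0, 0], ![0, 0, 1, Complex.I]],
    ![![0, 0, -1, Complex.I], ![1, -Complex.I, 0, 0]]]

lemma nullCoeff_metric (A A' B B' : Fin 2) :
    ∑ a, nullCoeff A A' a * nullCoeff B B' a = 2 * (eps A B * eps A' B') := by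
  fin_cases A <;> fin_cases A' <;> fin_cases B <;> fin_cases B' <;>
    simp [nullCoeff, Fin.sum_univ_four, eps] <;> norm_num

lemma exists_isReal_spinFrame (hG : IsMetricOn G O) (hx : x ∈ O) :
    ∃ e : SpinFrame G x, e.IsReal := by
  obtain ⟨E, hE, hdet⟩ := exists_orthonormal hG hx
  set r : ℂ := (((Real.sqrt 2)⁻¹ : ℝ) : ℂ) with hr
  have hr2 : r * r = 1 / 2 := by
    rw [hr, ← Complex.ofReal_mul, ← mul_inv, Real.mul_self_sqrt (by norm_num)]
    norm_num
  set σ : Fin 2 → Fin 2 → Fin 4 → ℂ := fun A A' i => r * ∑ a, nullCoeff A A' a * (E i a : ℂ)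
    with hσ
  have hE2 : ∀ a b, ∑ i, ∑ j, (G x i j : ℂ) * ((E i a : ℂ) * (E j b : ℂ)) =
      if a = b then 1 else 0 := by
    intro a b
    have h1 := congrFun (congrFun hE a) b
    rw [Matrix.mul_apply, Matrix.one_apply] at h1
    simp only [Matrix.mul_apply, Matrix.transpose_apply, Finset.sum_mul] at h1
    rw [Finset.sum_comm] at h1
    have h2 : ∑ i, ∑ j, G x i j * (E i a * E j b) = if a = b then (1 : ℝ) else 0 := by
      rw [← h1]
      exact Finset.sum_congr rfl fun i _ => Finset.sum_congr rfl fun j _ => by ring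
    have h3 := congrArg (Complex.ofReal) h2
    push_cast at h3
    rw [h3]
    split_ifs <;> simp
  have hmet : ∀ A A' B B', ∑ i, ∑ j, (G x i j : ℂ) * σ A A' i * σ B B' j =
      eps A B * eps A' B' := by
    intro A A' B B'
    have h1 : ∑ i, ∑ j, (G x i j : ℂ) * σ A A' i * σ B B' j =
        r * r * ∑ a, ∑ b, nullCoeff A A' a * nullCoeff B B' b *
          ∑ i, ∑ j, (G x i j : ℂ) * ((E i a : ℂ) * (E j b : ℂ)) := by
      have h9 : ∀ f : Fin 4 → Fin 4 → Fin 4 → Fin 4 → ℂ,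
          ∑ c, ∑ d, ∑ i, ∑ j, f i j c d = ∑ i, ∑ j, ∑ c, ∑ d, f i j c d := by
        intro f
        have : ∀ c, ∑ d, ∑ i, ∑ j, f i j c d = ∑ i, ∑ j, ∑ d, f i j c d := by
          intro c
          rw [Finset.sum_comm]
          exact Finset.sum_congr rfl fun i _ => Finset.sum_comm
        simp only [this]
        rw [Finset.sum_comm]
        exact Finset.sum_congr rfl fun i _ => Finset.sum_comm
      simp only [Finset.mul_sum]
      rw [h9]
      refine Finset.sum_congr rfl fun i _ => Finset.sum_congr rfl fun j _ => ?_
      simp only [hσ]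
      rw [show (G x i j : ℂ) * (r * ∑ a, nullCoeff A A' a * (E i a : ℂ)) *
        (r * ∑ a, nullCoeff B B' a * (E j a : ℂ)) = r * r * (G x i j : ℂ) *
        ((∑ a, nullCoeff A A' a * (E i a : ℂ)) * ∑ a, nullCoeff B B' a * (E j a : ℂ)) by ring,
        Finset.sum_mul_sum]
      simp only [Finset.mul_sum]
      exact Finset.sum_congr rfl fun a _ => Finset.sum_congr rfl fun b _ => by ring
    rw [h1]
    simp only [hE2, mul_ite, mul_one, mul_zero, Finset.sum_ite_eq, Finset.mem_univ, if_true]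
    rw [nullCoeff_metric, hr2]
    ring
  have hor : spinComp σ (volForm G x) ![0, 0, 1, 1] ![0, 1, 0, 1] = -1 := by
    have h1 : spinComp σ (volForm G x) ![0, 0, 1, 1] ![0, 1, 0, 1] =
        (Real.sqrt (G x).det : ℂ) * (frameMat σ).det := by
      rw [← sum_prod_det, Finset.mul_sum, spinComp]
      refine Finset.sum_congr rfl fun I _ => ?_
      simp only [volForm, Complex.ofReal_mul, det_cast]
      rw [mul_left_comm]
      congr 1
    set c : CMat := !![1, Complex.I, 0, 0; 0, 0, 1, Complex.I; 0, 0, -1, Complex.I;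
      1, -Complex.I, 0, 0] with hc
    have h2 : frameMat σ = (r • c) * (toC E)ᵀ := by
      ext a i
      rw [Matrix.mul_apply]
      simp only [Matrix.smul_apply, smul_eq_mul, Matrix.transpose_apply, toC_apply, mul_assoc,
        ← Finset.mul_sum]
      fin_cases a <;> rfl
    -- The 4 cancels the fourth power of r, so the spin frame has the determinant of E; this is why
    -- `exists_orthonormal` provides the value -1.
    have hcd : c.det = 4 := by
      simp [hc, Matrix.det_succ_row_zero, Fin.sum_univ_succ, Fin.succAbove]
      ring_nf
      simp
      norm_num
    have hEd : (toC E).det = (E.det : ℂ) := (Complex.ofRealHom.map_det E).symm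
    rw [h1, h2, Matrix.det_mul, Matrix.det_smul, Matrix.det_transpose, hEd, hcd]
    have h3 : (Real.sqrt (G x).det : ℂ) * (E.det : ℂ) = -1 := by exact_mod_cast hdet
    have h4 : r ^ Fintype.card (Fin 4) = 1 / 4 := by
      rw [Fintype.card_fin]
      linear_combination (r * r + 1 / 2) * hr2
    rw [h4]
    linear_combination h3
  refine ⟨⟨σ, hmet, hor⟩, fun A A' i => ?_⟩
  simp only [hσ, map_mul, map_sum, Complex.conj_ofReal, hr]
  rw [mul_left_comm]
  congr 1
  rw [Finset.mul_sum]
  refine Finset.sum_congr rfl fun a _ => ?_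
  rw [← mul_assoc]
  congr 1
  fin_cases A <;> fin_cases A' <;> fin_cases a <;> simp [nullCoeff]

/-! ### The covector field determined by the divergence of the Weyl tensor -/

lemma spin1_surjective (e : SpinFrame G x) (u : Fin 2 → Fin 2 → ℂ) :
    ∃ a b : Fin 4 → ℝ, ∀ A A', u A A' = spin1 e a A A' + Complex.I * spin1 e b A A' := by
  set w : Fin 4 → ℂ := (toC (G x) * (frameMat e.σ)ᵀ * etaMat) *ᵥ ![u 0 0, u 0 1, u 1 0, u 1 1]
    with hw
  have h1 : frameMat e.σ *ᵥ w = ![u 0 0, u 0 1, u 1 0, u 1 1] := by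
    rw [hw, Matrix.mulVec_mulVec, frameMat_mul, Matrix.one_mulVec]
  have h2 : ∀ A A', ∑ i, e.σ A A' i * w i = u A A' := by
    intro A A'
    fin_cases A <;> fin_cases A'
    · exact congrFun h1 0
    · exact congrFun h1 1
    · exact congrFun h1 2
    · exact congrFun h1 3
  refine ⟨fun i => (w i).re, fun i => (w i).im, fun A A' => ?_⟩
  rw [← h2, spin1, spin1, Finset.mul_sum, ← Finset.sum_add_distrib]
  refine Finset.sum_congr rfl fun i _ => ?_
  conv_lhs => rw [← Complex.re_add_im (w i)]
  ring

/-- The spinor solution may correspond to a complex covector a + ib. The tensor equation has real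
coefficients, so its real part shows that a alone is a solution. -/
lemma exists_divEq (hG : IsMetricOn G O) (hx : x ∈ O) (hA : ∀ y ∈ O, WeylASDAt G y)
    (e : SpinFrame G x) {u : Fin 2 → Fin 2 → ℂ}
    (hW : ∀ A' A B C, W e A' A B C = ∑ D, psi e A B C D * ∑ E, eps D E * u E A') :
    ∃ v : Fin 4 → ℝ, DivEq G v x := by
  obtain ⟨a, b, hab⟩ := spin1_surjective e u
  refine ⟨a, ?_⟩
  have hTa : ∀ m, IsASDType (G x) (nab G m (wey G) x - a m • wey G x) := fun m =>
    (asdSubmodule (G x)).sub_mem (nab_isASDType hG hA hx m)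
      ((asdSubmodule (G x)).smul_mem _ (wey_isASDType hG hx (hA x hx)))
  have hTb : ∀ m, IsASDType (G x) (b m • wey G x) := fun m =>
    (asdSubmodule (G x)).smul_mem _ (wey_isASDType hG hx (hA x hx))
  have ha := contr_spin hG hx e hTa
  have hb := contr_spin hG hx e hTb
  have hz : ∀ A B C C', ∑ D, ∑ E, eps D E * ∑ m, e.σ E C' m *
        spinor e.σ (nab G m (wey G) x - a m • wey G x) A B C D
      - Complex.I * ∑ D, ∑ E, eps D E * ∑ m, e.σ E C' m * spinor e.σ (b m • wey G x) A B C D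
      = 0 := by
    intro A B C C'
    rw [← sub_eq_zero.2 (hW C' A B C)]
    simp only [hab, spinor_sub, spinor_smul, mul_sub, Finset.sum_sub_distrib, W, dPsi_eq, psi_eq,
      spin1]
    simp only [Fin.sum_univ_two, Finset.mul_sum, ← Finset.sum_add_distrib,
      ← Finset.sum_sub_distrib]
    refine Finset.sum_congr rfl fun m _ => ?_
    ring
  have hc : ∀ A A' B B' C C', ∑ i, e.σ A A' i * ∑ j, e.σ B B' j * ∑ k, e.σ C C' k *
      (((∑ l, ∑ m, (G x)⁻¹ l m * (nab G m (wey G) x - a m • wey G x) i j k l : ℝ) : ℂ)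
      - Complex.I * ((∑ l, ∑ m, (G x)⁻¹ l m * (b m • wey G x) i j k l : ℝ) : ℂ)) = 0 := by
    intro A A' B B' C C'
    have h1 : ∀ X Y : Fin 4 → Fin 4 → Fin 4 → ℂ,
        ∑ i, e.σ A A' i * ∑ j, e.σ B B' j * ∑ k, e.σ C C' k * (X i j k - Complex.I * Y i j k) =
        ∑ i, e.σ A A' i * ∑ j, e.σ B B' j * ∑ k, e.σ C C' k * X i j k
        - Complex.I * ∑ i, e.σ A A' i * ∑ j, e.σ B B' j * ∑ k, e.σ C C' k * Y i j k := by
      intro X Y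
      simp only [Finset.mul_sum, ← Finset.sum_sub_distrib]
      exact Finset.sum_congr rfl fun i _ => Finset.sum_congr rfl fun j _ =>
        Finset.sum_congr rfl fun k _ => by ring
    rw [h1, ha, hb]
    linear_combination (-eps A' B') * hz A B C C'
  intro i j k
  have h2 : ∀ i, ∀ B B' C C', _ := fun i B B' C C' =>
      frame_injective e (fun A A' => hc A A' B B' C C') i
  have h3 : ∀ i j, ∀ C C', _ := fun i j C C' =>
      frame_injective e (fun A A' => h2 i A A' C C') j
  have h4 := frame_injective e (fun A A' => h3 i j A A') k
  have h5 := congrArg Complex.re h4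
  simpa using h5

/-- Contraction of the Weyl tensor with a covector. -/
lemma weyl_contr_injective (hG : IsMetricOn G O) (hx : x ∈ O) (h : WeylASDAt G x)
    (hne : weyl G x ≠ 0) {u : Fin 4 → ℝ}
    (hu : ∀ i j k, ∑ l, ∑ m, (G x)⁻¹ l m * (u m * wey G x i j k l) = 0) : u = 0 := by
  obtain ⟨e, -⟩ := exists_isReal_spinFrame hG hx
  have hT : ∀ m, IsASDType (G x) (u m • wey G x) := fun m =>
    (asdSubmodule (G x)).smul_mem _ (wey_isASDType hG hx h)
  have h1 := (contr_eq_zero_iff hG hx e hT).1 hu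
  have h2 : ∀ C' D, ∑ E, eps D E * spin1 e u E C' = 0 := by
    intro C'
    refine psi_injective hG hx h hne e fun A B C => ?_
    rw [← h1 A B C C']
    simp only [spinor_smul, psi_eq, spin1, Fin.sum_univ_two, Finset.mul_sum,
      ← Finset.sum_add_distrib]
    exact Finset.sum_congr rfl fun m _ => by ring
  have h3 : ∀ E C', spin1 e u E C' = 0 := by
    intro E C'
    have a0 := h2 C' 0
    have a1 := h2 C' 1
    simp [eps] at a0 a1
    fin_cases E
    · exact a1
    · exact a0
  funext i
  have := frame_injective e (u := fun i => (u i : ℂ)) h3 i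
  exact_mod_cast this

/-- The covector field `v` with `∇^d C_{abcd} = C_{abcd} v^d` is unique and smooth. -/
lemma exists_smooth_divEq (hG : IsMetricOn G O) (hA : ∀ y ∈ O, WeylASDAt G y)
    (hne : ∀ y ∈ O, weyl G y ≠ 0) (hex : ∀ y ∈ O, ∃ v, DivEq G v y) :
    ∃ v : Fin 4 → Coord → ℝ, (∀ m, Sm O (v m)) ∧ ∀ y ∈ O, DivEq G (fun m => v m y) y := by
  -- At each point the equation is an overdetermined linear system Bv = d. Its normal equations have
  -- matrix N = BᵀB, invertible because contraction of C with a covector is injective, so v = N⁻¹Bᵀd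
  -- depends smoothly on the point.
  set B : Fin 4 × Fin 4 × Fin 4 → Fin 4 → Coord → ℝ := fun p m y =>
    ∑ l, (G y)⁻¹ l m * wey G y p.1 p.2.1 p.2.2 l with hB
  set d : Fin 4 × Fin 4 × Fin 4 → Coord → ℝ := fun p y =>
    ∑ l, ∑ m, (G y)⁻¹ l m * nab G m (wey G) y p.1 p.2.1 p.2.2 l with hd
  set N : Coord → Mat := fun y => Matrix.of fun m n => ∑ p, B p m y * B p n y with hN
  have hBs : ∀ p m, Sm O (B p m) := fun p m => Sm.sum fun l =>
    (hG.smooth_inv l m).mul (smooth_wey hG _ _ _ _)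
  have hds : ∀ p, Sm O (d p) := fun p => Sm.sum fun l => Sm.sum fun m =>
    (hG.smooth_inv l m).mul ((smooth_wey hG).nab hG m _ _ _ _)
  have hNs : SmM O N := fun m n => Sm.sum fun p => (hBs p m).mul (hBs p n)
  have hswap : ∀ y (u : Fin 4 → ℝ) (p : Fin 4 × Fin 4 × Fin 4),
      ∑ l, ∑ m, (G y)⁻¹ l m * (u m * wey G y p.1 p.2.1 p.2.2 l) = ∑ m, B p m y * u m := by
    intro y u p
    rw [Finset.sum_comm]
    refine Finset.sum_congr rfl fun m _ => ?_
    rw [hB, Finset.sum_mul]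
    exact Finset.sum_congr rfl fun l _ => by ring
  have hNB : ∀ y (u : Fin 4 → ℝ) m, (N y *ᵥ u) m = ∑ p, B p m y * ∑ n, B p n y * u n := by
    intro y u m
    simp only [Matrix.mulVec, dotProduct, hN, Matrix.of_apply, Finset.sum_mul, Finset.mul_sum]
    rw [Finset.sum_comm]
    exact Finset.sum_congr rfl fun p _ => Finset.sum_congr rfl fun n _ => by ring
  have hNdet : ∀ y ∈ O, (N y).det ≠ 0 := by
    intro y hy h0
    obtain ⟨u, hu0, hu⟩ := Matrix.exists_mulVec_eq_zero_iff.2 h0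
    apply hu0
    apply weyl_contr_injective hG hy (hA y hy) (hne y hy)
    have h1 : ∑ p, (∑ m, B p m y * u m) * (∑ m, B p m y * u m) = 0 := by
      have h2 : ∑ m, u m * (N y *ᵥ u) m = 0 := by simp [hu]
      have h3 : ∀ S : Fin 4 × Fin 4 × Fin 4 → ℝ, ∑ p, (∑ m, B p m y * u m) * S p =
          ∑ m, u m * ∑ p, B p m y * S p := by
        intro S
        simp only [Finset.sum_mul, Finset.mul_sum]
        rw [Finset.sum_comm]
        exact Finset.sum_congr rfl fun m _ => Finset.sum_congr rfl fun p _ => by ring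
      rw [← h2, h3]
      simp only [hNB]
    rw [Finset.sum_eq_zero_iff_of_nonneg fun p _ => mul_self_nonneg _] at h1
    intro i j k
    rw [hswap y u (i, j, k)]
    exact mul_self_eq_zero.1 (h1 (i, j, k) (Finset.mem_univ _))
  refine ⟨fun m y => ∑ n, (N y)⁻¹ m n * ∑ p, B p n y * d p y, fun m => Sm.sum fun n =>
    (hNs.inv hNdet m n).mul (Sm.sum fun p => (hBs p n).mul (hds p)), fun y hy => ?_⟩
  obtain ⟨v, hv⟩ := hex y hy
  have hdv : ∀ p, d p y = ∑ m, B p m y * v m := by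
    intro p
    have := hv p.1 p.2.1 p.2.2
    simp only [mul_sub, Finset.sum_sub_distrib] at this
    rw [← hswap]
    exact sub_eq_zero.1 this
  have hvv : (fun m => ∑ n, (N y)⁻¹ m n * ∑ p, B p n y * d p y) = v := by
    have h1 : (fun n => ∑ p, B p n y * d p y) = N y *ᵥ v := by
      funext n
      rw [hNB]
      simp only [hdv]
    have h2 : (fun m => ∑ n, (N y)⁻¹ m n * ∑ p, B p n y * d p y) =
        (N y)⁻¹ *ᵥ (fun n => ∑ p, B p n y * d p y) := rfl
    rw [h2, h1, Matrix.mulVec_mulVec, Matrix.nonsing_inv_mul _ (IsUnit.mk0 _ (hNdet y hy)),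
      Matrix.one_mulVec]
  rw [hvv]
  exact hv

end ASDGravity

end

noncomputable section

namespace ASDGravity

variable {O : Set Coord} {x : Coord} {G : Metric}

/-! ### Conformal change of the metric -/

variable {f : Coord → ℝ} {K : Metric}

/-- `K = exp(2 f) G` on `O`. -/
def IsConformal (G K : Metric) (f : Coord → ℝ) (O : Set Coord) : Prop :=
  ∀ y ∈ O, K y = (Real.exp (f y)) ^ 2 • G y

lemma Sm.exp (hf : Sm O f) : Sm O (fun y => Real.exp (f y)) := ContDiffOn.exp hf

lemma pd_exp (hO : IsOpen O) (hx : x ∈ O) (hf : Sm O f) (i : Fin 4) :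
    pd i (fun y => Real.exp (f y)) x = Real.exp (f x) * pd i f x := by
  unfold pd
  rw [fderiv_exp (hf.differentiableAt hO hx)]
  simp

lemma IsConformal.isMetricOn (hK : IsConformal G K f O) (hG : IsMetricOn G O) (hf : Sm O f) :
    IsMetricOn K O := by
  refine ⟨hG.isOpen, fun a b => ?_, fun y hy => ?_⟩
  · refine Sm.congr ((hf.exp.mul hf.exp).mul (hG.smooth a b)) fun y hy => ?_
    rw [hK y hy, Matrix.smul_apply, smul_eq_mul, sq]
  · rw [hK y hy]
    exact (hG.posDef y hy).smul (by positivity)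

/-- The gradient `U^l` of `f`. -/
def gradU (G : Metric) (f : Coord → ℝ) (l : Fin 4) (x : Coord) : ℝ :=
  ∑ m, (G x)⁻¹ l m * pd m f x

/-- Change of the Levi-Civita connection. -/
def confQ (G : Metric) (f : Coord → ℝ) (i : Fin 4) (x : Coord) : Mat := Matrix.of fun l k =>
  (if l = i then pd k f x else 0) + (if l = k then pd i f x else 0) - gradU G f l x * G x i k

lemma lower_gradU (hG : IsMetricOn G O) (hx : x ∈ O) (a : Fin 4) :
    ∑ l, G x a l * gradU G f l x = pd a f x := by
  simp only [gradU, Finset.mul_sum]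
  rw [Finset.sum_comm]
  simp only [← mul_assoc, ← Finset.sum_mul, hG.sum_mul_inv hx]
  simp

lemma lower_gradU' (hG : IsMetricOn G O) (hx : x ∈ O) (a : Fin 4) :
    ∑ l, G x l a * gradU G f l x = pd a f x := by
  rw [← lower_gradU hG hx a]
  exact Finset.sum_congr rfl fun l _ => by rw [hG.symm hx l a]

/-- By uniqueness of the Levi-Civita connection it is enough that the candidate is symmetric and
compatible with K; lowered with G, the symmetric part of `confQ` is ∂_i f times G, matching the
derivative of the factor exp(2f). -/
lemma Gam_conf (hK : IsConformal G K f O) (hG : IsMetricOn G O) (hf : Sm O f) (hx : x ∈ O)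
    (i : Fin 4) : Gam K i x = Gam G i x + confQ G f i x := by
  have hKm := hK.isMetricOn hG hf
  refine hKm.christoffel_unique hx (A := fun i y => Gam G i y + confQ G f i y) ?_ ?_ i
  · intro a k l
    have := hG.torsionFree hx a k l
    simp only [Matrix.add_apply, this, confQ, Matrix.of_apply, hG.symm hx a k]
    ring
  · intro i
    have hQ : ∀ a b, (G x * confQ G f i x) a b =
        G x a i * pd b f x + G x a b * pd i f x - pd a f x * G x i b := by
      intro a b
      simp only [Matrix.mul_apply, confQ, Matrix.of_apply, mul_sub, mul_add, mul_ite, mul_zero,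
        Finset.sum_sub_distrib, Finset.sum_add_distrib, Finset.sum_ite_eq', Finset.mem_univ, if_true,
        ← mul_assoc, ← Finset.sum_mul, lower_gradU hG hx]
    have hQ2 : (confQ G f i x)ᵀ * G x + G x * confQ G f i x = (2 * pd i f x) • G x := by
      have h1 : (confQ G f i x)ᵀ * G x = (G x * confQ G f i x)ᵀ := by
        rw [Matrix.transpose_mul, hG.transpose hx]
      rw [h1]
      ext a b
      simp only [Matrix.add_apply, Matrix.transpose_apply, hQ, Matrix.smul_apply, smul_eq_mul]
      rw [hG.symm hx b a, hG.symm hx i b, hG.symm hx i a]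
      ring
    have hd : pdM i K x = (Real.exp (f x)) ^ 2 • (pdM i G x + (2 * pd i f x) • G x) := by
      ext a b
      simp only [pdM, Matrix.of_apply, Matrix.smul_apply, Matrix.add_apply, smul_eq_mul]
      rw [pd_congr hG.isOpen hx (h := fun y => (Real.exp (f y) * Real.exp (f y)) * G y a b)
        (fun y hy => by rw [hK y hy, Matrix.smul_apply, smul_eq_mul, sq]),
        pd_mul hG.isOpen hx (hf.exp.mul hf.exp) (hG.smooth a b),
        pd_mul hG.isOpen hx hf.exp hf.exp, pd_exp hG.isOpen hx hf]
      ring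
    rw [hd, hG.compat hx, ← hQ2, hK x hx]
    simp only [Matrix.transpose_add, Matrix.mul_smul, Matrix.smul_mul, add_mul, mul_add, smul_add]
    abel

lemma smooth_gradU (hG : IsMetricOn G O) (hf : Sm O f) (l : Fin 4) : Sm O (gradU G f l) :=
  Sm.sum fun m => (hG.smooth_inv l m).mul (hf.pd hG.isOpen m)

lemma smooth_confQ (hG : IsMetricOn G O) (hf : Sm O f) (i : Fin 4) : SmM O (confQ G f i) := by
  intro l k
  have h1 : ∀ a b c : Fin 4, Sm O (fun y => if a = b then pd c f y else 0) := by
    intro a b c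
    by_cases h : a = b
    · simpa [h] using hf.pd hG.isOpen c
    · simpa [h] using Sm.const 0
  exact ((h1 l i k).add (h1 l k i)).sub ((smooth_gradU hG hf l).mul (hG.smooth i k))

/-- The Hessian `∇_i ∂_j f`. -/
def hess (G : Metric) (f : Coord → ℝ) (x : Coord) : Mat := covD1 G (fun m => pd m f) x

lemma hess_apply (i j : Fin 4) :
    hess G f x i j = pd i (pd j f) x - ∑ p, christoffel G p i j x * pd p f x := rfl

lemma hess_symm (hG : IsMetricOn G O) (hx : x ∈ O) (hf : Sm O f) (i j : Fin 4) :
    hess G f x i j = hess G f x j i := by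
  rw [hess_apply, hess_apply, pd_comm hG.isOpen hx hf]
  congr 1
  exact Finset.sum_congr rfl fun p _ => by
    have := hG.torsionFree hx i j p
    simp only [Gam, Matrix.of_apply] at this
    rw [this]

lemma pd_gradU (hG : IsMetricOn G O) (hx : x ∈ O) (hf : Sm O f) (i l : Fin 4) :
    pd i (gradU G f l) x = (∑ m, (G x)⁻¹ l m * hess G f x i m)
      - ∑ m, christoffel G l i m x * gradU G f m x := by
  have h1 : pd i (gradU G f l) x =
      ∑ m, (pd i (fun y => (G y)⁻¹ l m) x * pd m f x + (G x)⁻¹ l m * pd i (pd m f) x) := by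
    unfold gradU
    rw [pd_sum hG.isOpen hx fun m => (hG.smooth_inv l m).mul (hf.pd hG.isOpen m)]
    exact Finset.sum_congr rfl fun m _ =>
      pd_mul hG.isOpen hx (hG.smooth_inv l m) (hf.pd hG.isOpen m) i
  rw [h1]
  simp only [pd_inv_metric hG hx, hess_apply, gradU, mul_sub, Finset.sum_sub_distrib,
    Finset.sum_add_distrib, neg_mul, add_mul, Finset.sum_neg_distrib, Finset.sum_mul,
    Finset.mul_sum]
  have e1 : ∑ m, ∑ p, christoffel G l i p x * (G x)⁻¹ p m * pd m f x =
      ∑ m, ∑ p, christoffel G l i m x * ((G x)⁻¹ m p * pd p f x) := by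
    rw [Finset.sum_comm]
    exact Finset.sum_congr rfl fun _ _ => Finset.sum_congr rfl fun _ _ => by ring
  have e2 : ∑ m, ∑ p, (G x)⁻¹ l p * christoffel G m i p x * pd m f x =
      ∑ m, ∑ p, (G x)⁻¹ l m * (christoffel G p i m x * pd p f x) := by
    rw [Finset.sum_comm]
    exact Finset.sum_congr rfl fun _ _ => Finset.sum_congr rfl fun _ _ => by ring
  rw [e1, e2]
  ring

/-- `|df|²`. -/
def gradSq (G : Metric) (f : Coord → ℝ) (x : Coord) : ℝ :=
  ∑ k, ∑ l, (G x)⁻¹ k l * (pd k f x * pd l f x)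

lemma gradSq_eq : gradSq G f x = ∑ m, pd m f x * gradU G f m x := by
  simp only [gradSq, gradU, Finset.mul_sum]
  exact Finset.sum_congr rfl fun _ _ => Finset.sum_congr rfl fun _ _ => by ring

/-- Change `A_{kj} = - ∇_k ∂_j f + ∂_k f ∂_j f - (1/2) |df|² g_{kj}` of the Schouten tensor. -/
def confA (G : Metric) (f : Coord → ℝ) (x : Coord) (k j : Fin 4) : ℝ :=
  - hess G f x k j + pd k f x * pd j f x - (1 / 2) * gradSq G f x * G x k j

/-- The index j of `confQ` is left uncorrected, so this is the covariant derivative plus Γ^m_{ij}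
Q_m. The surplus is symmetric in i, j and disappears on antisymmetrising. -/
lemma confQ_deriv (hG : IsMetricOn G O) (hx : x ∈ O) (hf : Sm O f) (i j l k : Fin 4) :
    (pdM i (confQ G f j) x + Gam G i x * confQ G f j x - confQ G f j x * Gam G i x) l k =
      (if l = j then hess G f x i k else 0) + (if l = k then pd i (pd j f) x else 0)
        + christoffel G l i j x * pd k f x - (∑ m, (G x)⁻¹ l m * hess G f x i m) * G x j k
        - gradU G f l x * ∑ m, christoffel G m i j x * G x m k := by
  have hO := hG.isOpen
  have h1 : pdM i (confQ G f j) x l k = (if l = j then pd i (pd k f) x else 0)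
      + (if l = k then pd i (pd j f) x else 0)
      - (pd i (gradU G f l) x * G x j k + gradU G f l x * pd i (fun y => G y j k) x) := by
    have hite : ∀ a b c : Fin 4, Sm O (fun y => if a = b then pd c f y else 0) ∧
        pd i (fun y => if a = b then pd c f y else 0) x
          = if a = b then pd i (pd c f) x else 0 := by
      intro a b c
      by_cases h : a = b
      · simp only [h, if_true]
        exact ⟨hf.pd hO c, trivial⟩
      · simp only [h, if_false, pd_const]
        exact ⟨Sm.const 0, trivial⟩
    simp only [pdM, confQ, Matrix.of_apply]
    rw [pd_sub hO hx ((hite l j k).1.add (hite l k j).1)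
      ((smooth_gradU hG hf l).mul (hG.smooth j k)), pd_add hO hx (hite l j k).1 (hite l k j).1,
      (hite l j k).2, (hite l k j).2, pd_mul hO hx (smooth_gradU hG hf l) (hG.smooth j k)]
  have h2 : (Gam G i x * confQ G f j x) l k = christoffel G l i j x * pd k f x
      + christoffel G l i k x * pd j f x
      - (∑ m, christoffel G l i m x * gradU G f m x) * G x j k := by
    simp only [Matrix.mul_apply, confQ, Gam, Matrix.of_apply, mul_sub, mul_add, mul_ite, mul_zero,
      Finset.sum_sub_distrib, Finset.sum_add_distrib, Finset.sum_ite_eq', Finset.mem_univ, if_true,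
      ← mul_assoc, ← Finset.sum_mul]
  have h3 : (confQ G f j x * Gam G i x) l k =
      (if l = j then ∑ p, christoffel G p i k x * pd p f x else 0)
      + christoffel G l i k x * pd j f x
      - gradU G f l x * ∑ m, G x j m * christoffel G m i k x := by
    simp only [Matrix.mul_apply, confQ, Gam, Matrix.of_apply, sub_mul, add_mul, ite_mul, zero_mul,
      Finset.sum_sub_distrib, Finset.sum_add_distrib, Finset.sum_ite_eq, Finset.mem_univ, if_true,
      mul_assoc, ← Finset.mul_sum]
    split_ifs
    · simp only [mul_comm]
    · simp [mul_comm]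
  have h4 : pd i (fun y => G y j k) x =
      (∑ m, christoffel G m i j x * G x m k) + ∑ m, G x j m * christoffel G m i k x := by
    have := congrFun (congrFun (hG.compat hx i) j) k
    simpa [pdM, Matrix.mul_apply, Gam] using this
  rw [Matrix.sub_apply, Matrix.add_apply, h1, h2, h3, h4, pd_gradU hG hx hf, hess_apply]
  split_ifs <;> ring

lemma confQ_comm (hG : IsMetricOn G O) (hx : x ∈ O) (i j l k : Fin 4) :
    (confQ G f i x * confQ G f j x) l k =
      (if l = i then 2 * (pd j f x * pd k f x) - gradSq G f x * G x j k else 0)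
      + pd i f x * ((if l = j then pd k f x else 0) + (if l = k then pd j f x else 0)
        - gradU G f l x * G x j k)
      - gradU G f l x * (G x i j * pd k f x + G x i k * pd j f x - pd i f x * G x j k) := by
  have hs : ∀ c : Fin 4 → ℝ, ∑ m, c m * confQ G f j x m k =
      c j * pd k f x + c k * pd j f x - (∑ m, c m * gradU G f m x) * G x j k := by
    intro c
    simp only [confQ, Matrix.of_apply, mul_sub, mul_add, mul_ite, mul_zero,
      Finset.sum_sub_distrib, Finset.sum_add_distrib, Finset.sum_ite_eq', Finset.mem_univ, if_true,
      ← mul_assoc, ← Finset.sum_mul]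
  rw [Matrix.mul_apply, hs]
  have h1 : ∑ m, confQ G f i x l m * gradU G f m x = (if l = i then gradSq G f x else 0)
      + pd i f x * gradU G f l x - gradU G f l x * pd i f x := by
    simp only [confQ, Matrix.of_apply, sub_mul, add_mul, ite_mul, zero_mul,
      Finset.sum_sub_distrib, Finset.sum_add_distrib, Finset.sum_ite_eq, Finset.mem_univ, if_true,
      mul_assoc, ← Finset.mul_sum, lower_gradU hG hx, gradSq_eq]
    split_ifs <;> simp
  rw [h1]
  simp only [confQ, Matrix.of_apply]
  split_ifs <;> ring

/-- The Riemann tensor of a conformally rescaled metric. -/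
lemma riemann_conf (hK : IsConformal G K f O) (hG : IsMetricOn G O) (hf : Sm O f) (hx : x ∈ O)
    (l k i j : Fin 4) :
    riemann K l k i j x = riemann G l k i j x
      + (if l = i then confA G f x k j else 0) - (if l = j then confA G f x k i else 0)
      + G x k j * (∑ m, (G x)⁻¹ l m * confA G f x m i)
      - G x k i * (∑ m, (G x)⁻¹ l m * confA G f x m j) := by
  have hO := hG.isOpen
  have hpd : ∀ a b, pdM a (Gam K b) x = pdM a (Gam G b) x + pdM a (confQ G f b) x := by
    intro a b
    rw [pdM_congr hO hx (fun y hy => Gam_conf hK hG hf hy b),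
      pdM_add hO hx (hG.smooth_Gam b) (smooth_confQ hG hf b)]
  -- Curvature of Γ + Q: the old curvature, the antisymmetrised derivative of Q, and the commutator
  -- of Q with itself.
  have hc : curv (Gam K) i j x = curv (Gam G) i j x
      + (pdM i (confQ G f j) x + Gam G i x * confQ G f j x - confQ G f j x * Gam G i x)
      - (pdM j (confQ G f i) x + Gam G j x * confQ G f i x - confQ G f i x * Gam G j x)
      + confQ G f i x * confQ G f j x - confQ G f j x * confQ G f i x := by
    unfold curv
    rw [hpd, hpd, Gam_conf hK hG hf hx, Gam_conf hK hG hf hx]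
    noncomm_ring
  have hA : ∀ a, ∑ m, (G x)⁻¹ l m * confA G f x m a = - (∑ m, (G x)⁻¹ l m * hess G f x a m)
      + gradU G f l x * pd a f x - (1 / 2) * gradSq G f x * (if l = a then 1 else 0) := by
    intro a
    rw [← hG.sum_inv_mul hx, gradU, Finset.sum_mul, Finset.mul_sum, ← Finset.sum_neg_distrib,
      ← Finset.sum_add_distrib, ← Finset.sum_sub_distrib]
    refine Finset.sum_congr rfl fun m _ => ?_
    rw [confA, hess_symm hG hx hf m a]
    ring
  have ht : ∀ m, christoffel G m j i x = christoffel G m i j x := by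
    intro m
    have := hG.torsionFree hx j i m
    simpa only [Gam, Matrix.of_apply] using this
  rw [riemann_eq, riemann_eq, hc]
  simp only [Matrix.add_apply, Matrix.sub_apply _ _ l k]
  have e1 := confQ_deriv hG hx hf i j l k
  have e2 := confQ_deriv hG hx hf j i l k
  simp only [Matrix.add_apply, Matrix.sub_apply] at e1 e2
  rw [e1, e2, confQ_comm hG hx, confQ_comm hG hx, hA, hA]
  simp only [confA, ht, pd_comm hO hx hf j i, hess_symm hG hx hf k, hG.symm hx k, hG.symm hx j i]
  split_ifs <;> ring

end ASDGravity

end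

/-! ### Ricci-flat rescalings and the Bianchi identity -/

noncomputable section

namespace ASDGravity

variable {O : Set Coord} {x : Coord} {G : Metric}

/-! ### Conformally Ricci-flat metrics -/

variable {f : Coord → ℝ} {K : Metric}

lemma ricci_conf (hK : IsConformal G K f O) (hG : IsMetricOn G O) (hf : Sm O f) (hx : x ∈ O)
    (k j : Fin 4) :
    ricci K k j x = ricci G k j x + 2 * confA G f x k j
      + G x k j * ∑ i, ∑ m, (G x)⁻¹ i m * confA G f x m i := by
  have h : ∑ i, G x k i * ∑ m, (G x)⁻¹ i m * confA G f x m j = confA G f x k j := by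
    simp only [Finset.mul_sum]
    rw [Finset.sum_comm]
    simp only [← mul_assoc, ← Finset.sum_mul, hG.sum_mul_inv hx]
    simp
  unfold ricci
  simp only [riemann_conf hK hG hf hx, Finset.sum_add_distrib, Finset.sum_sub_distrib, if_true, h,
    ← Finset.mul_sum]
  simp
  ring

lemma ricci_eq_schouten (hG : IsMetricOn G O) (hx : x ∈ O) (k j : Fin 4) :
    ricci G k j x = 2 * schouten G x k j
      + G x k j * ∑ i, ∑ m, (G x)⁻¹ i m * schouten G x m i := by
  have h : ∑ i, ∑ m, (G x)⁻¹ i m * schouten G x m i = (1 / 6) * scalarCurv G x := by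
    have h4 : ∑ i, ∑ m, (G x)⁻¹ i m * G x m i = 4 := by
      simp only [hG.sum_inv_mul hx]
      simp
    have : ∀ i m, (G x)⁻¹ i m * schouten G x m i = (1 / 2) * ((G x)⁻¹ i m * ricci G i m x)
        - (1 / 12) * scalarCurv G x * ((G x)⁻¹ i m * G x m i) := by
      intro i m
      rw [schouten, hG.ricci_symm hx i m]
      ring
    simp only [this, Finset.sum_sub_distrib, ← Finset.mul_sum, h4]
    rw [scalarCurv]
    ring
  rw [h, schouten]
  ring

/-- A symmetric tensor is determined by `2 S_{kj} + (tr S) g_{kj}`. -/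
lemma eq_zero_of_two_mul_add_trace (hG : IsMetricOn G O) (hx : x ∈ O) {S : Fin 4 → Fin 4 → ℝ}
    (h : ∀ k j, 2 * S k j + G x k j * ∑ i, ∑ m, (G x)⁻¹ i m * S m i = 0) (k j : Fin 4) :
    S k j = 0 := by
  set t := ∑ i, ∑ m, (G x)⁻¹ i m * S m i with ht
  have h4 : ∑ i, ∑ m, (G x)⁻¹ i m * G x m i = 4 := by
    simp only [hG.sum_inv_mul hx]
    simp
  -- Taking the trace gives 6 tr S = 0.
  have h1 : ∑ i, ∑ m, (G x)⁻¹ i m * (2 * S m i + G x m i * t) = 2 * t + 4 * t := by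
    have e : ∀ i m, (G x)⁻¹ i m * (2 * S m i + G x m i * t) =
        2 * ((G x)⁻¹ i m * S m i) + t * ((G x)⁻¹ i m * G x m i) := fun i m => by ring
    simp only [e, Finset.sum_add_distrib, ← Finset.mul_sum, h4, ← ht]
    ring
  simp only [h, mul_zero, Finset.sum_const_zero] at h1
  have h0 : t = 0 := by linarith
  have := h k j
  rw [h0] at this
  linarith

/-- The Ricci tensor of K is 2S + (tr S) g with S = P + A, the same expression by which P determines
the Ricci tensor of G; this map is injective. -/
lemma ricci_conf_eq_zero_iff (hK : IsConformal G K f O) (hG : IsMetricOn G O) (hf : Sm O f)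
    (hx : x ∈ O) :
    (∀ k j, ricci K k j x = 0) ↔ ∀ k j, schouten G x k j + confA G f x k j = 0 := by
  have key : ∀ k j, ricci K k j x = 2 * (schouten G x k j + confA G f x k j)
      + G x k j * ∑ i, ∑ m, (G x)⁻¹ i m * (schouten G x m i + confA G f x m i) := by
    intro k j
    rw [ricci_conf hK hG hf hx, ricci_eq_schouten hG hx]
    simp only [mul_add, Finset.sum_add_distrib]
    ring
  constructor
  · intro h
    exact eq_zero_of_two_mul_add_trace hG hx
      (S := fun k j => schouten G x k j + confA G f x k j) fun k j => by rw [← key, h]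
  · intro h k j
    rw [key]
    simp [h]

lemma covD1_neg (v : Fin 4 → Coord → ℝ) :
    covD1 G (fun m y => - v m y) x = - covD1 G v x := by
  ext n m
  simp only [covD1, Matrix.of_apply, Matrix.neg_apply, pd_neg, mul_neg, Finset.sum_neg_distrib]
  ring

lemma obstr_neg_pd (hG : IsMetricOn G O) (hx : x ∈ O) (hf : Sm O f) (k j : Fin 4) :
    obstr G (fun m => - pd m f x) (covD1 G (fun m y => - pd m f y) x) x k j =
      schouten G x k j + confA G f x k j := by
  have h := covD1_neg (G := G) (x := x) (fun m => pd m f)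
  rw [h, obstr, Matrix.of_apply, Matrix.neg_apply, confA, ← hess_symm hG hx hf j k, gradSq, hess]
  simp only [neg_mul_neg]
  ring

/-- Substituting P = -A into the conformal transformation of the Riemann tensor leaves the Weyl
tensor of G. With one index up there is no conformal factor. -/
lemma wey_eq_of_ricci_conf (hK : IsConformal G K f O) (hG : IsMetricOn G O) (hf : Sm O f)
    (hx : x ∈ O) (h : ∀ k j, ricci K k j x = 0) (l k i j : Fin 4) :
    wey G x l k i j = ∑ q, G x l q * riemann K q k i j x := by
  have hA : ∀ k j, schouten G x k j = - confA G f x k j := fun k j => by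
    linarith [(ricci_conf_eq_zero_iff hK hG hf hx).1 h k j]
  have hl : ∀ a, ∑ q, G x l q * ∑ m, (G x)⁻¹ q m * confA G f x m a = confA G f x l a := by
    intro a
    simp only [Finset.mul_sum]
    rw [Finset.sum_comm]
    simp only [← mul_assoc, ← Finset.sum_mul, hG.sum_mul_inv hx]
    simp
  simp only [riemann_conf hK hG hf hx, mul_add, mul_sub, Finset.sum_add_distrib,
    Finset.sum_sub_distrib, mul_ite, mul_zero, Finset.sum_ite_eq', Finset.mem_univ, if_true,
    mul_left_comm (G x l _) (G x k _), ← Finset.mul_sum, hl]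
  rw [wey_eq, riem]
  simp only [hA]
  ring

/-- Covariant derivative of a tensor `T^l_{kij}`. -/
def nabMixed (G : Metric) (m : Fin 4) (T : Fin 4 → Fin 4 → Fin 4 → Fin 4 → Coord → ℝ) (x : Coord)
    (l k i j : Fin 4) : ℝ :=
  pd m (T l k i j) x + ∑ n, christoffel G l m n x * T n k i j x
    - ∑ p, christoffel G p m k x * T l p i j x - ∑ p, christoffel G p m i x * T l k p j x
    - ∑ p, christoffel G p m j x * T l k i p x

lemma IsMetricOn.christoffel_symm (hG : IsMetricOn G O) (hx : x ∈ O) (l i j : Fin 4) :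
    christoffel G l i j x = christoffel G l j i x := by
  have := hG.torsionFree hx i j l
  simpa only [Gam, Matrix.of_apply] using this

lemma riemann_swap (l k i j : Fin 4) : riemann K l k i j x = - riemann K l k j i x := by
  rw [riemann_eq, riemann_eq, curv_swap _ j i, Matrix.neg_apply]

/-- The contracted second Bianchi identity for a Ricci-flat metric. -/
lemma sum_nabMixed_riemann (hK : IsMetricOn K O) (h : ∀ y ∈ O, ∀ k j, ricci K k j y = 0)
    (hx : x ∈ O) (k j i : Fin 4) : ∑ m, nabMixed K m (riemann K) x m k j i = 0 := by
  have hO := hK.isOpen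
  have hr : ∀ y ∈ O, ∀ k j, ∑ m, riemann K m k m j y = 0 := h
  have hr2 : ∀ y ∈ O, ∀ k j, ∑ m, riemann K m k j m y = 0 := fun y hy k j => by
    rw [Finset.sum_congr rfl fun m _ => riemann_swap m k j m, Finset.sum_neg_distrib, hr y hy,
      neg_zero]
  -- Trace over the upper index and the first direction of differentiation. The other two derivative
  -- terms reduce to derivatives of the Ricci tensor; the Christoffel terms on j and i arise from
  -- commutator terms by symmetry of the connection.
  have hb : ∀ m, _ := fun m =>
    congrFun (congrFun (second_bianchi hO hx hK.smooth_Gam m j i) m) k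
  have hs := Finset.sum_congr rfl fun m (_ : m ∈ Finset.univ) => hb m
  simp only [Matrix.add_apply, Matrix.sub_apply, Matrix.mul_apply, pdM, Matrix.of_apply,
    Matrix.zero_apply, Finset.sum_const_zero] at hs
  simp only [← riemann_eq, Gam, Matrix.of_apply] at hs
  have e1 : ∑ m, pd j (fun y => riemann K m k i m y) x = 0 := by
    rw [← pd_sum hO hx fun m => hK.smooth_riemann m k i m]
    exact pd_eq_zero hO hx (fun y hy => hr2 y hy k i) j
  have e2 : ∑ m, pd i (fun y => riemann K m k m j y) x = 0 := by
    rw [← pd_sum hO hx fun m => hK.smooth_riemann m k m j]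
    exact pd_eq_zero hO hx (fun y hy => hr y hy k j) i
  have e3 : ∑ m, ∑ n, riemann K m n i m x * christoffel K n j k x = 0 := by
    rw [Finset.sum_comm]
    simp only [← Finset.sum_mul, hr2 x hx]
    simp
  have e4 : ∑ m, ∑ n, riemann K m n m j x * christoffel K n i k x = 0 := by
    rw [Finset.sum_comm]
    simp only [← Finset.sum_mul, hr x hx]
    simp
  have e5 : ∑ m, ∑ p, christoffel K p m j x * riemann K m k p i x =
      - ∑ m, ∑ n, christoffel K m j n x * riemann K n k i m x := by
    rw [Finset.sum_comm, ← Finset.sum_neg_distrib]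
    refine Finset.sum_congr rfl fun m _ => ?_
    rw [← Finset.sum_neg_distrib]
    refine Finset.sum_congr rfl fun n _ => ?_
    rw [hK.christoffel_symm hx, riemann_swap n k m i]
    ring
  have e6 : ∑ m, ∑ p, christoffel K p m i x * riemann K m k j p x =
      - ∑ m, ∑ n, christoffel K m i n x * riemann K n k m j x := by
    rw [Finset.sum_comm, ← Finset.sum_neg_distrib]
    refine Finset.sum_congr rfl fun m _ => ?_
    rw [← Finset.sum_neg_distrib]
    refine Finset.sum_congr rfl fun n _ => ?_
    rw [hK.christoffel_symm hx, riemann_swap n k j m]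
    ring
  have e7 : ∑ m, ∑ p, christoffel K p m k x * riemann K m p j i x =
      ∑ m, ∑ p, riemann K m p j i x * christoffel K p m k x :=
    Finset.sum_congr rfl fun m _ => Finset.sum_congr rfl fun n _ => mul_comm _ _
  simp only [nabMixed, Finset.sum_add_distrib, Finset.sum_sub_distrib, e5, e6, e7]
  simp only [Finset.sum_add_distrib, Finset.sum_sub_distrib, e1, e2, e3, e4] at hs
  linarith

/-- Lowering an index commutes with ∇ because the metric is parallel. -/
lemma nab_lower (hG : IsMetricOn G O) (hx : x ∈ O)
    {T : Fin 4 → Fin 4 → Fin 4 → Fin 4 → Coord → ℝ} (hT : ∀ l k i j, Sm O (T l k i j)) {t : Coord → T4}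
    (ht : ∀ y ∈ O, ∀ l k i j, t y l k i j = ∑ q, G y l q * T q k i j y) (m l k i j : Fin 4) :
    nab G m t x l k i j = ∑ q, G x l q * nabMixed G m T x q k i j := by
  have hO := hG.isOpen
  have h1 : pd m (fun y => t y l k i j) x = ∑ q, (pd m (fun y => G y l q) x * T q k i j x
      + G x l q * pd m (T q k i j) x) := by
    rw [pd_congr hO hx (fun y hy => ht y hy l k i j),
      pd_sum hO hx fun q => (hG.smooth l q).mul (hT q k i j)]
    exact Finset.sum_congr rfl fun q _ => pd_mul hO hx (hG.smooth l q) (hT q k i j) m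
  have h2 : ∀ q, pd m (fun y => G y l q) x =
      (∑ c, christoffel G c m l x * G x c q) + ∑ c, G x l c * christoffel G c m q x := by
    intro q
    have := congrFun (congrFun (hG.compat hx m) l) q
    simpa [pdM, Matrix.mul_apply, Gam] using this
  have c1 : ∑ q, (∑ c, christoffel G c m l x * G x c q) * T q k i j x =
      ∑ n, christoffel G n m l x * ∑ q, G x n q * T q k i j x := by
    simp only [Finset.sum_mul, Finset.mul_sum]
    rw [Finset.sum_comm]
    simp only [mul_assoc]
  have c2 : ∑ q, (∑ c, G x l c * christoffel G c m q x) * T q k i j x =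
      ∑ q, G x l q * ∑ n, christoffel G q m n x * T n k i j x := by
    simp only [Finset.sum_mul, Finset.mul_sum]
    rw [Finset.sum_comm]
    simp only [mul_assoc]
  have c3 : ∀ (c : Fin 4 → ℝ) (S : Fin 4 → Fin 4 → ℝ),
      ∑ n, c n * ∑ q, G x l q * S q n = ∑ q, G x l q * ∑ n, c n * S q n := by
    intro c S
    simp only [Finset.mul_sum]
    rw [Finset.sum_comm]
    exact Finset.sum_congr rfl fun _ _ => Finset.sum_congr rfl fun _ _ => by ring
  rw [nab, h1]
  simp only [ht x hx, h2, add_mul, Finset.sum_add_distrib, c1, c2, nabMixed, mul_add, mul_sub,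
    Finset.sum_sub_distrib]
  rw [c3 _ (fun q n => T q n i j x), c3 _ (fun q n => T q k n j x), c3 _ (fun q n => T q k i n x)]
  ring

/-- If `exp(2 f) G` is Ricci-flat, then the Weyl tensor satisfies `∇^l C_{ijkl} = - ∂^l f C_{ijkl}`. -/
lemma divEq_of_ricci_conf (hK : IsConformal G K f O) (hG : IsMetricOn G O) (hf : Sm O f)
    (hA : ∀ y ∈ O, WeylASDAt G y) (h : ∀ y ∈ O, ∀ k j, ricci K k j y = 0) (hx : x ∈ O) :
    DivEq G (fun m => - pd m f x) x := by
  have hKm := hK.isMetricOn hG hf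
  have hw := wey_isASDType hG hx (hA x hx)
  have ht : ∀ y ∈ O, ∀ l k i j, wey G y l k i j = ∑ q, G y l q * riemann K q k i j y :=
    fun y hy => wey_eq_of_ricci_conf hK hG hf hy (h y hy)
  have anti2 : ∀ {t : T4}, IsASDType (G x) t → ∀ i j k l, t i j k l = t l k j i := by
    intro t ht i j k l
    rw [ht.pair, ht.anti, ht.pair, ht.anti, ht.pair, neg_neg]
  have hup : ∀ n k j i, ∑ l, (G x)⁻¹ n l * wey G x l k j i = riemann K n k j i x := by
    intro n k j i
    simp only [ht x hx, Finset.mul_sum]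
    rw [Finset.sum_comm]
    simp only [← mul_assoc, ← Finset.sum_mul, hG.sum_inv_mul hx]
    simp
  have hU : ∀ k j i, ∑ p, gradU G f p x * wey G x p k j i = ∑ m, pd m f x * riemann K m k j i x := by
    intro k j i
    simp only [← hup, gradU, Finset.sum_mul, Finset.mul_sum]
    rw [Finset.sum_comm]
    refine Finset.sum_congr rfl fun _ _ => Finset.sum_congr rfl fun _ _ => ?_
    rw [hG.inv_symm hx]
    ring
  have hlow : ∀ q k j i, ∑ m, G x m q * riemann K m k j i x = wey G x q k j i := by
    intro q k j i
    rw [ht x hx]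
    exact Finset.sum_congr rfl fun m _ => by rw [hG.symm hx]
  have htr : ∀ j i, ∑ m, riemann K m m j i x = 0 := by
    intro j i
    have h1 : ∑ m, riemann K m m j i x = ∑ m, ∑ l, (G x)⁻¹ m l * wey G x l m j i := by
      simp only [hup]
    have h2 : ∑ m, ∑ l, (G x)⁻¹ m l * wey G x l m j i =
        - ∑ m, ∑ l, (G x)⁻¹ m l * wey G x l m j i := by
      conv_lhs => rw [Finset.sum_comm]
      rw [← Finset.sum_neg_distrib]
      refine Finset.sum_congr rfl fun m _ => ?_
      rw [← Finset.sum_neg_distrib]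
      refine Finset.sum_congr rfl fun l _ => ?_
      rw [hG.inv_symm hx l m, hw.anti]
      ring
    linarith
  have hr : ∀ k j, ∑ m, riemann K m k m j x = 0 := h x hx
  have hr2 : ∀ k j, ∑ m, riemann K m k j m x = 0 := fun k j => by
    rw [Finset.sum_congr rfl fun m _ => riemann_swap m k j m, Finset.sum_neg_distrib, hr, neg_zero]
  have hQ : ∀ m l k, christoffel K l m k x = christoffel G l m k x + confQ G f m x l k := by
    intro m l k
    have := congrFun (congrFun (Gam_conf hK hG hf hx m) l) k
    simpa only [Gam, Matrix.of_apply, Matrix.add_apply] using this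
  have hQ1 : ∀ T : Fin 4 → ℝ, ∑ m, ∑ n, confQ G f m x m n * T n = 4 * ∑ n, pd n f x * T n := by
    intro T
    rw [Finset.sum_comm]
    simp only [← Finset.sum_mul, confQ, Matrix.of_apply, Finset.sum_sub_distrib,
      Finset.sum_add_distrib, if_true, Finset.sum_ite_eq', Finset.mem_univ,
      mul_comm (gradU G f _ x), lower_gradU' hG hx, Finset.mul_sum]
    refine Finset.sum_congr rfl fun n _ => ?_
    simp
    ring
  have hQ2 : ∀ (a : Fin 4) (S : Fin 4 → Fin 4 → ℝ), ∑ m, ∑ p, confQ G f m x p a * S m p =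
      pd a f x * (∑ m, S m m) + (∑ m, pd m f x * S m a)
        - ∑ p, gradU G f p x * ∑ m, G x m a * S m p := by
    intro a S
    simp only [confQ, Matrix.of_apply, sub_mul, add_mul, ite_mul, zero_mul,
      Finset.sum_sub_distrib, Finset.sum_add_distrib, Finset.sum_ite_eq', Finset.mem_univ, if_true,
      Finset.mul_sum]
    congr 1
    rw [Finset.sum_comm]
    exact Finset.sum_congr rfl fun _ _ => Finset.sum_congr rfl fun _ _ => by ring
  -- Converting the divergence from K to G. In units of ∂_m f R^m_{kji}, the upper index contributes
  -- 4, the index k contributes -2, and j and i together -1 by the cyclic identity; the net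
  -- coefficient is 1. Traces drop out by Ricci-flatness and antisymmetry.
  have key : ∀ k j i, ∑ m, nabMixed G m (riemann K) x m k j i
      + ∑ m, pd m f x * riemann K m k j i x = 0 := by
    intro k j i
    have hb := sum_nabMixed_riemann hKm h hx k j i
    simp only [nabMixed, hQ, add_mul, Finset.sum_add_distrib, Finset.sum_sub_distrib] at hb
    rw [hQ1, hQ2 k (fun m p => riemann K m p j i x), hQ2 j (fun m p => riemann K m k p i x),
      hQ2 i (fun m p => riemann K m k j p x)] at hb
    simp only [htr, hr, hr2, hlow] at hb
    have d1 : ∑ p, gradU G f p x * wey G x k p j i = - ∑ m, pd m f x * riemann K m k j i x := by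
      rw [← hU, ← Finset.sum_neg_distrib]
      exact Finset.sum_congr rfl fun p _ => by rw [hw.anti]; ring
    have d2 : ∑ p, gradU G f p x * wey G x j k p i + ∑ p, gradU G f p x * wey G x i k j p =
        ∑ m, pd m f x * riemann K m k j i x := by
      rw [← hU, ← Finset.sum_add_distrib]
      refine Finset.sum_congr rfl fun p _ => ?_
      rw [← mul_add]
      congr 1
      have a1 := hw.cyc p i j k
      have a2 := hw.pair j k p i
      have a3 := anti2 hw i k j p
      have a4 := hw.pair p k i j
      have a5 := hw.anti i j p k
      have a6 := hw.pair j i p k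
      linarith
    simp only [nabMixed, Finset.sum_add_distrib, Finset.sum_sub_distrib]
    linarith
  intro i j k
  have hn := fun m => anti2 (nab_isASDType hG hA hx m)
  have hl := nab_lower hG hx hKm.smooth_riemann ht
  rw [Finset.sum_comm]
  rw [← key k j i, ← Finset.sum_add_distrib]
  refine Finset.sum_congr rfl fun m _ => ?_
  have s1 : ∑ l, (G x)⁻¹ l m * wey G x i j k l = riemann K m k j i x := by
    rw [← hup]
    exact Finset.sum_congr rfl fun l _ => by rw [hG.inv_symm hx, anti2 hw]
  have s2 : ∑ l, (G x)⁻¹ l m * nab G m (wey G) x i j k l = nabMixed G m (riemann K) x m k j i := by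
    simp only [hn m i j k, hl, Finset.mul_sum]
    rw [Finset.sum_comm]
    simp only [hG.inv_symm hx _ m, ← mul_assoc, ← Finset.sum_mul, hG.sum_inv_mul hx]
    simp
  rw [← s1, ← s2, Finset.mul_sum, ← Finset.sum_add_distrib]
  exact Finset.sum_congr rfl fun l _ => by ring

end ASDGravity

end

/-! ### The Poincaré lemma and the equivalence on a coordinate domain -/

noncomputable section

namespace ASDGravity

variable {O : Set Coord} {x : Coord} {G : Metric}

/-! ### The local theorem -/

lemma sum_dirVec (w : Coord) : ∑ m, w m • dirVec m = w := by
  ext i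
  simp [dirVec, Pi.single_apply]

/-- The one-form with components `v`. -/
def oneForm (v : Fin 4 → Coord → ℝ) (y : Coord) : Coord →L[ℝ] ℝ :=
  ∑ m, v m y • (EuclideanSpace.proj m : Coord →L[ℝ] ℝ)

lemma oneForm_dirVec (v : Fin 4 → Coord → ℝ) (y : Coord) (m : Fin 4) :
    oneForm v y (dirVec m) = v m y := by
  simp [oneForm, dirVec]

lemma contDiffOn_oneForm {v : Fin 4 → Coord → ℝ} (hv : ∀ m, Sm O (v m)) :
    ContDiffOn ℝ ∞ (oneForm v) O :=
  ContDiffOn.sum fun m _ => ContDiffOn.smul (hv m) contDiffOn_const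

lemma fderiv_apply_eq_sum (h : Coord → ℝ) (y w : Coord) : fderiv ℝ h y w = ∑ n, w n * pd n h y := by
  conv_lhs => rw [← sum_dirVec w]
  simp [pd]

/-- A closed one-form on a convex open set is exact. -/
lemma exists_pd_eq (hO : IsOpen O) (hc : Convex ℝ O) {v : Fin 4 → Coord → ℝ}
    (hv : ∀ m, Sm O (v m)) (hcl : ∀ y ∈ O, ∀ n m, pd n (v m) y = pd m (v n) y) :
    ∃ f, Sm O f ∧ ∀ y ∈ O, ∀ m, pd m f y = v m y := by
  have hd : ∀ y ∈ O, ∀ a b, fderiv ℝ (oneForm v) y a b = ∑ m, ∑ n, a n * b m * pd n (v m) y := by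
    intro y hy a b
    have h1 : HasFDerivAt (oneForm v)
        (∑ m, (fderiv ℝ (v m) y).smulRight (EuclideanSpace.proj m : Coord →L[ℝ] ℝ)) y := by
      refine HasFDerivAt.fun_sum fun m _ => ?_
      exact ((hv m).differentiableAt hO hy).hasFDerivAt.smul_const
        (EuclideanSpace.proj m : Coord →L[ℝ] ℝ)
    rw [h1.fderiv]
    have h2 : ∀ m : Fin 4, (EuclideanSpace.proj m : Coord →L[ℝ] ℝ) b = b m := fun _ => rfl
    simp only [sum_apply, ContinuousLinearMap.smulRight_apply, smul_apply, h2, smul_eq_mul,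
      fderiv_apply_eq_sum, Finset.sum_mul]
    exact Finset.sum_congr rfl fun _ _ => Finset.sum_congr rfl fun _ _ => by ring
  obtain ⟨f, hf⟩ := hc.exists_forall_hasFDerivAt_of_fderiv_symmetric hO
    ((contDiffOn_oneForm hv).differentiableOn (by simp)) (fun y hy a b => by
      rw [hd y hy, hd y hy, Finset.sum_comm]
      refine Finset.sum_congr rfl fun m _ => Finset.sum_congr rfl fun n _ => ?_
      rw [hcl y hy]
      ring)
  refine ⟨f, ?_, fun y hy m => ?_⟩
  -- The derivative of f is the given smooth one-form, hence f is smooth.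
  · refine (contDiffOn_infty_iff_fderiv_of_isOpen hO).2
      ⟨fun y hy => (hf y hy).differentiableAt.differentiableWithinAt, ?_⟩
    exact (contDiffOn_oneForm hv).congr fun y hy => (hf y hy).fderiv
  · rw [pd, (hf y hy).fderiv, oneForm_dirVec]

lemma conditions_of_ricci_conf {f : Coord → ℝ} {K : Metric} (hK : IsConformal G K f O)
    (hG : IsMetricOn G O) (hf : Sm O f) (hA : ∀ y ∈ O, WeylASDAt G y) (hne : weyl G x ≠ 0)
    (h : ∀ y ∈ O, ∀ k j, ricci K k j y = 0) (hx : x ∈ O) (e : SpinFrame G x) :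
    (curvMatrix e).det = 0 ∧ ∀ E' E A B C A' : Fin 2,
      (∑ D, Xi e E' E A B C D * Vup e D A') - Theta e A B C E E' A' = 0 := by
  have hd : ∀ y ∈ O, DivEq G (fun m => - pd m f y) y := fun y hy =>
    divEq_of_ricci_conf hK hG hf hA h hy
  refine ⟨det_eq_zero_of_eq hG hx (hA x hx) e ((divEq_iff hG hx hA e _).1 (hd x hx)), ?_⟩
  refine (obstr_eq_zero_iff hG hx hA hne e (hd x hx)
    (derivDivEq hG (v := fun m y => - pd m f y) (fun m => (hf.pd hG.isOpen m).neg) hd hx)).1 ?_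
  ext k j
  rw [obstr_neg_pd hG hx hf, Matrix.zero_apply]
  exact (ricci_conf_eq_zero_iff hK hG hf hx).1 (h x hx) k j

lemma exists_divEq_of_det (hG : IsMetricOn G O) (hx : x ∈ O) (hA : ∀ y ∈ O, WeylASDAt G y)
    (hne : weyl G x ≠ 0) (hdet : ∀ e : SpinFrame G x, (curvMatrix e).det = 0) :
    ∃ v : Fin 4 → ℝ, DivEq G v x := by
  obtain ⟨e, he⟩ := exists_isReal_spinFrame hG hx
  obtain ⟨u, hu⟩ := exists_eq_of_det_eq_zero hG hx hA hne e he (hdet e)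
  -- The index is lowered here so that raising it with ε gives back u, by εεᵀ = 1.
  refine exists_divEq hG hx hA e (u := fun E A' => ∑ D, eps D E * u D A') fun A' A B C => ?_
  rw [hu]
  simp [eps]

/-- The divergence equation gives v and the second condition makes `obstr` vanish. All terms of
`obstr` other than ∇v are symmetric, so v is closed, and on a convex domain v = -df. -/
lemma exists_ricci_conf_eq_zero (hG : IsMetricOn G O) (hc : Convex ℝ O)
    (hA : ∀ y ∈ O, WeylASDAt G y) (hne : ∀ y ∈ O, weyl G y ≠ 0)
    (hdet : ∀ y ∈ O, ∀ e : SpinFrame G y, (curvMatrix e).det = 0)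
    (hob : ∀ y ∈ O, ∀ e : SpinFrame G y, ∀ E' E A B C A' : Fin 2,
      (∑ D, Xi e E' E A B C D * Vup e D A') - Theta e A B C E E' A' = 0) :
    ∃ f, Sm O f ∧ ∀ K, IsConformal G K f O → ∀ y ∈ O, ∀ k j, ricci K k j y = 0 := by
  obtain ⟨v, hv, hvd⟩ := exists_smooth_divEq hG hA hne fun y hy =>
    exists_divEq_of_det hG hy hA (hne y hy) (hdet y hy)
  have ho : ∀ y ∈ O, obstr G (fun m => v m y) (covD1 G v y) y = 0 := by
    intro y hy
    obtain ⟨e, -⟩ := exists_isReal_spinFrame hG hy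
    exact (obstr_eq_zero_iff hG hy hA (hne y hy) e (hvd y hy) (derivDivEq hG hv hvd hy)).2
      (hob y hy e)
  obtain ⟨f, hf, hfv⟩ := exists_pd_eq hG.isOpen hc (v := fun m y => - v m y)
    (fun m => (hv m).neg) (by
      intro y hy n m
      rw [pd_neg, pd_neg, neg_inj]
      have h1 := congrFun (congrFun (ho y hy) n) m
      have h2 := congrFun (congrFun (ho y hy) m) n
      simp only [obstr, covD1, Matrix.of_apply, Matrix.zero_apply] at h1 h2
      rw [hG.schouten_symm hy n m, hG.symm hy n m] at h1
      simp only [hG.christoffel_symm hy _ n m] at h2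
      linarith)
  refine ⟨f, hf, fun K hK y hy => (ricci_conf_eq_zero_iff hK hG hf hy).2 fun k j => ?_⟩
  rw [← obstr_neg_pd hG hy hf]
  have h1 : (fun m => - pd m f y) = fun m => v m y := by
    funext m
    rw [hfv y hy, neg_neg]
  have h2 : covD1 G (fun m y => - pd m f y) y = covD1 G v y := by
    ext n m
    simp only [covD1, Matrix.of_apply]
    rw [pd_congr hG.isOpen hy (h := v m) fun z hz => by rw [hfv z hz, neg_neg]]
    congr 1
    exact Finset.sum_congr rfl fun p _ => by rw [hfv y hy, neg_neg]
  rw [h1, h2, ho y hy, Matrix.zero_apply]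

end ASDGravity

end

noncomputable section

namespace ASDGravity

variable {O : Set Coord} {x : Coord} {G : Metric}

/-! ### Change of coordinates -/

variable {O₂ : Set Coord} {K : Metric} {F : Coord → Coord}

/-- The Jacobian matrix `∂_k F^l`. -/
def jac (F : Coord → Coord) (y : Coord) : Mat := Matrix.of fun l k => pd k (fun z => F z l) y

lemma Sm.coord (hF : ContDiffOn ℝ ∞ F O₂) (l : Fin 4) : Sm O₂ (fun z => F z l) :=
  (EuclideanSpace.proj l : Coord →L[ℝ] ℝ).contDiff.comp_contDiffOn hF

lemma smooth_jac (hO : IsOpen O₂) (hF : ContDiffOn ℝ ∞ F O₂) : SmM O₂ (jac F) :=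
  fun l k => (Sm.coord hF l).pd hO k

lemma fderiv_dirVec (hO : IsOpen O₂) (hx : x ∈ O₂) (hF : ContDiffOn ℝ ∞ F O₂) (k l : Fin 4) :
    fderiv ℝ F x (dirVec k) l = jac F x l k := by
  have hd : DifferentiableAt ℝ F x := (hF.differentiableOn (by simp)).differentiableAt (hO.mem_nhds hx)
  have h := ((EuclideanSpace.proj l : Coord →L[ℝ] ℝ).hasFDerivAt.comp x hd.hasFDerivAt).fderiv
  have e : (EuclideanSpace.proj l : Coord →L[ℝ] ℝ) ∘ F = fun z => F z l := rfl
  rw [e] at h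
  simp only [jac, Matrix.of_apply, pd, h]
  rfl

lemma Sm.comp_map {h : Coord → ℝ} (hh : Sm O h) (hF : ContDiffOn ℝ ∞ F O₂)
    (hm : Set.MapsTo F O₂ O) : Sm O₂ (fun z => h (F z)) :=
  ContDiffOn.comp hh hF hm

lemma pd_comp {h : Coord → ℝ} (hO : IsOpen O) (hO₂ : IsOpen O₂) (hh : Sm O h)
    (hF : ContDiffOn ℝ ∞ F O₂) (hm : Set.MapsTo F O₂ O) (hx : x ∈ O₂) (i : Fin 4) :
    pd i (fun z => h (F z)) x = ∑ a, jac F x a i * pd a h (F x) := by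
  have hd : DifferentiableAt ℝ F x :=
    (hF.differentiableOn (by simp)).differentiableAt (hO₂.mem_nhds hx)
  have h1 := (hh.differentiableAt hO (hm hx)).hasFDerivAt.comp x hd.hasFDerivAt
  have e : h ∘ F = fun z => h (F z) := rfl
  rw [e] at h1
  rw [pd, h1.fderiv, ContinuousLinearMap.comp_apply, fderiv_apply_eq_sum]
  exact Finset.sum_congr rfl fun a _ => by rw [fderiv_dirVec hO₂ hx hF]

/-- `K = F^* G` on `O₂`. -/
structure IsPullback (F : Coord → Coord) (G K : Metric) (O O₂ : Set Coord) : Prop where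
  metric : IsMetricOn G O
  metric₂ : IsMetricOn K O₂
  smooth : ContDiffOn ℝ ∞ F O₂
  mapsTo : Set.MapsTo F O₂ O
  eq : ∀ y ∈ O₂, K y = (jac F y)ᵀ * G (F y) * jac F y

/-- The connection matrices of `G` pulled back along `F`. -/
def pullConn (F : Coord → Coord) (G : Metric) (i : Fin 4) (y : Coord) : Mat :=
  ∑ a, jac F y a i • Gam G a (F y)

namespace IsPullback

lemma det_jac_ne (h : IsPullback F G K O O₂) (hx : x ∈ O₂) : IsUnit (jac F x).det := by
  have h1 := h.metric₂.det_ne x hx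
  rw [h.eq x hx, Matrix.det_mul, Matrix.det_mul] at h1
  exact isUnit_iff_ne_zero.2 (right_ne_zero_of_mul h1)

lemma pdM_comp (h : IsPullback F G K O O₂) (hx : x ∈ O₂) {A : Coord → Mat} (hA : SmM O A)
    (i : Fin 4) : pdM i (fun z => A (F z)) x = ∑ a, jac F x a i • pdM a A (F x) := by
  ext p q
  simp only [pdM, Matrix.of_apply, Matrix.sum_apply, Matrix.smul_apply, smul_eq_mul]
  exact pd_comp h.metric.isOpen h.metric₂.isOpen (hA p q) h.smooth h.mapsTo hx i

lemma smooth_pullConn (h : IsPullback F G K O O₂) (i : Fin 4) : SmM O₂ (pullConn F G i) := by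
  intro p q
  have : ∀ y, pullConn F G i y p q = ∑ a, jac F y a i * Gam G a (F y) p q := by
    intro y
    simp [pullConn, Matrix.sum_apply]
  simp only [this]
  exact Sm.sum fun a => (smooth_jac h.metric₂.isOpen h.smooth a i).mul
    ((h.metric.smooth_Gam a p q).comp_map h.smooth h.mapsTo)

lemma pd_jac_symm (h : IsPullback F G K O O₂) (hx : x ∈ O₂) (i j l : Fin 4) :
    pd i (fun y => jac F y l j) x = pd j (fun y => jac F y l i) x :=
  pd_comm h.metric₂.isOpen hx (Sm.coord h.smooth l) i j

/-- The transformation law of Christoffel symbols, by uniqueness: solved for the connection of K,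
the right side is symmetric because second derivatives of F commute, and compatible with K because K
is the pullback of G. -/
lemma jac_mul_Gam (h : IsPullback F G K O O₂) (hx : x ∈ O₂) (i : Fin 4) :
    jac F x * Gam K i x = pullConn F G i x * jac F x + pdM i (jac F) x := by
  have hu := h.det_jac_ne hx
  have hJ := smooth_jac h.metric₂.isOpen h.smooth
  have hGF : SmM O₂ (fun z => G (F z)) := fun a b =>
    (h.metric.smooth a b).comp_map h.smooth h.mapsTo
  have hu2 : ∀ X : Mat, jac F x * ((jac F x)⁻¹ * X) = X := fun X =>
    Matrix.mul_nonsing_inv_cancel_left _ _ hu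
  have key := h.metric₂.christoffel_unique hx
    (A := fun i y => (jac F y)⁻¹ * (pullConn F G i y * jac F y + pdM i (jac F) y)) ?_ ?_ i
  · rw [key, hu2]
  · intro i k l
    have : ∀ i : Fin 4, (pullConn F G i x * jac F x + pdM i (jac F) x) =
        Matrix.of fun q k => (∑ a, ∑ p, jac F x a i * jac F x p k * Gam G a (F x) q p)
          + pd i (fun y => jac F y q k) x := by
      intro i
      ext q k
      simp only [pullConn, Matrix.add_apply, Matrix.mul_apply, Matrix.sum_apply, Matrix.smul_apply,
        smul_eq_mul, Matrix.of_apply, pdM, Finset.sum_mul]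
      congr 1
      exact Finset.sum_congr rfl fun _ _ => Finset.sum_congr rfl fun _ _ => by ring
    beta_reduce
    rw [this i, this k]
    simp only [Matrix.mul_apply, Matrix.of_apply]
    refine Finset.sum_congr rfl fun q _ => ?_
    rw [h.pd_jac_symm hx i k, Finset.sum_comm]
    congr 2
    refine Finset.sum_congr rfl fun a _ => Finset.sum_congr rfl fun p _ => ?_
    rw [h.metric.torsionFree (h.mapsTo hx) p a q]
    ring
  · intro i
    have e1 : pdM i K x = ((pdM i (jac F) x)ᵀ * G (F x) +
        (jac F x)ᵀ * ∑ a, jac F x a i • pdM a G (F x)) * jac F x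
        + (jac F x)ᵀ * G (F x) * pdM i (jac F) x := by
      rw [pdM_congr h.metric₂.isOpen hx h.eq,
        pdM_mul h.metric₂.isOpen hx (hJ.transpose.mul hGF) hJ,
        pdM_mul h.metric₂.isOpen hx hJ.transpose hGF, pdM_transpose, h.pdM_comp hx h.metric.smooth]
    have e2 : ∑ a, jac F x a i • pdM a G (F x) =
        (pullConn F G i x)ᵀ * G (F x) + G (F x) * pullConn F G i x := by
      simp only [h.metric.compat (h.mapsTo hx), pullConn, Matrix.transpose_sum, Finset.sum_mul,
        Finset.mul_sum, smul_add, Finset.sum_add_distrib, Matrix.transpose_smul, Matrix.smul_mul,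
        Matrix.mul_smul]
    have e3 : ∀ X : Mat, K x * ((jac F x)⁻¹ * X) = (jac F x)ᵀ * (G (F x) * X) := by
      intro X
      rw [h.eq x hx, mul_assoc, mul_assoc, hu2]
    have e4 : ∀ X : Mat, ((jac F x)⁻¹ * X)ᵀ * K x = Xᵀ * G (F x) * jac F x := by
      intro X
      rw [← h.metric₂.transpose hx, ← Matrix.transpose_mul, e3, Matrix.transpose_mul,
        Matrix.transpose_mul, h.metric.transpose (h.mapsTo hx), Matrix.transpose_transpose]
    rw [e1, e2, e3, e4]
    simp only [Matrix.transpose_add, Matrix.transpose_mul]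
    noncomm_ring

/-- The two connections are gauge equivalent through the Jacobian, so their curvatures are
conjugate. Differentiating the transformation law gives extra terms symmetric in i, j, which cancel.
-/
lemma jac_mul_curv (h : IsPullback F G K O O₂) (hx : x ∈ O₂) (i j : Fin 4) :
    jac F x * curv (Gam K) i j x = curv (pullConn F G) i j x * jac F x := by
  have hO := h.metric₂.isOpen
  have hJ := smooth_jac hO h.smooth
  have hB := h.smooth_pullConn
  have hA := h.metric₂.smooth_Gam
  have key : ∀ i j, jac F x * (pdM i (Gam K j) x + Gam K i x * Gam K j x) =
      (pdM i (pullConn F G j) x + pullConn F G i x * pullConn F G j x) * jac F x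
      + (pullConn F G j x * pdM i (jac F) x + pullConn F G i x * pdM j (jac F) x
        + pdM i (pdM j (jac F)) x) := by
    intro i j
    have h1 : pdM i (fun y => jac F y * Gam K j y) x =
        pdM i (fun y => pullConn F G j y * jac F y + pdM j (jac F) y) x :=
      pdM_congr hO hx (fun y hy => h.jac_mul_Gam hy j) i
    rw [pdM_mul hO hx hJ (hA j), pdM_add hO hx ((hB j).mul hJ) (hJ.pdM hO j),
      pdM_mul hO hx (hB j) hJ] at h1
    have h2 : jac F x * (Gam K i x * Gam K j x) =
        (pullConn F G i x * jac F x + pdM i (jac F) x) * Gam K j x := by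
      rw [← h.jac_mul_Gam hx, mul_assoc]
    have h3 : pullConn F G i x * jac F x * Gam K j x =
        pullConn F G i x * (pullConn F G j x * jac F x + pdM j (jac F) x) := by
      rw [← h.jac_mul_Gam hx, mul_assoc]
    rw [mul_add, h2, add_mul, h3, eq_sub_of_add_eq' h1]
    noncomm_ring
  have e : ∀ A : Fin 4 → Coord → Mat, curv A i j x =
      (pdM i (A j) x + A i x * A j x) - (pdM j (A i) x + A j x * A i x) := by
    intro A
    unfold curv
    abel
  rw [e, e, mul_sub, key, key, pdM_comm hO hx hJ i j]
  noncomm_ring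

/-- Derivatives of the Jacobian factors are second derivatives of F and cancel under
antisymmetrisation. -/
lemma curv_pullConn (h : IsPullback F G K O O₂) (hx : x ∈ O₂) (i j : Fin 4) :
    curv (pullConn F G) i j x =
      ∑ a, ∑ b, (jac F x a i * jac F x b j) • curv (Gam G) a b (F x) := by
  have hO := h.metric₂.isOpen
  have hJ := smooth_jac hO h.smooth
  have hp : ∀ i j, pdM i (pullConn F G j) x = (∑ b, pd i (fun y => jac F y b j) x • Gam G b (F x))
      + ∑ b, ∑ a, (jac F x a i * jac F x b j) • pdM a (Gam G b) (F x) := by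
    intro i j
    ext p q
    have hs : ∀ b, Sm O₂ (fun y => Gam G b (F y) p q) := fun b =>
      (h.metric.smooth_Gam b p q).comp_map h.smooth h.mapsTo
    have e : (fun y => pullConn F G j y p q) = fun y => ∑ b, jac F y b j * Gam G b (F y) p q := by
      funext y
      simp [pullConn, Matrix.sum_apply]
    simp only [pdM, Matrix.of_apply, Matrix.add_apply, Matrix.sum_apply, Matrix.smul_apply,
      smul_eq_mul, e]
    rw [pd_sum hO hx fun b => (hJ b j).mul (hs b), ← Finset.sum_add_distrib]
    refine Finset.sum_congr rfl fun b _ => ?_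
    rw [pd_mul hO hx (hJ b j) (hs b), pd_comp h.metric.isOpen hO (h.metric.smooth_Gam b p q)
      h.smooth h.mapsTo hx, Finset.mul_sum]
    congr 1
    exact Finset.sum_congr rfl fun a _ => by ring
  have hm : ∀ i j, pullConn F G i x * pullConn F G j x =
      ∑ a, ∑ b, (jac F x a i * jac F x b j) • (Gam G a (F x) * Gam G b (F x)) := by
    intro i j
    simp only [pullConn, Finset.sum_mul, Finset.mul_sum, Matrix.smul_mul, Matrix.mul_smul, smul_smul]
    rw [Finset.sum_comm]
    exact Finset.sum_congr rfl fun _ _ => Finset.sum_congr rfl fun _ _ => by rw [mul_comm]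
  have hs : ∀ T : Fin 4 → Fin 4 → Mat, ∑ b, ∑ a, (jac F x a j * jac F x b i) • T a b =
      ∑ a, ∑ b, (jac F x a i * jac F x b j) • T b a := by
    intro T
    exact Finset.sum_congr rfl fun _ _ => Finset.sum_congr rfl fun _ _ => by rw [mul_comm]
  rw [curv, hp, hp, hm, hm]
  simp only [curv, smul_add, smul_sub, Finset.sum_add_distrib, Finset.sum_sub_distrib,
    h.pd_jac_symm hx j i]
  rw [hs (fun a b => pdM a (Gam G b) (F x)),
    Finset.sum_comm (f := fun a b => (jac F x a j * jac F x b i) • (Gam G a (F x) * Gam G b (F x))),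
    hs (fun a b => Gam G a (F x) * Gam G b (F x)),
    Finset.sum_comm (f := fun b a => (jac F x a i * jac F x b j) • pdM a (Gam G b) (F x))]
  abel

/-- The pullback of a Ricci-flat metric is Ricci-flat. -/
lemma ricci_eq_zero (h : IsPullback F G K O O₂) (hx : x ∈ O₂) (hr : ∀ k j, ricci G k j (F x) = 0)
    (k j : Fin 4) : ricci K k j x = 0 := by
  have hu := h.det_jac_ne hx
  have hR : ∀ i, curv (Gam K) i j x = (jac F x)⁻¹ *
      ((∑ a, ∑ b, (jac F x a i * jac F x b j) • curv (Gam G) a b (F x)) * jac F x) := by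
    intro i
    rw [← h.curv_pullConn hx, ← h.jac_mul_curv hx, Matrix.nonsing_inv_mul_cancel_left _ _ hu]
  have hJ : ∀ a q, ∑ i, jac F x a i * (jac F x)⁻¹ i q = if a = q then 1 else 0 := by
    intro a q
    rw [← Matrix.mul_apply, Matrix.mul_nonsing_inv _ hu, Matrix.one_apply]
  have hr2 : ∀ p b, ∑ a, curv (Gam G) a b (F x) a p = 0 := by
    intro p b
    rw [← hr p b]
    exact Finset.sum_congr rfl fun a _ => (riemann_eq G a p a b (F x)).symm
  -- The trace over i pairs the Jacobian with its inverse and leaves the trace of T, which is the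
  -- Ricci tensor of G at the image point contracted with two Jacobians.
  set T : Fin 4 → Fin 4 → ℝ := fun q a =>
    ∑ p, ∑ b, (jac F x b j * jac F x p k) * curv (Gam G) a b (F x) q p with hT
  have e : ∀ i, riemann K i k i j x = ∑ q, ∑ a, (jac F x a i * (jac F x)⁻¹ i q) * T q a := by
    intro i
    rw [riemann_eq, hR, Matrix.mul_apply]
    refine Finset.sum_congr rfl fun q _ => ?_
    simp only [hT, Matrix.mul_apply, Matrix.sum_apply, Matrix.smul_apply, smul_eq_mul,
      Finset.sum_mul, Finset.mul_sum]
    rw [Finset.sum_comm]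
    exact Finset.sum_congr rfl fun _ _ => Finset.sum_congr rfl fun _ _ =>
      Finset.sum_congr rfl fun _ _ => by ring
  have e2 : ricci K k j x = ∑ a, T a a := by
    unfold ricci
    simp only [e]
    rw [Finset.sum_comm]
    refine Finset.sum_congr rfl fun q _ => ?_
    rw [Finset.sum_comm]
    simp only [← Finset.sum_mul, hJ]
    simp
  have e3 : ∑ a, T a a = ∑ p, ∑ b, (jac F x b j * jac F x p k) *
      ∑ a, curv (Gam G) a b (F x) a p := by
    simp only [hT, Finset.mul_sum]
    rw [Finset.sum_comm]
    exact Finset.sum_congr rfl fun p _ => Finset.sum_comm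
  rw [e2, e3]
  simp [hr2]

end IsPullback

end ASDGravity

end

noncomputable section

namespace ASDGravity

/-! ### Components of a metric on a manifold in charts -/

section Manifold

variable {M : Type*} [TopologicalSpace M] [ChartedSpace Coord M] {h : BilinField M}
  {φ φ' : OpenPartialHomeomorph M Coord} {x : Coord}

lemma inChart_apply (h : BilinField M) (φ : OpenPartialHomeomorph M Coord) (x : Coord)
    (i j : Fin 4) : inChart h φ x i j = h (φ.symm x)
      (mfderiv (𝓡 4) (𝓡 4) φ.symm x (dirVec i)) (mfderiv (𝓡 4) (𝓡 4) φ.symm x (dirVec j)) := rfl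

lemma inChart_smul (Ω : M → ℝ) :
    inChart (fun q => (Ω q) ^ 2 • h q) φ x = (Ω (φ.symm x)) ^ 2 • inChart h φ x := rfl

lemma sum_mfderiv_symm (φ : OpenPartialHomeomorph M Coord) (x w : Coord) :
    ∑ i, w i • mfderiv (𝓡 4) (𝓡 4) φ.symm x (dirVec i) = mfderiv (𝓡 4) (𝓡 4) φ.symm x w := by
  conv_rhs => rw [← sum_dirVec w]
  exact ((map_sum _ _ _).trans (Finset.sum_congr rfl fun i _ => map_smul _ _ _)).symm

lemma bilin_sum (h : BilinField M) (p : M) (u v : Fin 4 → TangentSpace (𝓡 4) p) (a b : Fin 4 → ℝ) :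
    h p (∑ i, a i • u i) (∑ j, b j • v j) = ∑ i, ∑ j, a i * b j * h p (u i) (v j) := by
  simp only [map_sum, map_smul, sum_apply, smul_apply, smul_eq_mul, Finset.mul_sum]
  rw [Finset.sum_comm]
  exact Finset.sum_congr rfl fun _ _ => Finset.sum_congr rfl fun _ _ => by ring

lemma bilin_congr (h : BilinField M) {p q : M} (e : p = q) (u v : Coord) :
    h p (show TangentSpace (𝓡 4) p from u) (show TangentSpace (𝓡 4) p from v) =
      h q (show TangentSpace (𝓡 4) q from u) (show TangentSpace (𝓡 4) q from v) := by
  subst e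
  rfl

variable [IsManifold (𝓡 4) ∞ M]

lemma mfderiv_symm_injective (hφ : φ ∈ atlas Coord M) (hx : x ∈ φ.target) :
    Function.Injective (mfderiv (𝓡 4) (𝓡 4) φ.symm x) :=
  have : IsManifold (𝓡 4) 1 M := IsManifold.of_le (n := ∞) (by simp)
  (mdifferentiable_of_mem_atlas hφ).symm.mfderiv_injective hx

lemma contMDiffOn_chart_symm' (hφ : φ ∈ atlas Coord M) :
    ContMDiffOn (𝓡 4) (𝓡 4) ∞ φ.symm φ.target :=
  contMDiffOn_symm_of_mem_maximalAtlas (IsManifold.subset_maximalAtlas hφ)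

variable (g : Bundle.ContMDiffRiemannianMetric (𝓡 4) ∞ Coord (fun p : M => TangentSpace (𝓡 4) p))

lemma smooth_inChart (hφ : φ ∈ atlas Coord M) (i j : Fin 4) :
    Sm φ.target (fun y => inChart g.inner φ y i j) := by
  have : IsManifold (𝓡 4) 1 M := IsManifold.of_le (n := ∞) (by simp)
  have hs := contMDiffOn_chart_symm' hφ
  have hv : ∀ i, ContMDiffOn (𝓡 4) (𝓡 4).tangent ∞ (fun y => (Bundle.TotalSpace.mk' Coord
      (φ.symm y) (mfderiv (𝓡 4) (𝓡 4) φ.symm y (dirVec i)) : TangentBundle (𝓡 4) M)) φ.target := by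
    intro i
    -- The coordinate vector field is the tangent map of the inverse chart along a constant section,
    -- hence smooth into the tangent bundle.
    have h1 := hs.contMDiffOn_tangentMapWithin (m := ∞) (by simp) φ.open_target.uniqueMDiffOn
    have h2 : ContMDiffOn (𝓡 4) (𝓡 4).tangent ∞ (fun y : Coord =>
        (⟨y, dirVec i⟩ : TangentBundle (𝓡 4) Coord)) φ.target :=
      contMDiffOn_vectorSpace_iff_contDiffOn.2 contDiffOn_const
    refine (h1.comp h2 fun y hy => hy).congr fun y hy => ?_
    simp only [Function.comp, tangentMapWithin]
    rw [mfderivWithin_of_isOpen φ.open_target hy]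
  have hg : ContMDiffOn (𝓡 4) ((𝓡 4).prod 𝓘(ℝ, Coord →L[ℝ] Coord →L[ℝ] ℝ)) ∞
      (fun y => Bundle.TotalSpace.mk' (Coord →L[ℝ] Coord →L[ℝ] ℝ)
        (E := fun p : M => TangentSpace (𝓡 4) p →L[ℝ] TangentSpace (𝓡 4) p →L[ℝ] ℝ)
        (φ.symm y) (g.inner (φ.symm y))) φ.target :=
    g.contMDiff.comp_contMDiffOn hs
  have h3 : ContMDiffOn (𝓡 4) ((𝓡 4).prod 𝓘(ℝ, ℝ)) ∞ (fun y => Bundle.TotalSpace.mk' ℝ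
      (E := Bundle.Trivial M ℝ) (φ.symm y) (inChart g.inner φ y i j)) φ.target :=
    ContMDiffOn.clm_bundle_apply₂ (F₁ := Coord) (F₂ := Coord) hg (hv i) (hv j)
  refine contMDiffOn_iff_contDiffOn.1 fun y hy => ?_
  have h4 := h3 y hy
  simp only [Bundle.contMDiffWithinAt_totalSpace] at h4
  exact h4.2

lemma isMetricOn_inChart (hφ : φ ∈ atlas Coord M) : IsMetricOn (inChart g.inner φ) φ.target := by
  refine ⟨φ.open_target, smooth_inChart g hφ, fun y hy => ?_⟩
  refine Matrix.PosDef.of_dotProduct_mulVec_pos ?_ fun w hw => ?_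
  · ext i j
    simp only [Matrix.conjTranspose_apply, star_trivial, inChart_apply]
    exact g.symm _ _ _
  · set w₂ : Coord := WithLp.toLp 2 w with hw₂
    have h0 : mfderiv (𝓡 4) (𝓡 4) φ.symm y w₂ ≠ 0 := by
      intro h0
      have h1 : w₂ = 0 := mfderiv_symm_injective hφ hy (h0.trans (map_zero _).symm)
      exact hw (by simpa [hw₂] using h1)
    have h2 := g.pos _ _ h0
    rw [← sum_mfderiv_symm, bilin_sum] at h2
    refine lt_of_lt_of_eq h2 ?_
    simp only [star_trivial, dotProduct, Matrix.mulVec, Finset.mul_sum, inChart_apply]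
    exact Finset.sum_congr rfl fun i _ => Finset.sum_congr rfl fun j _ => by
      simp only [hw₂]
      ring

/-- The transition map between two charts. -/
def transMap (φ φ' : OpenPartialHomeomorph M Coord) (y : Coord) : Coord := φ' (φ.symm y)

lemma contDiffOn_trans (hφ : φ ∈ atlas Coord M) (hφ' : φ' ∈ atlas Coord M) :
    ContDiffOn ℝ ∞ (transMap φ φ') (φ.target ∩ φ.symm ⁻¹' φ'.source) := by
  have h1 : ContMDiffOn (𝓡 4) (𝓡 4) ∞ φ' φ'.source :=
    contMDiffOn_of_mem_maximalAtlas (IsManifold.subset_maximalAtlas hφ')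
  exact contMDiffOn_iff_contDiffOn.1 (h1.comp ((contMDiffOn_chart_symm' hφ).mono fun y hy => hy.1)
    fun y hy => hy.2)

lemma inChart_trans (h : BilinField M) (hφ : φ ∈ atlas Coord M) (hφ' : φ' ∈ atlas Coord M)
    (hx : x ∈ φ.target ∩ φ.symm ⁻¹' φ'.source) :
    inChart h φ x = (jac (transMap φ φ') x)ᵀ * inChart h φ' (transMap φ φ' x) * jac (transMap φ φ') x := by
  have hO : IsOpen (φ.target ∩ φ.symm ⁻¹' φ'.source) :=
    φ.symm.isOpen_inter_preimage φ'.open_source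
  have hF := contDiffOn_trans hφ hφ'
  have hd : DifferentiableAt ℝ (transMap φ φ') x :=
    (hF.differentiableOn (by simp)).differentiableAt (hO.mem_nhds hx)
  have hp : φ'.symm (transMap φ φ' x) = φ.symm x := φ'.left_inv hx.2
  have ht : transMap φ φ' x ∈ φ'.target := φ'.map_source hx.2
  have hm : MDifferentiableAt (𝓡 4) (𝓡 4) φ'.symm (transMap φ φ' x) :=
    ((contMDiffOn_chart_symm' hφ').contMDiffAt (φ'.open_target.mem_nhds ht)).mdifferentiableAt
      (by simp)
  have key : ∀ k, (mfderiv (𝓡 4) (𝓡 4) φ.symm x (dirVec k) : Coord) =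
      ∑ a, jac (transMap φ φ') x a k •
        (mfderiv (𝓡 4) (𝓡 4) φ'.symm (transMap φ φ' x) (dirVec a) : Coord) := by
    intro k
    have e1 : φ.symm =ᶠ[nhds x] φ'.symm ∘ transMap φ φ' :=
      Filter.eventuallyEq_of_mem (hO.mem_nhds hx) fun y hy => (φ'.left_inv hy.2).symm
    have e2 : mfderiv (𝓡 4) (𝓡 4) φ.symm x = mfderiv (𝓡 4) (𝓡 4) (φ'.symm ∘ transMap φ φ') x :=
      e1.mfderiv_eq
    have e3 : mfderiv (𝓡 4) (𝓡 4) (φ'.symm ∘ transMap φ φ') x (dirVec k) =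
        mfderiv (𝓡 4) (𝓡 4) φ'.symm (transMap φ φ' x) (fderiv ℝ (transMap φ φ') x (dirVec k)) := by
      rw [mfderiv_comp x hm hd.mdifferentiableAt, mfderiv_eq_fderiv]
      rfl
    have e4 := sum_mfderiv_symm φ' (transMap φ φ' x) (fderiv ℝ (transMap φ φ') x (dirVec k))
    simp only [fderiv_dirVec hO hx hF] at e4
    have e5 : (mfderiv (𝓡 4) (𝓡 4) φ.symm x (dirVec k) : Coord) =
        mfderiv (𝓡 4) (𝓡 4) (φ'.symm ∘ transMap φ φ') x (dirVec k) := by rw [e2]; rfl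
    exact e5.trans (e3.trans e4.symm)
  ext i j
  have e : inChart h φ x i j = ∑ a, ∑ b, jac (transMap φ φ') x a i * jac (transMap φ φ') x b j *
      inChart h φ' (transMap φ φ' x) a b := by
    simp only [inChart_apply]
    rw [← bilin_sum]
    -- The base points seen through the two charts agree only by a proved equation, so the bilinear
    -- form is transported along it.
    refine Eq.trans ?_ (bilin_congr h hp.symm _ _)
    rw [← key i, ← key j]
  rw [e]
  simp only [Matrix.mul_apply, Matrix.transpose_apply, Finset.sum_mul]
  rw [Finset.sum_comm]
  exact Finset.sum_congr rfl fun _ _ => Finset.sum_congr rfl fun _ _ => by ring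

end Manifold

end ASDGravity

end

/-! ### From coordinate domains to the manifold -/

noncomputable section

namespace ASDGravity

/-! ### The global theorem -/

section Manifold

variable {M : Type*} [TopologicalSpace M] [ChartedSpace Coord M] [IsManifold (𝓡 4) ∞ M]
  {φ φ' : OpenPartialHomeomorph M Coord}
  (g : Bundle.ContMDiffRiemannianMetric (𝓡 4) ∞ Coord (fun p : M => TangentSpace (𝓡 4) p))

lemma conditions_of_locallyConformallyRicciFlat (hASD : IsASD g.inner) (hne : WeylNeZero g.inner)
    (h : LocallyConformallyRicciFlat g.inner) (hφ : φ ∈ atlas Coord M) {x : Coord}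
    (hx : x ∈ φ.target) (e : SpinFrame (inChart g.inner φ) x) :
    (curvMatrix e).det = 0 ∧ ∀ E' E A B C A' : Fin 2,
      (∑ D, Xi e E' E A B C D * Vup e D A') - Theta e A B C E E' A' = 0 := by
  obtain ⟨U, hU, hxU, Ω, hΩ, hpos, hr⟩ := h (φ.symm x)
  set O : Set Coord := φ.target ∩ φ.symm ⁻¹' U with hOdef
  have hO : IsOpen O := φ.symm.isOpen_inter_preimage hU
  have hG : IsMetricOn (inChart g.inner φ) O :=
    (isMetricOn_inChart g hφ).mono hO Set.inter_subset_left
  have hs : Sm O (fun y => Ω (φ.symm y)) :=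
    contMDiffOn_iff_contDiffOn.1 (hΩ.comp ((contMDiffOn_chart_symm' hφ).mono fun y hy => hy.1)
      fun y hy => hy.2)
  -- The local results write the conformal factor as exp(f), so f is log Ω.
  have hf : Sm O (fun y => Real.log (Ω (φ.symm y))) :=
    ContDiffOn.log hs fun y hy => (hpos _ hy.2).ne'
  refine conditions_of_ricci_conf (K := inChart (fun q => (Ω q) ^ 2 • g.inner q) φ) (O := O)
    (fun y hy => ?_) hG hf (fun y hy => hASD φ hφ y hy.1) (hne φ hφ x hx)
    (fun y hy k j => hr φ hφ y hy.1 hy.2 k j) ⟨hx, hxU⟩ e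
  rw [inChart_smul, Real.exp_log (hpos _ hy.2)]

lemma locallyConformallyRicciFlat_of_conditions (hASD : IsASD g.inner) (hne : WeylNeZero g.inner)
    (hdet : ∀ φ ∈ atlas Coord M, ∀ x ∈ φ.target, ∀ e : SpinFrame (inChart g.inner φ) x,
      (curvMatrix e).det = 0)
    (hob : ∀ φ ∈ atlas Coord M, ∀ x ∈ φ.target, ∀ e : SpinFrame (inChart g.inner φ) x,
      ∀ E' E A B C A' : Fin 2, (∑ D, Xi e E' E A B C D * Vup e D A') - Theta e A B C E E' A' = 0) :
    LocallyConformallyRicciFlat g.inner := by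
  intro p
  set φ₀ := chartAt Coord p with hφ₀
  have hφ : φ₀ ∈ atlas Coord M := chart_mem_atlas Coord p
  -- A ball inside the chart, since the Poincaré lemma needs a convex domain.
  obtain ⟨r, hr, hB⟩ := Metric.isOpen_iff.1 φ₀.open_target (φ₀ p)
    (φ₀.map_source (mem_chart_source Coord p))
  set B := Metric.ball (φ₀ p) r with hBdef
  have hG : IsMetricOn (inChart g.inner φ₀) B := (isMetricOn_inChart g hφ).mono Metric.isOpen_ball hB
  obtain ⟨f, hf, hK⟩ := exists_ricci_conf_eq_zero hG (convex_ball _ _)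
    (fun y hy => hASD φ₀ hφ y (hB hy)) (fun y hy => hne φ₀ hφ y (hB hy))
    (fun y hy => hdet φ₀ hφ y (hB hy)) (fun y hy => hob φ₀ hφ y (hB hy))
  set Ω : M → ℝ := fun q => Real.exp (f (φ₀ q)) with hΩ
  refine ⟨φ₀.source ∩ φ₀ ⁻¹' B, φ₀.isOpen_inter_preimage Metric.isOpen_ball,
    ⟨mem_chart_source Coord p, Metric.mem_ball_self hr⟩, Ω, ?_, fun q _ => Real.exp_pos _, ?_⟩
  · have h1 : ContMDiffOn (𝓡 4) (𝓡 4) ∞ φ₀ φ₀.source :=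
      contMDiffOn_of_mem_maximalAtlas (IsManifold.subset_maximalAtlas hφ)
    exact (contMDiffOn_iff_contDiffOn.2 hf.exp).comp (h1.mono Set.inter_subset_left) fun q hq => hq.2
  · intro φ hφ' x hx hxU
    have hKc : IsConformal (inChart g.inner φ₀) (inChart (fun q => (Ω q) ^ 2 • g.inner q) φ₀) f B := by
      intro y hy
      rw [inChart_smul, hΩ]
      simp only [φ₀.right_inv (hB hy)]
    set O₂ : Set Coord := φ.target ∩ φ.symm ⁻¹' (φ₀.source ∩ φ₀ ⁻¹' B) with hO₂
    have hO : IsOpen O₂ :=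
      φ.symm.isOpen_inter_preimage (φ₀.isOpen_inter_preimage Metric.isOpen_ball)
    have hF : ContDiffOn ℝ ∞ (transMap φ φ₀) O₂ :=
      (contDiffOn_trans hφ' hφ).mono fun y hy => ⟨hy.1, hy.2.1⟩
    have hmaps : Set.MapsTo (transMap φ φ₀) O₂ B := fun y hy => hy.2.2
    have hKc₂ : IsConformal (inChart g.inner φ) (inChart (fun q => (Ω q) ^ 2 • g.inner q) φ)
        (fun y => f (transMap φ φ₀ y)) O₂ := fun y _ => inChart_smul Ω
    -- Ricci-flatness is required in every chart of the atlas but has been obtained in one; the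
    -- components elsewhere are pullbacks under transition maps.
    have hpull : IsPullback (transMap φ φ₀) (inChart (fun q => (Ω q) ^ 2 • g.inner q) φ₀)
        (inChart (fun q => (Ω q) ^ 2 • g.inner q) φ) B O₂ :=
      { metric := hKc.isMetricOn hG hf
        metric₂ := hKc₂.isMetricOn ((isMetricOn_inChart g hφ').mono hO Set.inter_subset_left)
          (hf.comp_map hF hmaps)
        smooth := hF
        mapsTo := hmaps
        eq := fun y hy => inChart_trans _ hφ' hφ ⟨hy.1, hy.2.1⟩ }
    exact hpull.ricci_eq_zero ⟨hx, hxU⟩ (hK _ hKc _ (hmaps ⟨hx, hxU⟩))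

end Manifold

end ASDGravity

end

theorem theorem3p1 {M : Type*} [TopologicalSpace M] [ChartedSpace ASDGravity.Coord M]
    [IsManifold (𝓡 4) ∞ M] (hM : ASDGravity.IsOrientedAtlas M)
    (g : Bundle.ContMDiffRiemannianMetric (𝓡 4) ∞ ASDGravity.Coord
      (fun p : M => TangentSpace (𝓡 4) p))
    (hASD : ASDGravity.IsASD g.inner) (hne : ASDGravity.WeylNeZero g.inner) :
    ASDGravity.LocallyConformallyRicciFlat g.inner ↔
      (∀ φ ∈ atlas ASDGravity.Coord M, ∀ x ∈ φ.target,
        ∀ e : ASDGravity.SpinFrame (ASDGravity.inChart g.inner φ) x,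
          (ASDGravity.curvMatrix e).det = 0) ∧
      (∀ φ ∈ atlas ASDGravity.Coord M, ∀ x ∈ φ.target,
        ∀ e : ASDGravity.SpinFrame (ASDGravity.inChart g.inner φ) x,
          ∀ E' E A B C A' : Fin 2,
            (∑ D, ASDGravity.Xi e E' E A B C D * ASDGravity.Vup e D A')
              - ASDGravity.Theta e A B C E E' A' = 0) := by
  constructor
  · intro h
    have key := fun φ (hφ : φ ∈ atlas ASDGravity.Coord M) x (hx : x ∈ φ.target) e =>
      ASDGravity.conditions_of_locallyConformallyRicciFlat g hASD hne h hφ hx e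
    exact ⟨fun φ hφ x hx e => (key φ hφ x hx e).1, fun φ hφ x hx e => (key φ hφ x hx e).2⟩
  · rintro ⟨hdet, hob⟩
    exact ASDGravity.locallyConformallyRicciFlat_of_conditions g hASD hne hdet hob
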